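/- Let $k$ be a field of characteristic $0$, let $V$ be a finite-dimensional $k$-vector space, and let $A=S(V)$ be the symmetric algebra of $V$, regarded as the (co)free commutative cocommutative bialgebra in which every $v\in V$ is primitive ($\Delta(v)=v\otimes 1+1\otimes v$, $\varepsilon(v)=0$). For a bialgebra $A$ with unit and counit, let $C^p_{\mathrm{GS}}(A)=\bigoplus_{m+n=p,\ m,n\ge 0}\operatorname{Hom}_k(A^{\otimes m},A^{\otimes n})$ be the Gerstenhaber–Schack complex, whose differential is $d_1+(-1)^m d_2$ on $\operatorname{Hom}_k(A^{\otimes m},A^{\otimes n})$, where for $\Psi\colon A^{\otimes m}\to A^{\otimes n}$ $$\begin{aligned}(d_1\Psi)(a_0\otimes\dots\otimes a_m)={}&\Delta^{n-1}(a_0)\,\Psi(a_1\otimes\dots\otimes a_m)+\sum_{i=0}^{m-1}(-1)^{i+1}\Psi(a_0\otimes\dots\otimes a_ia_{i+1}\otimes\dots\otimes a_m)\\&+(-1)^{m+1}\Psi(a_0\otimes\dots\otimes a_{m-1})\,\Delta^{n-1}(a_m),\end{aligned}$$ $$\begin{aligned}(d_2\Psi)(a_1\otimes\dots\otimes a_m)={}&(a_1^{(1)}\cdots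 a_m^{(1)})\otimes\Psi(a_1^{(2)}\otimes\dots\otimes a_m^{(2)})+\sum_{i=1}^{n}(-1)^i\Delta_i\Psi(a_1\otimes\dots\otimes a_m)\\&+(-1)^{n+1}\Psi(a_1^{(1)}\otimes\dots\otimes a_m^{(1)})\otimes(a_1^{(2)}\cdots a_m^{(2)}).\end{aligned}$$ Here $\Delta(a)=a^{(1)}\otimes a^{(2)}$ in Sweedler notation, $\Delta^{n-1}\colon A\to A^{\otimes n}$ is the iterated coproduct (the counit for $n=0$), and $\Delta_i$ applies $\Delta$ to the $i$-th tensor factor. Let $H^p_{\mathrm{GS}}(A)$ be the cohomology of this complex. Then for every integer $p\ge 0$ there is an isomorphism of $k$-vector spaces $$H^p_{\mathrm{GS}}(S(V))\;\cong\;\bigoplus_{i+j=p,\ i,j\ge 0}\Lambda^iV\otimes_k\Lambda^j(V^*).$$ -/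

import Mathlib

/-!
# The Gerstenhaber–Schack cohomology of a bialgebra

For a bialgebra `A` over a commutative ring `k`, the Gerstenhaber–Schack complex is the total
complex of the bicomplex `Hom_k(A^{⊗m}, A^{⊗n})`, `m, n ≥ 0`, whose two differentials are the
Hochschild (bar) and the cobar differential.
-/

open scoped TensorProduct

noncomputable section

namespace GerstenhaberSchack

variable (k : Type*) [CommRing k] (A : Type*) [Ring A]

section TensorPower

variable [Algebra k A]

/-- The isomorphism `A ⊗ A^{⊗n} ≃ A^{⊗(n+1)}`, `a ⊗ (a₁ ⊗ ⋯ ⊗ aₙ) ↦ a ⊗ a₁ ⊗ ⋯ ⊗ aₙ`. -/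
def cons (n : ℕ) : A ⊗[k] (⨂[k]^n A) ≃ₗ[k] ⨂[k]^(n + 1) A :=
  LinearEquiv.ofLinearMap
    (TensorProduct.lift
      ((PiTensorProduct.lift (R := k) (s := fun _ : Fin n => A)
          (E := ⨂[k]^(n + 1) A)).toLinearMap ∘ₗ
        (PiTensorProduct.tprod k (s := fun _ : Fin (n + 1) => A)).curryLeft))
    (PiTensorProduct.lift
      (LinearMap.uncurryLeft (M := fun _ : Fin (n + 1) => A) (M₂ := A ⊗[k] (⨂[k]^n A))
        { toFun := fun a =>
            (TensorProduct.mk k A (⨂[k]^n A) a).compMultilinearMap (PiTensorProduct.tprod k)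
          map_add' := fun a b => by ext; simp
          map_smul' := fun r a => by ext; simp [TensorProduct.smul_tmul'] }))
    (by
      ext a
      simp)
    (by
      ext a t
      simp)

/-- The isomorphism `A^{⊗n} ⊗ A ≃ A^{⊗(n+1)}`, `(a₁ ⊗ ⋯ ⊗ aₙ) ⊗ a ↦ a₁ ⊗ ⋯ ⊗ aₙ ⊗ a`. -/
def snoc (n : ℕ) : (⨂[k]^n A) ⊗[k] A ≃ₗ[k] ⨂[k]^(n + 1) A :=
  LinearEquiv.ofLinearMap
    (TensorProduct.lift
      (PiTensorProduct.lift (PiTensorProduct.tprod k (s := fun _ : Fin (n + 1) => A)).curryRight))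
    (PiTensorProduct.lift
      (MultilinearMap.uncurryRight (M := fun _ : Fin (n + 1) => A) (M₂ := (⨂[k]^n A) ⊗[k] A)
        ((TensorProduct.mk k (⨂[k]^n A) A).compMultilinearMap (PiTensorProduct.tprod k))))
    (by
      ext a
      simp)
    (by
      ext a t
      simp)

variable {k A}

lemma cons_tprod {n : ℕ} (a : A) (t : Fin n → A) :
    cons k A n (a ⊗ₜ PiTensorProduct.tprod k t) =
      PiTensorProduct.tprod k (Fin.cons a t : Fin (n + 1) → A) := by
  simp [cons]

lemma snoc_tprod {n : ℕ} (t : Fin n → A) (a : A) :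
    snoc k A n (PiTensorProduct.tprod k t ⊗ₜ a) =
      PiTensorProduct.tprod k (Fin.snoc t a : Fin (n + 1) → A) := by
  simp [snoc]

variable (k A)

/-- Multiplication of two neighbouring factors (positions `i` and `i + 1`, counted from `0`):
`a₀ ⊗ ⋯ ⊗ a_m ↦ a₀ ⊗ ⋯ ⊗ a_i * a_{i+1} ⊗ ⋯ ⊗ a_m`. -/
def mulAt : (m : ℕ) → Fin m → (⨂[k]^(m + 1) A →ₗ[k] ⨂[k]^m A)
  | 0, i => i.elim0
  | m + 1, i => Fin.cases (motive := fun _ => ⨂[k]^(m + 1 + 1) A →ₗ[k] ⨂[k]^(m + 1) A)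
      (((cons k A m).toLinearMap ∘ₗ (LinearMap.mul' k A).rTensor _) ∘ₗ
        (TensorProduct.assoc k A A (⨂[k]^m A)).symm.toLinearMap ∘ₗ
        (cons k A m).symm.toLinearMap.lTensor A ∘ₗ (cons k A (m + 1)).symm.toLinearMap)
      (fun j => (cons k A m).toLinearMap ∘ₗ (mulAt m j).lTensor A ∘ₗ
        (cons k A (m + 1)).symm.toLinearMap) i

end TensorPower

section Bialgebra

variable [Bialgebra k A]

/-- The comultiplication applied to the factor in position `i` (counted from `0`):
`a₀ ⊗ ⋯ ⊗ a_{n-1} ↦ a₀ ⊗ ⋯ ⊗ Δ(a_i) ⊗ ⋯ ⊗ a_{n-1}`. -/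
def comulAt : (n : ℕ) → Fin n → (⨂[k]^n A →ₗ[k] ⨂[k]^(n + 1) A)
  | 0, i => i.elim0
  | n + 1, i => Fin.cases (motive := fun _ => ⨂[k]^(n + 1) A →ₗ[k] ⨂[k]^(n + 1 + 1) A)
      ((cons k A (n + 1)).toLinearMap ∘ₗ (cons k A n).toLinearMap.lTensor A ∘ₗ
        (TensorProduct.assoc k A A (⨂[k]^n A)).toLinearMap ∘ₗ
        (Coalgebra.comul (R := k) (A := A)).rTensor _ ∘ₗ (cons k A n).symm.toLinearMap)
      (fun j => (cons k A (n + 1)).toLinearMap ∘ₗ (comulAt n j).lTensor A ∘ₗ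
        (cons k A n).symm.toLinearMap) i

/-- The iterated comultiplication `A → A^{⊗n}`, `a ↦ Δ^{n-1}(a) = a⁽¹⁾ ⊗ ⋯ ⊗ a⁽ⁿ⁾`. It is
the counit for `n = 0` and the identity for `n = 1`. -/
def comulPow : (n : ℕ) → (A →ₗ[k] ⨂[k]^n A)
  | 0 => Algebra.linearMap k (⨂[k]^0 A) ∘ₗ Coalgebra.counit
  | n + 1 => (cons k A n).toLinearMap ∘ₗ (comulPow n).lTensor A ∘ₗ Coalgebra.comul

/-- The left coaction of `A` on `A^{⊗m}`: `a₁ ⊗ ⋯ ⊗ a_m ↦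
(a₁⁽¹⁾ * ⋯ * a_m⁽¹⁾) ⊗ (a₁⁽²⁾ ⊗ ⋯ ⊗ a_m⁽²⁾)`. -/
def coactL : (m : ℕ) → (⨂[k]^m A →ₗ[k] A ⊗[k] (⨂[k]^m A))
  | 0 => TensorProduct.mk k A (⨂[k]^0 A) 1
  | m + 1 => TensorProduct.map (LinearMap.mul' k A) (cons k A m).toLinearMap ∘ₗ
      (TensorProduct.tensorTensorTensorComm k A A A (⨂[k]^m A)).toLinearMap ∘ₗ
      TensorProduct.map Coalgebra.comul (coactL m) ∘ₗ (cons k A m).symm.toLinearMap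

/-- The right coaction of `A` on `A^{⊗m}`: `a₁ ⊗ ⋯ ⊗ a_m ↦
(a₁⁽¹⁾ ⊗ ⋯ ⊗ a_m⁽¹⁾) ⊗ (a₁⁽²⁾ * ⋯ * a_m⁽²⁾)`. -/
def coactR : (m : ℕ) → (⨂[k]^m A →ₗ[k] (⨂[k]^m A) ⊗[k] A)
  | 0 => (TensorProduct.mk k (⨂[k]^0 A) A).flip 1
  | m + 1 => TensorProduct.map (cons k A m).toLinearMap (LinearMap.mul' k A) ∘ₗ
      (TensorProduct.tensorTensorTensorComm k A A (⨂[k]^m A) A).toLinearMap ∘ₗ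
      TensorProduct.map Coalgebra.comul (coactR m) ∘ₗ (cons k A m).symm.toLinearMap

variable {k A}

/-- `a₀ ⊗ ⋯ ⊗ a_m ↦ Δ^{n-1}(a₀) * Ψ(a₁ ⊗ ⋯ ⊗ a_m)`. -/
def faceL {m n : ℕ} (Ψ : ⨂[k]^m A →ₗ[k] ⨂[k]^n A) : ⨂[k]^(m + 1) A →ₗ[k] ⨂[k]^n A :=
  LinearMap.mul' k (⨂[k]^n A) ∘ₗ TensorProduct.map (comulPow k A n) Ψ ∘ₗ
    (cons k A m).symm.toLinearMap

/-- `a₀ ⊗ ⋯ ⊗ a_m ↦ Ψ(a₀ ⊗ ⋯ ⊗ a_{m-1}) * Δ^{n-1}(a_m)`. -/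
def faceR {m n : ℕ} (Ψ : ⨂[k]^m A →ₗ[k] ⨂[k]^n A) : ⨂[k]^(m + 1) A →ₗ[k] ⨂[k]^n A :=
  LinearMap.mul' k (⨂[k]^n A) ∘ₗ TensorProduct.map Ψ (comulPow k A n) ∘ₗ
    (snoc k A m).symm.toLinearMap

/-- The Hochschild part `Hom(A^{⊗m}, A^{⊗n}) → Hom(A^{⊗(m+1)}, A^{⊗n})` of the
Gerstenhaber–Schack differential. -/
def d₁ {m n : ℕ} (Ψ : ⨂[k]^m A →ₗ[k] ⨂[k]^n A) : ⨂[k]^(m + 1) A →ₗ[k] ⨂[k]^n A :=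
  faceL Ψ + ∑ i : Fin m, (-1 : k) ^ (i.val + 1) • (Ψ ∘ₗ mulAt k A m i) +
    (-1 : k) ^ (m + 1) • faceR Ψ

/-- `a₁ ⊗ ⋯ ⊗ a_m ↦ (a₁⁽¹⁾ * ⋯ * a_m⁽¹⁾) ⊗ Ψ(a₁⁽²⁾ ⊗ ⋯ ⊗ a_m⁽²⁾)`. -/
def cofaceL {m n : ℕ} (Ψ : ⨂[k]^m A →ₗ[k] ⨂[k]^n A) : ⨂[k]^m A →ₗ[k] ⨂[k]^(n + 1) A :=
  (cons k A n).toLinearMap ∘ₗ Ψ.lTensor A ∘ₗ coactL k A m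

/-- `a₁ ⊗ ⋯ ⊗ a_m ↦ Ψ(a₁⁽¹⁾ ⊗ ⋯ ⊗ a_m⁽¹⁾) ⊗ (a₁⁽²⁾ * ⋯ * a_m⁽²⁾)`. -/
def cofaceR {m n : ℕ} (Ψ : ⨂[k]^m A →ₗ[k] ⨂[k]^n A) : ⨂[k]^m A →ₗ[k] ⨂[k]^(n + 1) A :=
  (snoc k A n).toLinearMap ∘ₗ Ψ.rTensor A ∘ₗ coactR k A m

/-- The cobar part `Hom(A^{⊗m}, A^{⊗n}) → Hom(A^{⊗m}, A^{⊗(n+1)})` of the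
Gerstenhaber–Schack differential. -/
def d₂ {m n : ℕ} (Ψ : ⨂[k]^m A →ₗ[k] ⨂[k]^n A) : ⨂[k]^m A →ₗ[k] ⨂[k]^(n + 1) A :=
  cofaceL Ψ + ∑ i : Fin n, (-1 : k) ^ (i.val + 1) • (comulAt k A n i ∘ₗ Ψ) +
    (-1 : k) ^ (n + 1) • cofaceR Ψ

lemma d₁_add {m n : ℕ} (Φ Ψ : ⨂[k]^m A →ₗ[k] ⨂[k]^n A) : d₁ (Φ + Ψ) = d₁ Φ + d₁ Ψ := by
  simp only [d₁, faceL, faceR, TensorProduct.map_add_left, TensorProduct.map_add_right,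
    LinearMap.add_comp, LinearMap.comp_add, smul_add, Finset.sum_add_distrib]
  abel

lemma d₁_smul {m n : ℕ} (r : k) (Ψ : ⨂[k]^m A →ₗ[k] ⨂[k]^n A) : d₁ (r • Ψ) = r • d₁ Ψ := by
  simp only [d₁, faceL, faceR, TensorProduct.map_smul_left, TensorProduct.map_smul_right,
    LinearMap.smul_comp, LinearMap.comp_smul, smul_add, Finset.smul_sum, smul_comm r]

lemma d₂_add {m n : ℕ} (Φ Ψ : ⨂[k]^m A →ₗ[k] ⨂[k]^n A) : d₂ (Φ + Ψ) = d₂ Φ + d₂ Ψ := by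
  simp only [d₂, cofaceL, cofaceR, LinearMap.lTensor_add, LinearMap.rTensor_add,
    LinearMap.add_comp, LinearMap.comp_add, smul_add, Finset.sum_add_distrib]
  abel

lemma d₂_smul {m n : ℕ} (r : k) (Ψ : ⨂[k]^m A →ₗ[k] ⨂[k]^n A) : d₂ (r • Ψ) = r • d₂ Ψ := by
  simp only [d₂, cofaceL, cofaceR, LinearMap.lTensor_smul, LinearMap.rTensor_smul,
    LinearMap.smul_comp, LinearMap.comp_smul, smul_add, Finset.smul_sum, smul_comm r]

variable (k A)

/-- Families `(Ψ_{m,n})` with `Ψ_{m,n} ∈ Hom_k(A^{⊗m}, A^{⊗n})`, for all `m, n ≥ 0`. -/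
def Bicochain : Type _ := (m n : ℕ) → (⨂[k]^m A →ₗ[k] ⨂[k]^n A)

instance : AddCommGroup (Bicochain k A) :=
  inferInstanceAs (AddCommGroup ((m n : ℕ) → (⨂[k]^m A →ₗ[k] ⨂[k]^n A)))

instance : Module k (Bicochain k A) :=
  inferInstanceAs (Module k ((m n : ℕ) → (⨂[k]^m A →ₗ[k] ⨂[k]^n A)))

variable {k A} in
@[ext] lemma Bicochain.ext {Φ Ψ : Bicochain k A} (h : ∀ m n, Φ m n = Ψ m n) : Φ = Ψ :=
  funext fun m => funext fun n => h m n

variable {k A} in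
@[simp] lemma Bicochain.zero_apply (m n : ℕ) : (0 : Bicochain k A) m n = 0 := rfl

variable {k A} in
@[simp] lemma Bicochain.add_apply (Φ Ψ : Bicochain k A) (m n : ℕ) :
    (Φ + Ψ) m n = Φ m n + Ψ m n := rfl

variable {k A} in
@[simp] lemma Bicochain.smul_apply (r : k) (Ψ : Bicochain k A) (m n : ℕ) :
    (r • Ψ) m n = r • Ψ m n := rfl

variable {k A} in
/-- The total differential of a family `Ψ`, written out in each bidegree. -/
def differentialAux (Ψ : Bicochain k A) : Bicochain k A
  | 0, 0 => 0
  | m + 1, 0 => d₁ (Ψ m 0)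
  | 0, n + 1 => d₂ (Ψ 0 n)
  | m + 1, n + 1 => d₁ (Ψ m (n + 1)) + (-1 : k) ^ (m + 1) • d₂ (Ψ (m + 1) n)

/-- The Gerstenhaber–Schack differential `d₁ + (-1)^m d₂` on `Hom_k(A^{⊗m}, A^{⊗n})`; the sign
makes the two (commuting) differentials anticommute. -/
def differential : Bicochain k A →ₗ[k] Bicochain k A where
  toFun := differentialAux
  map_add' Φ Ψ := by
    ext1 m n
    rw [Bicochain.add_apply]
    cases m <;> cases n <;> simp only [differentialAux, Bicochain.add_apply, d₁_add, d₂_add,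
      smul_add, add_zero]
    abel
  map_smul' r Ψ := by
    ext1 m n
    rw [Bicochain.smul_apply]
    cases m <;> cases n <;> simp [differentialAux, d₁_smul, d₂_smul, smul_comm r]

variable {k A}

@[simp] lemma differential_zero_zero (Ψ : Bicochain k A) : differential k A Ψ 0 0 = 0 := rfl

@[simp] lemma differential_succ_zero (Ψ : Bicochain k A) (m : ℕ) :
    differential k A Ψ (m + 1) 0 = d₁ (Ψ m 0) := rfl

@[simp] lemma differential_zero_succ (Ψ : Bicochain k A) (n : ℕ) :
    differential k A Ψ 0 (n + 1) = d₂ (Ψ 0 n) := rfl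

@[simp] lemma differential_succ_succ (Ψ : Bicochain k A) (m n : ℕ) :
    differential k A Ψ (m + 1) (n + 1) =
      d₁ (Ψ m (n + 1)) + (-1 : k) ^ (m + 1) • d₂ (Ψ (m + 1) n) := rfl

variable (k A)

/-- The Gerstenhaber–Schack cochains of degree `p`: the subspace
`⨁_{m+n=p} Hom_k(A^{⊗m}, A^{⊗n})` of families supported in the bidegrees `m + n = p`. -/
def cochains (p : ℕ) : Submodule k (Bicochain k A) where
  carrier := {Ψ | ∀ m n, m + n ≠ p → Ψ m n = 0}
  zero_mem' := fun _ _ _ => rfl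
  add_mem' := fun hΦ hΨ m n h => by rw [Bicochain.add_apply, hΦ m n h, hΨ m n h, add_zero]
  smul_mem' := fun r Ψ hΨ m n h => by rw [Bicochain.smul_apply, hΨ m n h, smul_zero]

/-- The cocycles of degree `p`. -/
def cocycles (p : ℕ) : Submodule k (Bicochain k A) :=
  cochains k A p ⊓ LinearMap.ker (differential k A)

/-- The coboundaries of degree `p`: the image of the cochains of degree `p - 1` (zero if `p = 0`). -/
def coboundaries : ℕ → Submodule k (Bicochain k A)
  | 0 => ⊥
  | p + 1 => (cochains k A p).map (differential k A)

/-- The Gerstenhaber–Schack cohomology `H^p_GS(A)`: cocycles modulo coboundaries. -/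
abbrev cohomology (p : ℕ) : Type _ :=
  cocycles k A p ⧸ (coboundaries k A p).submoduleOf (cocycles k A p)

end Bialgebra

end GerstenhaberSchack

end

/-! The coefficients can be made trivial by a change of variables. Let `x ↦ x⁽⁻¹⁾ ⊗ x⁽⁰⁾` be the
diagonal coaction of `A` on `A^{⊗m}`, and send `Φ` to its `twist`, `x ↦ Δ^{n-1}(x⁽⁻¹⁾) * Φ(x⁽⁰⁾)`.
The antipode provides the inverse. Since `A` is commutative and cocommutative, the twist turns `d₁`
into precomposition with the bar differential `barD` with trivial coefficients, and `d₂` into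
postcomposition with the cobar differential `cobarD` (`d₁_twist`, `d₂_twist`,
`differential_twistAll`). The Gerstenhaber–Schack complex is thereby the total complex of Hom(bar,
cobar).

Over a field both complexes split: each is homotopic to its image under projections `π`, `π'` that
annihilate the differentials (`exists_splitting`, `exists_cosplitting`). The two homotopies combine
into one on the total complex, from the identity to `Ψ ↦ π' Ψ π` (`homDifferential_homotopy`). So
the cohomology in degree `p` is the sum over `i + j = p` of Hom(im `π i`, im `π' j`)
(`nonempty_cohomology_equiv`).

It remains to find the dimensions of these images, that is, the homology of the two complexes. For
the bar complex, take the bicomplex `Λ^q ⊗ A^{⊗(p+1)}` with the bar-resolution differential in `p`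
and the Koszul differential on the first factor in `q`. By Euler's identity, with degrees inverted
in characteristic zero, the columns contract onto the bar complex. The rows contract onto `Λ^q` with
zero differential. Hence the homology is `Λ^n` (`nonempty_homology_barD_equiv`). For the cobar
complex the same works with the de Rham differential in place of the Koszul one, after dualising so
that the same chain-complex lemma applies (`nonempty_homology_dualMap_cobarD_equiv`).

Both images have dimension `d.choose n` with `d = dim V`, and the isomorphism follows by comparing
finite dimensions. -/

noncomputable section

namespace GerstenhaberSchack

/-! ### First quadrant bicomplexes with contractible columns or rows. -/

section Bicomplex

variable {k : Type*} [CommRing k]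

section Homology

variable {B : ℕ → Type*} [∀ n, AddCommGroup (B n)] [∀ n, Module k (B n)]

/-- The cycles of a nonnegatively graded chain complex. -/
def cycles (f : ∀ n, B (n + 1) →ₗ[k] B n) : ∀ n, Submodule k (B n)
  | 0 => ⊤
  | n + 1 => LinearMap.ker (f n)

/-- The homology of a nonnegatively graded chain complex. -/
abbrev homology (f : ∀ n, B (n + 1) →ₗ[k] B n) (n : ℕ) : Type _ :=
  cycles f n ⧸ (LinearMap.range (f n)).submoduleOf (cycles f n)

/-- A surjection of submodules which identifies two submodules of them induces an isomorphism of
the quotients. -/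
lemma nonempty_quotient_equiv {M N : Type*} [AddCommGroup M] [Module k M] [AddCommGroup N]
    [Module k N] {Z Y : Submodule k M} {Z' Y' : Submodule k N} (f : M →ₗ[k] N)
    (hf : ∀ z ∈ Z, f z ∈ Z') (hs : ∀ z' ∈ Z', ∃ z ∈ Z, f z - z' ∈ Y')
    (hY : ∀ z ∈ Z, z ∈ Y ↔ f z ∈ Y') :
    Nonempty ((Z ⧸ Y.submoduleOf Z) ≃ₗ[k] (Z' ⧸ Y'.submoduleOf Z')) := by
  have hle : Y.submoduleOf Z ≤ (Y'.submoduleOf Z').comap (f.restrict hf) := by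
    intro z hz
    exact (hY z.1 z.2).1 hz
  refine ⟨LinearEquiv.ofBijective (Submodule.mapQ _ _ (f.restrict hf) hle) ⟨?_, ?_⟩⟩
  · rw [injective_iff_map_eq_zero]
    intro x
    obtain ⟨z, rfl⟩ := Submodule.Quotient.mk_surjective _ x
    intro h
    rw [Submodule.mapQ_apply, Submodule.Quotient.mk_eq_zero] at h
    rw [Submodule.Quotient.mk_eq_zero]
    exact (hY z.1 z.2).2 h
  · intro x
    obtain ⟨z', rfl⟩ := Submodule.Quotient.mk_surjective _ x
    obtain ⟨z, hz, h⟩ := hs z'.1 z'.2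
    refine ⟨Submodule.Quotient.mk ⟨z, hz⟩, ?_⟩
    rw [Submodule.mapQ_apply, Submodule.Quotient.eq]
    exact h

/-- The quotient of a submodule by the zero submodule. -/
def quotientBotEquiv {M : Type*} [AddCommGroup M] [Module k M] (Z : Submodule k M) :
    (Z ⧸ (⊥ : Submodule k M).submoduleOf Z) ≃ₗ[k] Z :=
  Submodule.quotEquivOfEqBot _ (by rw [Submodule.submoduleOf, Submodule.comap_bot]; simp)

/-- The homology of a complex with zero differential. -/
lemma nonempty_homology_zero (n : ℕ) :
    Nonempty (homology (fun n => (0 : B (n + 1) →ₗ[k] B n)) n ≃ₗ[k] B n) := by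
  have h : Nonempty (((⊤ : Submodule k (B n)) ⧸ (⊥ : Submodule k (B n)).submoduleOf ⊤) ≃ₗ[k]
      homology (fun n => (0 : B (n + 1) →ₗ[k] B n)) n) := by
    refine nonempty_quotient_equiv LinearMap.id ?_ ?_ ?_
    · intro z _
      cases n <;> simp [cycles]
    · intro z _
      exact ⟨z, trivial, by simp⟩
    · intro z _
      simp
  obtain ⟨e⟩ := h
  exact ⟨e.symm ≪≫ₗ quotientBotEquiv _ ≪≫ₗ Submodule.topEquiv⟩

end Homology

variable {E : ℕ → ℕ → Type*} [∀ p q, AddCommGroup (E p q)] [∀ p q, Module k (E p q)]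

/-- The total differential of a first quadrant bicomplex with anticommuting differentials. -/
def totalD (d' : ∀ p q, E (p + 1) q →ₗ[k] E p q) (d'' : ∀ p q, E p (q + 1) →ₗ[k] E p q) :
    (∀ p q, E p q) →ₗ[k] (∀ p q, E p q) where
  toFun f p q := d' p q (f (p + 1) q) + d'' p q (f p (q + 1))
  map_add' f g := by
    ext p q
    simp only [Pi.add_apply, map_add]
    abel
  map_smul' r f := by
    ext p q
    simp

variable (k E) in
/-- The families supported in total degree `n`. -/
def homogeneous (n : ℕ) : Submodule k (∀ p q, E p q) where
  carrier := {f | ∀ p q, p + q ≠ n → f p q = 0}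
  zero_mem' := fun _ _ _ => rfl
  add_mem' := fun hf hg p q h => by simp [hf p q h, hg p q h]
  smul_mem' := fun r f hf p q h => by simp [hf p q h]

variable {B : ℕ → Type*} [∀ n, AddCommGroup (B n)] [∀ n, Module k (B n)]
  {d' : ∀ p q, E (p + 1) q →ₗ[k] E p q} {d'' : ∀ p q, E p (q + 1) →ₗ[k] E p q}
  {f : ∀ p, B (p + 1) →ₗ[k] B p}

lemma totalD_apply (g : ∀ p q, E p q) (p q : ℕ) :
    totalD d' d'' g p q = d' p q (g (p + 1) q) + d'' p q (g p (q + 1)) := rfl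

lemma totalD_mem {n : ℕ} {g : ∀ p q, E p q} (hg : g ∈ homogeneous k E (n + 1)) :
    totalD d' d'' g ∈ homogeneous k E n := by
  intro p q h
  rw [totalD_apply, hg _ _ (by omega), hg _ _ (by omega)]
  simp

variable (d' d'' f) in
/-- A contraction of the columns of a bicomplex onto an augmentation. -/
structure ColumnContraction where
  /-- the augmentation -/
  aug : ∀ p, E p 0 →ₗ[k] B p
  /-- a section of the augmentation -/
  sec : ∀ p, B p →ₗ[k] E p 0
  /-- the contracting homotopy -/
  t : ∀ p q, E p q →ₗ[k] E p (q + 1)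
  aug_sec : ∀ p b, aug p (sec p b) = b
  aug_vert : ∀ p x, aug p (d'' p 0 x) = 0
  aug_horiz : ∀ p x, aug p (d' p 0 x) = f p (aug (p + 1) x)
  t_zero : ∀ p x, d'' p 0 (t p 0 x) = x - sec p (aug p x)
  t_succ : ∀ p q x, d'' p (q + 1) (t p (q + 1) x) + t p q (d'' p q x) = x

namespace ColumnContraction

variable (C : ColumnContraction d' d'' f)

/-- The contracting homotopy on families. -/
def shift (g : ∀ p q, E p q) : ∀ p q, E p q
  | _, 0 => 0
  | p, q + 1 => C.t p q (g p q)

-- A staircase argument: the rows of the residual `z - D y` are cleared one at a time, each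
-- correction being the column homotopy applied to the current residual. Keeping `y` zero in the
-- bottom row is what later allows a lift to be corrected without changing its augmentation.
include C in
theorem exists_totalD_eq (hD : ∀ g, totalD d' d'' (totalD d' d'' g) = 0) {n : ℕ}
    {z : ∀ p q, E p q} (hz : z ∈ homogeneous k E n) (hz0 : totalD d' d'' z = 0)
    (ha : ∀ p, C.aug p (z p 0) = 0) :
    ∃ y ∈ homogeneous k E (n + 1), (∀ p, y p 0 = 0) ∧ totalD d' d'' y = z := by
  have key : ∀ j, ∃ y ∈ homogeneous k E (n + 1), (∀ p, y p 0 = 0) ∧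
      ∀ p q, q < j → (z - totalD d' d'' y) p q = 0 := by
    intro j
    induction j with
    | zero => exact ⟨0, zero_mem _, fun _ => rfl, fun _ _ h => absurd h (Nat.not_lt_zero _)⟩
    | succ j ih =>
      obtain ⟨y, hy, hy0, hyj⟩ := ih
      set r := z - totalD d' d'' y with hr
      have hrn : r ∈ homogeneous k E n := sub_mem hz (totalD_mem hy)
      have hr0 : totalD d' d'' r = 0 := by rw [hr, map_sub, hz0, hD, sub_zero]
      -- As `y` has no bottom row, `D y` meets the bottom row only in vertical boundaries, which the
      -- augmentation kills.
      have hra : ∀ p, C.aug p (r p 0) = 0 := by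
        intro p
        simp [hr, totalD_apply, ha, hy0, C.aug_vert]
      refine ⟨y + C.shift r, add_mem hy ?_, ?_, ?_⟩
      · rintro p (_ | q) h
        · rfl
        · change C.t p q (r p q) = 0
          rw [hrn p q (by omega), map_zero]
      · intro p
        simp [hy0, shift]
      · have e : z - totalD d' d'' (y + C.shift r) = r - totalD d' d'' (C.shift r) := by
          rw [map_add, hr]
          abel
        rw [e]
        rintro p (_ | q) h
        · simp [totalD_apply, shift, C.t_zero, hra]
        · have h1 : d'' p q (r p (q + 1)) = - d' p q (r (p + 1) q) := by
            have := congrFun (congrFun hr0 p) q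
            rw [totalD_apply] at this
            exact eq_neg_of_add_eq_zero_right this
          have h2 := C.t_succ p q (r p (q + 1))
          have h3 : r (p + 1) q = 0 := hyj _ _ (by omega)
          rw [h1, h3] at h2
          simp only [map_zero, neg_zero, add_zero] at h2
          simp [totalD_apply, shift, h3, h2]
  -- A family of total degree `n` lives in the rows `q ≤ n`, so `n + 1` steps clear everything.
  obtain ⟨y, hy, hy0, hyj⟩ := key (n + 1)
  refine ⟨y, hy, hy0, ?_⟩
  have : z - totalD d' d'' y = 0 := by
    ext p q
    by_cases h : p + q = n
    · exact hyj p q (by omega)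
    · exact (sub_mem hz (totalD_mem hy)) p q h
  exact (sub_eq_zero.1 this).symm

include C in
/-- The homology of the total complex is the homology of the augmentation. -/
theorem nonempty_total_equiv (hD : ∀ g, totalD d' d'' (totalD d' d'' g) = 0) (n : ℕ) :
    Nonempty (((homogeneous k E n ⊓ LinearMap.ker (totalD d' d'') : Submodule k (∀ p q, E p q)) ⧸
      ((homogeneous k E (n + 1)).map (totalD d' d'')).submoduleOf
        (homogeneous k E n ⊓ LinearMap.ker (totalD d' d''))) ≃ₗ[k] homology f n) := by
  have haD : ∀ (y : ∀ p q, E p q) p, C.aug p (totalD d' d'' y p 0) = f p (C.aug (p + 1) (y (p + 1) 0)) := by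
    intro y p
    rw [totalD_apply, map_add, C.aug_vert, C.aug_horiz, add_zero]
  have single : ∀ n (b : B n), ∃ g ∈ homogeneous k E n, g n 0 = C.sec n b := by
    intro n b
    refine ⟨Pi.single n (Pi.single 0 (C.sec n b)), ?_, by simp⟩
    intro p q h
    by_cases hp : p = n
    · subst hp
      simp only [Pi.single_eq_same]
      exact Pi.single_eq_of_ne (by omega) _
    · rw [Pi.single_eq_of_ne hp]
      rfl
  refine nonempty_quotient_equiv (C.aug n ∘ₗ LinearMap.proj 0 ∘ₗ LinearMap.proj n) ?_ ?_ ?_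
  · rintro z ⟨hz, hz0⟩
    cases n with
    | zero => trivial
    | succ n =>
      have := haD z n
      rw [LinearMap.mem_ker.1 hz0] at this
      simpa [cycles] using this.symm
  · intro b hb
    obtain ⟨g, hg, hgb⟩ := single n b
    -- The lift `g` of the cycle `b` need not be a total cycle, but `D g` has zero augmentation.
    -- Subtracting `y` repairs this and leaves the bottom row intact. In degree 0 nothing needs
    -- repair.
    have hgD : ∃ y ∈ homogeneous k E n, (∀ p, y p 0 = 0) ∧ totalD d' d'' y = totalD d' d'' g := by
      cases n with
      | zero =>
        refine ⟨0, zero_mem _, fun _ => rfl, ?_⟩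
        ext p q
        rw [totalD_apply, totalD_apply, hg _ _ (by omega), hg _ _ (by omega)]
        rfl
      | succ n =>
        refine C.exists_totalD_eq hD (totalD_mem hg) (hD _) fun p => ?_
        rw [haD]
        by_cases hp : p = n
        · subst hp
          rw [hgb, C.aug_sec]
          exact hb
        · rw [hg _ _ (by omega)]
          simp
    obtain ⟨y, hy, hy0, hyg⟩ := hgD
    refine ⟨g - y, ⟨sub_mem hg hy, ?_⟩, ?_⟩
    · rw [SetLike.mem_coe, LinearMap.mem_ker, map_sub, hyg, sub_self]
    · simp [hgb, hy0, C.aug_sec]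
  · rintro z ⟨hz, hz0⟩
    constructor
    · rintro ⟨y, -, rfl⟩
      exact ⟨C.aug (n + 1) (y (n + 1) 0), (haD y n).symm⟩
    · rintro ⟨b, hb⟩
      -- If the augmentation of `z` bounds `b`, then `z - D g` has zero augmentation for any lift
      -- `g` of `b`, hence is a boundary.
      obtain ⟨g, hg, hgb⟩ := single (n + 1) b
      obtain ⟨y, hy, -, hyz⟩ := C.exists_totalD_eq hD (sub_mem hz (totalD_mem (d' := d')
        (d'' := d'') hg)) (by rw [map_sub, hz0, hD, sub_zero]) (fun p => by
          rw [Pi.sub_apply, Pi.sub_apply, map_sub, haD]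
          by_cases hp : p = n
          · subst hp
            rw [hgb, C.aug_sec, hb]
            simp
          · rw [hz _ _ (by omega), hg _ _ (by omega)]
            simp)
      exact ⟨y + g, add_mem hy hg, by rw [map_add, hyz, sub_add_cancel]⟩

end ColumnContraction

/-- If the columns of a bicomplex are contractible onto `B` and its rows are contractible onto
`L`, then `B` and `L` have isomorphic homology. -/
theorem nonempty_homology_equiv {L : ℕ → Type*} [∀ n, AddCommGroup (L n)] [∀ n, Module k (L n)]
    {g : ∀ p, L (p + 1) →ₗ[k] L p}
    (C : ColumnContraction d' d'' f)
    (R : ColumnContraction (E := fun p q => E q p) (fun p q => d'' q p) (fun p q => d' q p) g)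
    (h' : ∀ p q x, d' p q (d' (p + 1) q x) = 0) (h'' : ∀ p q x, d'' p q (d'' p (q + 1) x) = 0)
    (h : ∀ p q x, d' p q (d'' (p + 1) q x) + d'' p q (d' p (q + 1) x) = 0) (n : ℕ) :
    Nonempty (homology f n ≃ₗ[k] homology g n) := by
  have hD : ∀ g, totalD d' d'' (totalD d' d'' g) = 0 := by
    intro g
    ext p q
    have := h p q (g (p + 1) (q + 1))
    simp only [totalD_apply, map_add, h', h'', zero_add, add_zero]
    exact this
  -- Exchanging the two indices does not change the total complex, so it can be augmented along
  -- columns and along rows.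
  have hsw : ∀ g, totalD (E := fun p q => E q p) (fun p q => d'' q p) (fun p q => d' q p) g =
      fun p q => totalD d' d'' (fun p q => g q p) q p := by
    intro g
    ext p q
    simp only [totalD_apply]
    abel
  obtain ⟨e₁⟩ := C.nonempty_total_equiv hD n
  obtain ⟨e₂⟩ := R.nonempty_total_equiv (fun g => by rw [hsw, hsw]; ext p q; simp [hD]) n
  let sw : (∀ p q, E p q) →ₗ[k] (∀ p q, E q p) :=
    { toFun := fun f p q => f q p
      map_add' := fun _ _ => rfl
      map_smul' := fun _ _ => rfl }
  obtain ⟨e₃⟩ := nonempty_quotient_equiv (k := k)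
    (Z := homogeneous k E n ⊓ LinearMap.ker (totalD d' d''))
    (Y := (homogeneous k E (n + 1)).map (totalD d' d''))
    (Z' := homogeneous k (fun p q => E q p) n ⊓ LinearMap.ker
      (totalD (E := fun p q => E q p) (fun p q => d'' q p) (fun p q => d' q p)))
    (Y' := (homogeneous k (fun p q => E q p) (n + 1)).map
      (totalD (E := fun p q => E q p) (fun p q => d'' q p) (fun p q => d' q p))) sw
    (by
      rintro z ⟨hz, hz0⟩
      refine ⟨fun p q hpq => hz q p (by omega), ?_⟩
      rw [SetLike.mem_coe, LinearMap.mem_ker] at hz0 ⊢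
      rw [hsw]
      ext p q
      exact congrFun (congrFun hz0 q) p)
    (by
      rintro z ⟨hz, hz0⟩
      refine ⟨fun p q => z q p, ⟨fun p q hpq => hz q p (by omega), ?_⟩, ?_⟩
      · rw [SetLike.mem_coe, LinearMap.mem_ker] at hz0 ⊢
        rw [hsw] at hz0
        ext p q
        exact congrFun (congrFun hz0 q) p
      · have : sw (fun p q => z q p) - z = 0 := sub_self z
        rw [this]
        exact zero_mem _)
    (by
      rintro z -
      constructor
      · rintro ⟨y, hy, rfl⟩
        exact ⟨fun p q => y q p, fun p q hpq => hy q p (by omega), hsw _⟩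
      · rintro ⟨y, hy, hyz⟩
        refine ⟨fun p q => y q p, fun p q hpq => hy q p (by omega), ?_⟩
        rw [hsw] at hyz
        ext p q
        exact congrFun (congrFun hyz q) p)
  exact ⟨e₁.symm ≪≫ₗ e₃ ≪≫ₗ e₂⟩

end Bicomplex

/-! ### Splittings of complexes of vector spaces. -/

section Splitting

variable {k : Type*} [Field k]

/-- Compose a linear retraction of `W` onto the range of `f` with a linear section of `f` over its
range. -/
lemma exists_generalized_inverse {U W : Type*} [AddCommGroup U] [Module k U] [AddCommGroup W]
    [Module k W] (f : U →ₗ[k] W) : ∃ g : W →ₗ[k] U, f ∘ₗ g ∘ₗ f = f ∧ g ∘ₗ f ∘ₗ g = g := by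
  obtain ⟨s, hs⟩ := f.rangeRestrict.exists_rightInverse_of_surjective f.range_rangeRestrict
  obtain ⟨r, hr⟩ := (LinearMap.range f).subtype.exists_leftInverse_of_injective (Submodule.ker_subtype _)
  have hs' : ∀ y, f (s y) = y := fun y => congrArg Subtype.val (LinearMap.congr_fun hs y)
  have hr' : ∀ y : LinearMap.range f, r y = y := fun y => LinearMap.congr_fun hr y
  have h1 : ∀ x, f (s (r (f x))) = f x := fun x => by
    rw [hs']; exact congrArg Subtype.val (hr' ⟨f x, x, rfl⟩)
  refine ⟨s ∘ₗ r, LinearMap.ext h1, LinearMap.ext fun y => ?_⟩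
  simp only [LinearMap.comp_apply]
  rw [hs', hr']

variable {B : ℕ → Type*} [∀ n, AddCommGroup (B n)] [∀ n, Module k (B n)]

/-- The composite `B n → B (n - 1) → B n` of two families of maps, zero for `n = 0`. -/
def viaPred (f : ∀ n, B (n + 1) →ₗ[k] B n) (h : ∀ n, B n →ₗ[k] B (n + 1)) :
    ∀ n, B n →ₗ[k] B n
  | 0 => 0
  | n + 1 => h n ∘ₗ f n

/-- Homotopies and projections which split a complex: with `f` the differential of a chain
complex and `h` a homotopy, or with the roles of the two exchanged. -/
structure Splitting (f : ∀ n, B (n + 1) →ₗ[k] B n) (h : ∀ n, B n →ₗ[k] B (n + 1))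
    (π : ∀ n, B n →ₗ[k] B n) : Prop where
  homotopy : ∀ n, π n = LinearMap.id - f n ∘ₗ h n - viaPred f h n
  comp_comp : ∀ n, f n ∘ₗ h n ∘ₗ f n = f n
  comp_comp' : ∀ n, h n ∘ₗ f n ∘ₗ h n = h n
  differential : ∀ n, f n ∘ₗ f (n + 1) = 0
  homotopy_sq : ∀ n, h (n + 1) ∘ₗ h n = 0

namespace Splitting

variable {f : ∀ n, B (n + 1) →ₗ[k] B n} {h : ∀ n, B n →ₗ[k] B (n + 1)} {π : ∀ n, B n →ₗ[k] B n}
  (S : Splitting f h π)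

include S

lemma comp_apply (n : ℕ) (x) : f n (h n (f n x)) = f n x := LinearMap.congr_fun (S.comp_comp n) x
lemma comp_apply' (n : ℕ) (x) : h n (f n (h n x)) = h n x := LinearMap.congr_fun (S.comp_comp' n) x
lemma differential_apply (n : ℕ) (x) : f n (f (n + 1) x) = 0 :=
  LinearMap.congr_fun (S.differential n) x
lemma homotopy_sq_apply (n : ℕ) (x) : h (n + 1) (h n x) = 0 :=
  LinearMap.congr_fun (S.homotopy_sq n) x

/-- The relations make `f h` and `h f` orthogonal idempotents with complement `π`. Hence `π` is
idempotent, and composing it with `f` or `h` on either side gives zero; this and the next four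
lemmas record it. -/
lemma proj_f (n : ℕ) (x) : π n (f n x) = 0 := by
  rw [S.homotopy]
  cases n with
  | zero => simp [viaPred, S.comp_apply]
  | succ n => simp [viaPred, S.comp_apply, S.differential_apply]

lemma proj_h (n : ℕ) (x) : π (n + 1) (h n x) = 0 := by
  rw [S.homotopy]
  simp [viaPred, S.comp_apply', S.homotopy_sq_apply]

lemma f_proj (n : ℕ) (x) : f n (π (n + 1) x) = 0 := by
  rw [S.homotopy]
  simp [viaPred, S.comp_apply, S.differential_apply]

lemma h_proj (n : ℕ) (x) : h n (π n x) = 0 := by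
  rw [S.homotopy]
  cases n with
  | zero => simp [viaPred, S.comp_apply']
  | succ n => simp [viaPred, S.comp_apply', S.homotopy_sq_apply]

lemma proj_proj (n : ℕ) (x) : π n (π n x) = π n x := by
  have := LinearMap.congr_fun (S.homotopy n) (π n x)
  rw [this]
  cases n with
  | zero => simp [viaPred, S.h_proj]
  | succ n => simp [viaPred, S.h_proj, S.f_proj]

/-- On a cycle the `h f` term vanishes, so `z = f (h z) + π z`. Thus a cycle bounds exactly when `π`
kills it. -/
lemma nonempty_homology_equiv (n : ℕ) : Nonempty (homology f n ≃ₗ[k] LinearMap.range (π n)) := by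
  have hcyc : ∀ x, π n x ∈ cycles f n := by
    intro x
    cases n with
    | zero => trivial
    | succ n => exact S.f_proj n x
  obtain ⟨e⟩ : Nonempty (homology f n ≃ₗ[k] (LinearMap.range (π n) ⧸
      (⊥ : Submodule k (B n)).submoduleOf (LinearMap.range (π n)))) := by
    refine nonempty_quotient_equiv (π n) (fun z _ => ⟨z, rfl⟩) ?_ ?_
    · rintro _ ⟨x, rfl⟩
      exact ⟨π n x, hcyc x, by simp [S.proj_proj]⟩
    · intro z hz
      constructor
      · rintro ⟨y, rfl⟩
        exact S.proj_f n y
      · intro hz0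
        refine ⟨h n z, ?_⟩
        have h1 : π n z = 0 := hz0
        rw [S.homotopy] at h1
        have h2 : viaPred f h n z = 0 := by
          cases n with
          | zero => rfl
          | succ n =>
            have : f n z = 0 := hz
            simp [viaPred, this]
        simp only [LinearMap.sub_apply, LinearMap.id_apply, LinearMap.comp_apply, h2, sub_zero] at h1
        exact (sub_eq_zero.1 h1).symm
  exact ⟨e ≪≫ₗ quotientBotEquiv _⟩

/-- The dual of a splitting. -/
lemma dual : Splitting (B := fun n => Module.Dual k (B n)) (fun n => (h n).dualMap)
    (fun n => (f n).dualMap) (fun n => (π n).dualMap) where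
  homotopy n := by
    ext φ x
    have := LinearMap.congr_fun (S.homotopy n) x
    cases n <;> simp [viaPred, this]
  comp_comp n := by
    ext φ x
    simp [S.comp_apply']
  comp_comp' n := by
    ext φ x
    simp [S.comp_apply]
  differential n := by
    ext φ x
    simp [S.homotopy_sq_apply]
  homotopy_sq n := by
    ext φ x
    simp [S.differential_apply]

end Splitting

/-- Every chain complex over a field splits. -/
theorem exists_splitting {f : ∀ n, B (n + 1) →ₗ[k] B n} (hf : ∀ n, f n ∘ₗ f (n + 1) = 0) :
    ∃ h π, Splitting f h π := by
  choose g hg hg' using fun n => exists_generalized_inverse (f n)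
  have hfa : ∀ n x, f n (f (n + 1) x) = 0 := fun n x => LinearMap.congr_fun (hf n) x
  have hga : ∀ n x, f n (g n (f n x)) = f n x := fun n x => LinearMap.congr_fun (hg n) x
  have hga' : ∀ n x, g n (f n (g n x)) = g n x := fun n x => LinearMap.congr_fun (hg' n) x
  -- A generalized inverse `g` need not square to zero. The correction term forces `h h = 0` and,
  -- because `f f = 0`, preserves `f h f = f` and `h f h = h`.
  refine ⟨fun n => g n - f (n + 1) ∘ₗ g (n + 1) ∘ₗ g n, _, fun n => rfl, ?_, ?_, hf, ?_⟩
  all_goals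
    intro n
    ext x
    simp [hfa, hga, hga']

/-- Every cochain complex over a field splits. -/
theorem exists_cosplitting {f : ∀ n, B n →ₗ[k] B (n + 1)} (hf : ∀ n, f (n + 1) ∘ₗ f n = 0) :
    ∃ h π, Splitting h f π := by
  choose g hg hg' using fun n => exists_generalized_inverse (f n)
  have hfa : ∀ n x, f (n + 1) (f n x) = 0 := fun n x => LinearMap.congr_fun (hf n) x
  have hga : ∀ n x, f n (g n (f n x)) = f n x := fun n x => LinearMap.congr_fun (hg n) x
  have hga' : ∀ n x, g n (f n (g n x)) = g n x := fun n x => LinearMap.congr_fun (hg' n) x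
  -- The mirror image of the chain-complex correction, with the extra factor on the other side
  -- because `f` now raises the degree.
  refine ⟨fun n => g n - g n ∘ₗ g (n + 1) ∘ₗ f (n + 1), _, fun n => rfl, ?_, ?_, ?_, hf⟩
  all_goals
    intro n
    ext x
    simp [hfa, hga, hga']

/-- The dual of the range of an endomorphism is the range of its transpose. -/
lemma nonempty_dual_range_equiv {U : Type*} [AddCommGroup U] [Module k U] (π : U →ₗ[k] U) :
    Nonempty (Module.Dual k (LinearMap.range π) ≃ₗ[k] LinearMap.range π.dualMap) := by
  have hinj : Function.Injective π.rangeRestrict.dualMap :=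
    LinearMap.dualMap_injective_of_surjective π.surjective_rangeRestrict
  have hr : LinearMap.range π.rangeRestrict.dualMap = LinearMap.range π.dualMap := by
    apply le_antisymm
    · rintro _ ⟨φ, rfl⟩
      obtain ⟨ψ, hψ⟩ := LinearMap.dualMap_surjective_of_injective
        (LinearMap.range π).injective_subtype φ
      refine ⟨ψ, ?_⟩
      rw [← hψ]
      rfl
    · rintro _ ⟨φ, rfl⟩
      exact ⟨(LinearMap.range π).subtype.dualMap φ, rfl⟩
  exact ⟨LinearEquiv.ofInjective _ hinj ≪≫ₗ LinearEquiv.ofEq _ _ hr⟩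

end Splitting

/-! ### Combining two homotopies on a total complex. -/

section Homotopy

/-- The homotopy of a total complex assembled from homotopies of the two differentials. -/
lemma total_homotopy {R : Type*} [Ring R] {X Y e s t P Q : R} (he : e * e = 1)
    (heX : e * X = -(X * e)) (heY : e * Y = Y * e) (hes : e * s = -(s * e))
    (hsY : Y * s = s * Y) (htX : t * X = X * t) (hPe : P * e = e * P)
    (hPY : P * Y = Y * P) (hPX : P * X = 0) (hXP : X * P = 0) (hs : X * s + s * X = 1 - P)
    (het : e * t = t * e) (ht : Y * t + t * Y = 1 - Q) :
    (X + e * Y) * (s + P * e * t) + (s + P * e * t) * (X + e * Y) = 1 - P * Q := by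
  -- The second homotopy acts only on the image of `P`, where `X` vanishes, so it does not interact
  -- with `X`; and `s` anticommutes with `e * Y`. What remains is `(1 - P) + P * (1 - Q)`.
  have h1 : X * (P * e * t) = 0 := by rw [← mul_assoc, ← mul_assoc, hXP]; simp
  have h2 : P * e * t * X = 0 := by
    rw [mul_assoc, htX, ← mul_assoc, mul_assoc P, heX, mul_neg, ← mul_assoc, hPX]; simp
  have h3 : e * Y * s = - (s * (e * Y)) := by
    rw [mul_assoc, hsY, ← mul_assoc, hes, neg_mul, mul_assoc]
  have h4 : e * Y * (P * e * t) = P * (Y * t) := by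
    calc e * Y * (P * e * t) = e * (Y * P) * e * t := by simp only [mul_assoc]
      _ = (e * P) * (Y * e) * t := by rw [← hPY]; simp only [mul_assoc]
      _ = P * (e * e) * Y * t := by rw [← hPe, ← heY]; simp only [mul_assoc]
      _ = P * (Y * t) := by rw [he]; simp only [mul_assoc, mul_one]
  have h5 : P * e * t * (e * Y) = P * (t * Y) := by
    calc P * e * t * (e * Y) = P * e * (t * e) * Y := by simp only [mul_assoc]
      _ = P * (e * e) * t * Y := by rw [← het]; simp only [mul_assoc]
      _ = P * (t * Y) := by rw [he]; simp only [mul_assoc, mul_one]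
  calc (X + e * Y) * (s + P * e * t) + (s + P * e * t) * (X + e * Y)
      = (X * s + s * X) + X * (P * e * t) + P * e * t * X + (e * Y * s + s * (e * Y))
        + (e * Y * (P * e * t) + P * e * t * (e * Y)) := by
        simp only [add_mul, mul_add]; abel
    _ = (1 - P) + P * (1 - Q) := by
        rw [h1, h2, h3, h4, h5, hs, ← mul_add, ht]; simp
    _ = 1 - P * Q := by rw [mul_sub, mul_one]; abel

variable {k : Type*} [CommRing k]

/-- If `D` is homotopic to zero relative to an idempotent `P` which annihilates it, then the
cohomology in each degree is the image of `P`. -/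
lemma nonempty_cohomology_equiv_map {C : Type*} [AddCommGroup C] [Module k C]
    (F G : Submodule k C) (D P : Module.End k C)
    (hDK : ∀ x ∈ F, D x = 0 → x - P x ∈ G) (hG : ∀ x ∈ G, P x = 0)
    (hDP : D * P = 0) (hPP : P * P = P) (hPF : ∀ x ∈ F, P x ∈ F) :
    Nonempty (((F ⊓ LinearMap.ker D : Submodule k C) ⧸ G.submoduleOf (F ⊓ LinearMap.ker D)) ≃ₗ[k]
      F.map P) := by
  obtain ⟨e⟩ : Nonempty (((F ⊓ LinearMap.ker D : Submodule k C) ⧸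
      G.submoduleOf (F ⊓ LinearMap.ker D)) ≃ₗ[k]
      (F.map P ⧸ (⊥ : Submodule k C).submoduleOf (F.map P))) := by
    refine nonempty_quotient_equiv P (fun z hz => ⟨z, hz.1, rfl⟩) ?_ ?_
    · rintro _ ⟨x, hx, rfl⟩
      refine ⟨P x, ⟨hPF x hx, LinearMap.congr_fun hDP x⟩, ?_⟩
      have : P (P x) = P x := LinearMap.congr_fun hPP x
      simp [this]
    · rintro z ⟨hz, hz0⟩
      constructor
      · exact fun h => hG z h
      · intro h
        have h0 : P z = 0 := h
        simpa [h0] using hDK z hz hz0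
  exact ⟨e ≪≫ₗ quotientBotEquiv _⟩

end Homotopy

/-! ### The total complex of Hom(bar, cobar) and its cohomology. -/

section Total

variable {k : Type*} [Field k] {A : Type*} [Ring A] [Bialgebra k A]

/-- A family of maps as a bicochain. -/
def Bicochain.of (Ψ : ∀ m n, ⨂[k]^m A →ₗ[k] ⨂[k]^n A) : Bicochain k A := Ψ

@[simp] lemma Bicochain.of_apply (Ψ : ∀ m n, ⨂[k]^m A →ₗ[k] ⨂[k]^n A) (m n : ℕ) :
    Bicochain.of Ψ m n = Ψ m n := rfl

/-- Precomposition with a family of maps raising the first degree. -/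
def precompSucc (f : ∀ m, ⨂[k]^(m + 1) A →ₗ[k] ⨂[k]^m A) : Module.End k (Bicochain k A) where
  toFun Ψ := fun
    | 0, _ => 0
    | m + 1, n => Ψ m n ∘ₗ f m
  map_add' Φ Ψ := Bicochain.ext fun m n => by
    cases m
    · exact (add_zero 0).symm
    · exact LinearMap.add_comp _ _ _
  map_smul' r Ψ := Bicochain.ext fun m n => by
    cases m
    · exact (smul_zero r).symm
    · exact LinearMap.smul_comp _ _ _

/-- Precomposition with a family of maps lowering the first degree. -/
def precompPred (h : ∀ m, ⨂[k]^m A →ₗ[k] ⨂[k]^(m + 1) A) : Module.End k (Bicochain k A) where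
  toFun Ψ := fun m n => Ψ (m + 1) n ∘ₗ h m
  map_add' _ _ := Bicochain.ext fun _ _ => LinearMap.add_comp _ _ _
  map_smul' _ _ := Bicochain.ext fun _ _ => LinearMap.smul_comp _ _ _

/-- Postcomposition with a family of maps raising the second degree. -/
def postcompSucc (h : ∀ m, ⨂[k]^m A →ₗ[k] ⨂[k]^(m + 1) A) : Module.End k (Bicochain k A) where
  toFun Ψ := fun
    | _, 0 => 0
    | m, n + 1 => h n ∘ₗ Ψ m n
  map_add' Φ Ψ := Bicochain.ext fun m n => by
    cases n
    · exact (add_zero 0).symm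
    · exact LinearMap.comp_add _ _ _
  map_smul' r Ψ := Bicochain.ext fun m n => by
    cases n
    · exact (smul_zero r).symm
    · exact LinearMap.comp_smul _ _ _

/-- Postcomposition with a family of maps lowering the second degree. -/
def postcompPred (f : ∀ m, ⨂[k]^(m + 1) A →ₗ[k] ⨂[k]^m A) : Module.End k (Bicochain k A) where
  toFun Ψ := fun m n => f n ∘ₗ Ψ m (n + 1)
  map_add' _ _ := Bicochain.ext fun _ _ => LinearMap.comp_add _ _ _
  map_smul' _ _ := Bicochain.ext fun _ _ => LinearMap.comp_smul _ _ _

/-- Composition on both sides, with a sign. -/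
def conjugate (r : ℕ → k) (π π' : ∀ m, ⨂[k]^m A →ₗ[k] ⨂[k]^m A) :
    Module.End k (Bicochain k A) where
  toFun Ψ := fun m n => r m • (π' n ∘ₗ Ψ m n ∘ₗ π m)
  map_add' Φ Ψ := Bicochain.ext fun m n => by
    refine Eq.trans ?_ (smul_add _ _ _)
    rw [Bicochain.add_apply, LinearMap.add_comp, LinearMap.comp_add]
  map_smul' s Ψ := Bicochain.ext fun m n => by
    change r m • (π' n ∘ₗ (s • Ψ) m n ∘ₗ π m) = s • (r m • (π' n ∘ₗ Ψ m n ∘ₗ π m))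
    rw [Bicochain.smul_apply, LinearMap.smul_comp, LinearMap.comp_smul, smul_comm]

section apply

variable (f : ∀ m, ⨂[k]^(m + 1) A →ₗ[k] ⨂[k]^m A) (h : ∀ m, ⨂[k]^m A →ₗ[k] ⨂[k]^(m + 1) A)
  (Ψ : Bicochain k A) (m n : ℕ)

@[simp] lemma precompSucc_zero : precompSucc f Ψ 0 n = 0 := rfl
@[simp] lemma precompSucc_succ : precompSucc f Ψ (m + 1) n = Ψ m n ∘ₗ f m := rfl
@[simp] lemma precompPred_apply : precompPred h Ψ m n = Ψ (m + 1) n ∘ₗ h m := rfl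
@[simp] lemma postcompSucc_zero : postcompSucc h Ψ m 0 = 0 := rfl
@[simp] lemma postcompSucc_succ : postcompSucc h Ψ m (n + 1) = h n ∘ₗ Ψ m n := rfl
@[simp] lemma postcompPred_apply : postcompPred f Ψ m n = f n ∘ₗ Ψ m (n + 1) := rfl
@[simp] lemma conjugate_apply (r : ℕ → k) (π π' : ∀ m, ⨂[k]^m A →ₗ[k] ⨂[k]^m A) :
    conjugate r π π' Ψ m n = r m • (π' n ∘ₗ Ψ m n ∘ₗ π m) := rfl
@[simp] lemma Bicochain.sub_apply (Φ : Bicochain k A) : (Φ - Ψ) m n = Φ m n - Ψ m n := rfl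
@[simp] lemma Bicochain.neg_apply : (-Ψ) m n = -Ψ m n := rfl

end apply

variable {f : ∀ m, ⨂[k]^(m + 1) A →ₗ[k] ⨂[k]^m A} {h : ∀ m, ⨂[k]^m A →ₗ[k] ⨂[k]^(m + 1) A}
  {π : ∀ m, ⨂[k]^m A →ₗ[k] ⨂[k]^m A}
  {f' : ∀ m, ⨂[k]^(m + 1) A →ₗ[k] ⨂[k]^m A} {h' : ∀ m, ⨂[k]^m A →ₗ[k] ⨂[k]^(m + 1) A}
  {π' : ∀ m, ⨂[k]^m A →ₗ[k] ⨂[k]^m A}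

/-- The differential of the total complex of `Hom(B, C)`, for a chain complex `B` with
differential `f` and a cochain complex `C` with differential `h'`. -/
def homDifferential (f : ∀ m, ⨂[k]^(m + 1) A →ₗ[k] ⨂[k]^m A)
    (h' : ∀ m, ⨂[k]^m A →ₗ[k] ⨂[k]^(m + 1) A) : Module.End k (Bicochain k A) :=
  precompSucc f + conjugate (fun m => (-1) ^ m) (fun _ => LinearMap.id) (fun _ => LinearMap.id) *
    postcompSucc h'

/-- The homotopy on the total complex of `Hom(B, C)` induced by splittings of `B` and `C`. -/
def homHomotopy (h : ∀ m, ⨂[k]^m A →ₗ[k] ⨂[k]^(m + 1) A) (π : ∀ m, ⨂[k]^m A →ₗ[k] ⨂[k]^m A)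
    (f' : ∀ m, ⨂[k]^(m + 1) A →ₗ[k] ⨂[k]^m A) : Module.End k (Bicochain k A) :=
  precompPred h + conjugate (fun _ => 1) π (fun _ => LinearMap.id) *
    conjugate (fun m => (-1) ^ m) (fun _ => LinearMap.id) (fun _ => LinearMap.id) * postcompPred f'

/-- A Künneth formula at the level of homotopies: an instance of `total_homotopy` where `X`, `s`,
`P` are precompositions with `f`, `h`, `π`, where `Y`, `t`, `Q` are postcompositions with `h'`,
`f'`, `π'`, and where `e` is the sign `(-1)^m`. -/
lemma homDifferential_homotopy (S : Splitting f h π) (S' : Splitting f' h' π') :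
    homDifferential f h' * homHomotopy h π f' + homHomotopy h π f' * homDifferential f h' =
      1 - conjugate (fun _ => 1) π π' := by
  have hP : conjugate (k := k) (fun _ => 1) π π' = conjugate (fun _ => 1) π (fun _ => LinearMap.id) *
      conjugate (fun _ => 1) (fun _ => LinearMap.id) π' := by
    ext Ψ m n x
    simp
  rw [hP]
  apply total_homotopy
  · ext Ψ m n x
    simp [smul_smul, ← mul_pow]
  · ext Ψ m n x
    cases m <;> simp [pow_succ]
  · ext Ψ m n x
    cases n <;> simp
  · ext Ψ m n x
    simp [pow_succ]
  · ext Ψ m n x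
    cases n <;> simp
  · ext Ψ m n x
    cases m <;> simp
  · ext Ψ m n x
    simp
  · ext Ψ m n x
    cases n <;> simp
  · ext Ψ m n x
    cases m <;> simp [S.f_proj]
  · ext Ψ m n x
    cases m <;> simp [S.proj_f]
  · ext Ψ m n x
    cases m <;> simp [S.homotopy, viaPred]
    abel
  · ext Ψ m n x
    simp
  · ext Ψ m n x
    cases n <;> simp [S'.homotopy, viaPred]
    abel

lemma homDifferential_mul_conjugate (S : Splitting f h π) (S' : Splitting f' h' π') :
    homDifferential f h' * conjugate (fun _ => 1) π π' = 0 := by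
  ext Ψ m n x
  cases m <;> cases n <;> simp [homDifferential, S.proj_f, S'.h_proj]

lemma conjugate_mul_homDifferential (S : Splitting f h π) (S' : Splitting f' h' π') :
    conjugate (fun _ => 1) π π' * homDifferential f h' = 0 := by
  ext Ψ m n x
  cases m <;> cases n <;> simp [homDifferential, S.f_proj, S'.proj_h]

lemma conjugate_mul_self (S : Splitting f h π) (S' : Splitting f' h' π') :
    conjugate (fun _ => (1 : k)) π π' * conjugate (fun _ => 1) π π' =
      conjugate (fun _ => 1) π π' := by
  ext Ψ m n x
  simp [S.proj_proj, S'.proj_proj]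

lemma conjugate_mem {p : ℕ} {r : ℕ → k} {Ψ : Bicochain k A} (hΨ : Ψ ∈ cochains k A p) :
    conjugate r π π' Ψ ∈ cochains k A p := by
  intro m n hmn
  rw [conjugate_apply, hΨ m n hmn]
  simp

lemma homHomotopy_mem {p : ℕ} {Ψ : Bicochain k A} (hΨ : Ψ ∈ cochains k A (p + 1)) :
    homHomotopy h π f' Ψ ∈ cochains k A p := by
  intro m n hmn
  simp [homHomotopy, hΨ (m + 1) n (by omega), hΨ m (n + 1) (by omega)]

lemma homHomotopy_eq_zero {Ψ : Bicochain k A} (hΨ : Ψ ∈ cochains k A 0) :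
    homHomotopy h π f' Ψ = 0 := by
  ext1 m n
  simp [homHomotopy, hΨ (m + 1) n (by omega), hΨ m (n + 1) (by omega)]

/-- The image of a projection of bicochains in degree `p`. -/
lemma nonempty_map_conjugate_equiv (S : Splitting f h π) (S' : Splitting f' h' π') (p : ℕ) :
    Nonempty ((cochains k A p).map (conjugate (fun _ => 1) π π') ≃ₗ[k]
      ((ij : Finset.HasAntidiagonal.antidiagonal p) →
        (LinearMap.range (π ij.1.1) →ₗ[k] LinearMap.range (π' ij.1.2)))) := by
  let J : ((ij : Finset.HasAntidiagonal.antidiagonal p) →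
        (LinearMap.range (π ij.1.1) →ₗ[k] LinearMap.range (π' ij.1.2))) →ₗ[k] Bicochain k A :=
    { toFun := fun φ => Bicochain.of fun m n => if hmn : (m, n) ∈ Finset.HasAntidiagonal.antidiagonal p then
        (LinearMap.range (π' n)).subtype ∘ₗ φ ⟨(m, n), hmn⟩ ∘ₗ (π m).rangeRestrict else 0
      map_add' := fun φ ψ => Bicochain.ext fun m n => by
        simp only [Bicochain.add_apply, Bicochain.of_apply]
        by_cases hmn : (m, n) ∈ Finset.HasAntidiagonal.antidiagonal p
        · simp only [dif_pos hmn]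
          rfl
        · simp only [dif_neg hmn, add_zero]
      map_smul' := fun r ψ => Bicochain.ext fun m n => by
        simp only [Bicochain.smul_apply, Bicochain.of_apply]
        by_cases hmn : (m, n) ∈ Finset.HasAntidiagonal.antidiagonal p
        · simp only [dif_pos hmn]
          rfl
        · simp only [dif_neg hmn, smul_zero] }
  have hJ : ∀ φ m n hmn, J φ m n = (LinearMap.range (π' n)).subtype ∘ₗ φ ⟨(m, n), hmn⟩ ∘ₗ
      (π m).rangeRestrict := fun φ m n hmn => dif_pos hmn
  have hJ0 : ∀ φ m n, m + n ≠ p → J φ m n = 0 := fun φ m n hmn =>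
    dif_neg (by simpa using hmn)
  have hinj : Function.Injective J := by
    rw [injective_iff_map_eq_zero]
    intro φ hφ
    ext ⟨⟨m, n⟩, hmn⟩ ⟨_, x, rfl⟩
    have := LinearMap.congr_fun ((hJ φ m n hmn).symm.trans (congrFun (congrFun hφ m) n)) x
    exact this
  have hrange : LinearMap.range J = (cochains k A p).map (conjugate (fun _ => 1) π π') := by
    apply le_antisymm
    · rintro _ ⟨φ, rfl⟩
      refine ⟨J φ, fun m n hmn => hJ0 φ m n hmn, ?_⟩
      ext1 m n
      by_cases hmn : m + n = p
      · have hmn' : (m, n) ∈ Finset.HasAntidiagonal.antidiagonal p := by simpa using hmn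
        refine LinearMap.ext fun x => ?_
        rw [conjugate_apply, hJ φ m n hmn', one_smul]
        have h1 : (π m).rangeRestrict (π m x) = (π m).rangeRestrict x :=
          Subtype.ext (S.proj_proj m x)
        have h2 : ∀ y : LinearMap.range (π' n), π' n y = y := by
          rintro ⟨_, y, rfl⟩
          exact S'.proj_proj n y
        simp only [LinearMap.comp_apply, Submodule.subtype_apply, h1, h2]
      · rw [conjugate_apply, hJ0 φ m n hmn]
        simp
    · rintro _ ⟨Ψ, hΨ, rfl⟩
      refine ⟨fun ij => (π' ij.1.2).rangeRestrict ∘ₗ Ψ ij.1.1 ij.1.2 ∘ₗ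
        (LinearMap.range (π ij.1.1)).subtype, ?_⟩
      ext m n x
      by_cases hmn : m + n = p
      · have hmn' : (m, n) ∈ Finset.HasAntidiagonal.antidiagonal p := by simpa using hmn
        rw [hJ _ m n hmn']
        simp
      · rw [hJ0 _ m n hmn, conjugate_apply, hΨ m n hmn]
        simp
  exact ⟨(LinearEquiv.ofInjective J hinj ≪≫ₗ LinearEquiv.ofEq _ _ hrange).symm⟩

/-- If the Gerstenhaber–Schack complex is isomorphic to the total complex of `Hom(B, C)`, then its
cohomology is computed by splittings of `B` and `C`. -/
theorem nonempty_cohomology_equiv (S : Splitting f h π) (S' : Splitting f' h' π')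
    (Θ : Bicochain k A ≃ₗ[k] Bicochain k A)
    (hΘ : ∀ p Ψ, Θ Ψ ∈ cochains k A p ↔ Ψ ∈ cochains k A p)
    (hΘd : ∀ Ψ, differential k A (Θ Ψ) = Θ (homDifferential f h' Ψ)) (p : ℕ) :
    Nonempty (cohomology k A p ≃ₗ[k]
      ((ij : Finset.HasAntidiagonal.antidiagonal p) →
        (LinearMap.range (π ij.1.1) →ₗ[k] LinearMap.range (π' ij.1.2)))) := by
  obtain ⟨e⟩ := nonempty_map_conjugate_equiv S S' p
  have hΘ' : ∀ p Ψ, Θ.symm Ψ ∈ cochains k A p ↔ Ψ ∈ cochains k A p := fun p Ψ => by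
    rw [← hΘ, Θ.apply_symm_apply]
  have hd : ∀ Ψ, homDifferential f h' (Θ.symm Ψ) = Θ.symm (differential k A Ψ) := fun Ψ => by
    rw [LinearEquiv.eq_symm_apply, ← hΘd, Θ.apply_symm_apply]
  have hdP : ∀ Ψ, conjugate (fun _ => 1) π π' (homDifferential f h' Ψ) = 0 :=
    fun Ψ => LinearMap.congr_fun (conjugate_mul_homDifferential S S') Ψ
  have hPd : ∀ Ψ, homDifferential f h' (conjugate (fun _ => 1) π π' Ψ) = 0 :=
    fun Ψ => LinearMap.congr_fun (homDifferential_mul_conjugate S S') Ψ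
  have hPP : ∀ Ψ, conjugate (fun _ => (1 : k)) π π' (conjugate (fun _ => 1) π π' Ψ) =
      conjugate (fun _ => 1) π π' Ψ := fun Ψ => LinearMap.congr_fun (conjugate_mul_self S S') Ψ
  obtain ⟨e'⟩ := nonempty_cohomology_equiv_map (cochains k A p) (coboundaries k A p)
    (differential k A)
    (Θ.toLinearMap ∘ₗ conjugate (fun _ => 1) π π' ∘ₗ Θ.symm.toLinearMap) (by
      intro x hx hx0
      have h1 := LinearMap.congr_fun (homDifferential_homotopy S S') (Θ.symm x)
      simp only [LinearMap.add_apply, Module.End.mul_apply, hd, hx0, map_zero, add_zero,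
        LinearMap.sub_apply, Module.End.one_apply] at h1
      have h2 := congrArg Θ h1
      rw [← hΘd, map_sub, Θ.apply_symm_apply] at h2
      change x - Θ (conjugate (fun _ => 1) π π' (Θ.symm x)) ∈ _
      rw [← h2]
      -- In degree 0 the homotopy has nowhere to land and vanishes, in agreement with the absence of
      -- coboundaries there.
      cases p with
      | zero =>
        rw [homHomotopy_eq_zero ((hΘ' _ _).2 hx)]
        simp
      | succ p => exact ⟨_, (hΘ _ _).2 (homHomotopy_mem ((hΘ' _ _).2 hx)), rfl⟩) (by
      intro x hx
      cases p with
      | zero =>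
        rw [coboundaries, Submodule.mem_bot] at hx
        rw [hx, map_zero]
      | succ p =>
        obtain ⟨y, -, rfl⟩ := hx
        change Θ (conjugate _ π π' (Θ.symm (differential k A y))) = 0
        rw [← hd, hdP, map_zero])
    (by
      ext1 x
      change differential k A (Θ (conjugate _ π π' (Θ.symm x))) = 0
      rw [hΘd, hPd, map_zero])
    (by
      ext1 x
      change Θ (conjugate _ π π' (Θ.symm (Θ (conjugate _ π π' (Θ.symm x))))) =
        Θ (conjugate _ π π' (Θ.symm x))
      rw [Θ.symm_apply_apply, hPP])
    (by
      intro x hx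
      exact (hΘ _ _).2 (conjugate_mem ((hΘ' _ _).2 hx)))
  have hmap : (cochains k A p).map (Θ.toLinearMap ∘ₗ conjugate (fun _ => (1 : k)) π π' ∘ₗ
      Θ.symm.toLinearMap) =
      ((cochains k A p).map (conjugate (fun _ => (1 : k)) π π')).map Θ.toLinearMap := by
    rw [Submodule.map_comp, Submodule.map_comp]
    congr 2
    ext x
    constructor
    · rintro ⟨y, hy, rfl⟩
      exact (hΘ' _ _).2 hy
    · intro hx
      exact ⟨Θ x, (hΘ _ _).2 hx, Θ.symm_apply_apply x⟩
  exact ⟨e' ≪≫ₗ LinearEquiv.ofEq _ _ hmap ≪≫ₗ (Θ.submoduleMap _).symm ≪≫ₗ e⟩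

end Total

/-! ### Structure maps of tensor powers as algebra homomorphisms. -/

section TensorPowerAlgebra

variable {k : Type*} [CommRing k] {A : Type*} [CommRing A]

section Algebra

variable [Algebra k A]

variable (k A) in
/-- `A ⊗ A^{⊗n} ≃ A^{⊗(n+1)}` as algebras. -/
def consAlg (n : ℕ) : A ⊗[k] (⨂[k]^n A) ≃ₐ[k] ⨂[k]^(n + 1) A :=
  Algebra.TensorProduct.algEquivOfLinearEquivTensorProduct (cons k A n)
    (by
      intro a b x y
      induction x using PiTensorProduct.induction_on with
      | smul_tprod r x =>
        induction y using PiTensorProduct.induction_on with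
        | smul_tprod s y =>
          simp only [smul_mul_smul_comm, PiTensorProduct.tprod_mul_tprod, TensorProduct.tmul_smul,
            map_smul, cons_tprod]
          congr 2
          ext i
          refine Fin.cases ?_ (fun i => ?_) i <;> simp
        | add y z hy hz => simp only [mul_add, TensorProduct.tmul_add, map_add, hy, hz]
      | add x z hx hz => simp only [add_mul, TensorProduct.tmul_add, map_add, hx, hz])
    (by
      rw [PiTensorProduct.one_def, cons_tprod, PiTensorProduct.one_def]
      congr 1
      ext i
      refine Fin.cases ?_ (fun i => ?_) i <;> simp)

variable (k A) in
/-- `A^{⊗n} ⊗ A ≃ A^{⊗(n+1)}` as algebras. -/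
def snocAlg (n : ℕ) : (⨂[k]^n A) ⊗[k] A ≃ₐ[k] ⨂[k]^(n + 1) A :=
  Algebra.TensorProduct.algEquivOfLinearEquivTensorProduct (snoc k A n)
    (by
      intro x y a b
      induction x using PiTensorProduct.induction_on with
      | smul_tprod r x =>
        induction y using PiTensorProduct.induction_on with
        | smul_tprod s y =>
          simp only [smul_mul_smul_comm, PiTensorProduct.tprod_mul_tprod, ← TensorProduct.smul_tmul',
            map_smul, snoc_tprod]
          congr 2
          ext i
          refine Fin.lastCases ?_ (fun i => ?_) i <;> simp
        | add y z hy hz => simp only [mul_add, TensorProduct.add_tmul, map_add, hy, hz]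
      | add x z hx hz => simp only [add_mul, TensorProduct.add_tmul, map_add, hx, hz])
    (by
      rw [PiTensorProduct.one_def, snoc_tprod, PiTensorProduct.one_def]
      congr 1
      ext i
      refine Fin.lastCases ?_ (fun i => ?_) i <;> simp)

@[simp] lemma consAlg_apply (n : ℕ) (z) : consAlg k A n z = cons k A n z := rfl
@[simp] lemma snocAlg_apply (n : ℕ) (z) : snocAlg k A n z = snoc k A n z := rfl

lemma cons_mul (n : ℕ) (a b : A) (x y : ⨂[k]^n A) :
    cons k A n (a ⊗ₜ x) * cons k A n (b ⊗ₜ y) = cons k A n ((a * b) ⊗ₜ (x * y)) := by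
  rw [← Algebra.TensorProduct.tmul_mul_tmul, ← consAlg_apply, ← consAlg_apply, ← consAlg_apply,
    map_mul]

@[simp] lemma cons_one (n : ℕ) : cons k A n (1 ⊗ₜ 1) = 1 := map_one (consAlg k A n)
@[simp] lemma snoc_one (n : ℕ) : snoc k A n (1 ⊗ₜ 1) = 1 := map_one (snocAlg k A n)

variable (k A) in
/-- `a ↦ a ⊗ 1 ⊗ ⋯ ⊗ 1`. -/
def consL (n : ℕ) : A →ₐ[k] ⨂[k]^(n + 1) A :=
  (consAlg k A n : A ⊗[k] (⨂[k]^n A) →ₐ[k] _).comp Algebra.TensorProduct.includeLeft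

variable (k A) in
/-- `x ↦ 1 ⊗ x`. -/
def consR (n : ℕ) : (⨂[k]^n A) →ₐ[k] ⨂[k]^(n + 1) A :=
  (consAlg k A n : A ⊗[k] (⨂[k]^n A) →ₐ[k] _).comp Algebra.TensorProduct.includeRight

lemma consL_apply (n : ℕ) (a) : consL k A n a = cons k A n (a ⊗ₜ 1) := rfl
lemma consR_apply (n : ℕ) (x) : consR k A n x = cons k A n (1 ⊗ₜ x) := rfl

lemma consL_mul_consR (n : ℕ) (a : A) (x : ⨂[k]^n A) :
    consL k A n a * consR k A n x = cons k A n (a ⊗ₜ x) := by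
  rw [consL_apply, consR_apply, cons_mul, one_mul, mul_one]

/-- Linear maps out of `A^{⊗(n+1)}` agree if they agree on all `a ⊗ x`. -/
lemma cons_ext {n : ℕ} {M : Type*} [AddCommMonoid M] [Module k M]
    {f g : ⨂[k]^(n + 1) A →ₗ[k] M} (h : ∀ a x, f (cons k A n (a ⊗ₜ x)) = g (cons k A n (a ⊗ₜ x))) :
    f = g := by
  have : f ∘ₗ (cons k A n).toLinearMap = g ∘ₗ (cons k A n).toLinearMap :=
    TensorProduct.ext' h
  ext1
  ext x
  have h2 := LinearMap.congr_fun this ((cons k A n).symm (PiTensorProduct.tprod k x))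
  simpa using h2

/-- Linear maps out of `A^{⊗0}` agree if they agree on `1`. -/
lemma zero_ext {M : Type*} [AddCommMonoid M] [Module k M]
    {f g : ⨂[k]^0 A →ₗ[k] M} (h : f 1 = g 1) : f = g := by
  ext x
  have : x = 1 := Subsingleton.elim _ _
  subst this
  exact h

/-- Algebra homomorphisms out of `A^{⊗(n+1)}` agree if they agree on all `a ⊗ 1` and `1 ⊗ x`. -/
lemma consAlg_ext {n : ℕ} {S : Type*} [Semiring S] [Algebra k S] {f g : ⨂[k]^(n + 1) A →ₐ[k] S}
    (hL : ∀ a, f (consL k A n a) = g (consL k A n a))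
    (hR : ∀ x, f (consR k A n x) = g (consR k A n x)) : f = g := by
  apply AlgHom.toLinearMap_injective
  refine cons_ext fun a x => ?_
  rw [← consL_mul_consR]
  simp only [AlgHom.toLinearMap_apply, map_mul, hL, hR]

lemma zeroAlg_ext {S : Type*} [Semiring S] [Algebra k S] (f g : ⨂[k]^0 A →ₐ[k] S) : f = g :=
  AlgHom.toLinearMap_injective (zero_ext (by simp))

lemma snoc_cons (n : ℕ) (a b : A) (x : ⨂[k]^n A) :
    snoc k A (n + 1) (cons k A n (a ⊗ₜ x) ⊗ₜ b) = cons k A (n + 1) (a ⊗ₜ snoc k A n (x ⊗ₜ b)) := by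
  induction x using PiTensorProduct.induction_on with
  | smul_tprod r x =>
    simp only [TensorProduct.tmul_smul, map_smul, cons_tprod, ← TensorProduct.smul_tmul',
      snoc_tprod, Fin.cons_snoc_eq_snoc_cons]
  | add x y hx hy => simp only [TensorProduct.tmul_add, TensorProduct.add_tmul, map_add, hx, hy]

lemma snoc_zero (b : A) : snoc k A 0 (1 ⊗ₜ b) = cons k A 0 (b ⊗ₜ 1) := by
  rw [PiTensorProduct.one_def, snoc_tprod, cons_tprod]
  congr 1
  ext i
  rw [show i = 0 from Fin.ext (by omega)]
  simp [Fin.snoc]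

lemma mulAt_zero (m : ℕ) (a b : A) (x : ⨂[k]^m A) :
    mulAt k A (m + 1) 0 (cons k A (m + 1) (a ⊗ₜ cons k A m (b ⊗ₜ x))) =
      cons k A m ((a * b) ⊗ₜ x) := by
  simp [mulAt]

lemma mulAt_succ (m : ℕ) (j : Fin m) (a : A) (x : ⨂[k]^(m + 1) A) :
    mulAt k A (m + 1) j.succ (cons k A (m + 1) (a ⊗ₜ x)) = cons k A m (a ⊗ₜ mulAt k A m j x) := by
  simp [mulAt]

/-- The algebra homomorphism `a ⊗ x ↦ f a * g x` on `A^{⊗(n+1)}`. -/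
def consLift {n : ℕ} {S : Type*} [CommSemiring S] [Algebra k S] (f : A →ₐ[k] S)
    (g : ⨂[k]^n A →ₐ[k] S) : ⨂[k]^(n + 1) A →ₐ[k] S :=
  (Algebra.TensorProduct.productMap f g).comp (consAlg k A n).symm.toAlgHom

section consLift

variable {n : ℕ} {S : Type*} [CommSemiring S] [Algebra k S] (f : A →ₐ[k] S)
  (g : ⨂[k]^n A →ₐ[k] S)

@[simp] lemma consLift_cons (a : A) (x : ⨂[k]^n A) :
    consLift f g (cons k A n (a ⊗ₜ x)) = f a * g x := by
  have h : (consAlg k A n).symm (cons k A n (a ⊗ₜ x)) = a ⊗ₜ x :=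
    (cons k A n).symm_apply_apply _
  simp [consLift, h]

@[simp] lemma consLift_consL (a : A) : consLift f g (consL k A n a) = f a := by
  simp [consL_apply]

@[simp] lemma consLift_consR (x : ⨂[k]^n A) : consLift f g (consR k A n x) = g x := by
  simp [consR_apply]

end consLift

lemma cons_induction {m : ℕ} {P : ⨂[k]^(m + 1) A → Prop} (h : ∀ a x, P (cons k A m (a ⊗ₜ x)))
    (h0 : P 0) (hadd : ∀ x y, P x → P y → P (x + y)) (x) : P x := by
  obtain ⟨z, rfl⟩ := (cons k A m).surjective x
  induction z with
  | zero => rwa [map_zero]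
  | tmul a x => exact h a x
  | add x y hx hy => rw [map_add]; exact hadd _ _ hx hy

variable (k A) in
/-- `mulAt` as an algebra homomorphism. -/
def mulAtAlg : (m : ℕ) → Fin m → (⨂[k]^(m + 1) A →ₐ[k] ⨂[k]^m A)
  | 0, i => i.elim0
  | m + 1, i => Fin.cases (motive := fun _ => ⨂[k]^(m + 1 + 1) A →ₐ[k] ⨂[k]^(m + 1) A)
      (consLift (consL k A m) (AlgHom.id k _))
      (fun j => consLift (consL k A m) ((consR k A m).comp (mulAtAlg m j))) i

lemma mulAtAlg_zero (m : ℕ) :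
    mulAtAlg k A (m + 1) 0 = consLift (consL k A m) (AlgHom.id k _) := rfl

lemma mulAtAlg_succ (m : ℕ) (j : Fin m) : mulAtAlg k A (m + 1) j.succ =
    consLift (consL k A m) ((consR k A m).comp (mulAtAlg k A m j)) := rfl

/-- Commutativity of `A` makes multiplication an algebra homomorphism. This and the analogous
comparisons below allow identities between structure maps to be checked on algebra generators alone.
-/
lemma mulAtAlg_toLinearMap (m : ℕ) (i : Fin m) :
    (mulAtAlg k A m i).toLinearMap = mulAt k A m i := by
  induction m with
  | zero => exact i.elim0
  | succ m ih =>
    refine cons_ext fun a x => ?_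
    refine Fin.cases ?_ (fun j => ?_) i
    · refine cons_induction (P := fun x => (mulAtAlg k A (m + 1) 0).toLinearMap
        (cons k A (m + 1) (a ⊗ₜ x)) = mulAt k A (m + 1) 0 (cons k A (m + 1) (a ⊗ₜ x)))
        (fun b x => ?_) ?_ (fun x y hx hy => ?_) x
      · rw [mulAt_zero, mulAtAlg_zero, AlgHom.toLinearMap_apply, consLift_cons, consL_apply,
          AlgHom.id_apply, cons_mul, one_mul]
      · simp only [TensorProduct.tmul_zero, map_zero]
      · simp only [TensorProduct.tmul_add, map_add, hx, hy]
    · rw [mulAt_succ, ← ih, mulAtAlg_succ, AlgHom.toLinearMap_apply, consLift_cons,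
        AlgHom.comp_apply, consL_mul_consR, AlgHom.toLinearMap_apply]

end Algebra

section Bialgebra

variable [Bialgebra k A]

lemma comulAt_zero (n : ℕ) (a : A) (x : ⨂[k]^n A) :
    comulAt k A (n + 1) 0 (cons k A n (a ⊗ₜ x)) =
      cons k A (n + 1) ((cons k A n).toLinearMap.lTensor A
        (TensorProduct.assoc k A A (⨂[k]^n A) (Coalgebra.comul a ⊗ₜ x))) := by
  simp [comulAt]

lemma comulAt_succ (n : ℕ) (j : Fin n) (a : A) (x : ⨂[k]^n A) :
    comulAt k A (n + 1) j.succ (cons k A n (a ⊗ₜ x)) =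
      cons k A (n + 1) (a ⊗ₜ comulAt k A n j x) := by
  simp [comulAt]

variable (k A) in
/-- `comulAt` as an algebra homomorphism. -/
def comulAtAlg : (n : ℕ) → Fin n → (⨂[k]^n A →ₐ[k] ⨂[k]^(n + 1) A)
  | 0, i => i.elim0
  | n + 1, i => Fin.cases (motive := fun _ => ⨂[k]^(n + 1) A →ₐ[k] ⨂[k]^(n + 1 + 1) A)
      (consLift ((Algebra.TensorProduct.productMap (consL k A (n + 1))
        ((consR k A (n + 1)).comp (consL k A n))).comp (Bialgebra.comulAlgHom k A))
        ((consR k A (n + 1)).comp (consR k A n)))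
      (fun j => consLift (consL k A (n + 1)) ((consR k A (n + 1)).comp (comulAtAlg n j))) i

lemma comulAtAlg_zero (n : ℕ) : comulAtAlg k A (n + 1) 0 =
    consLift ((Algebra.TensorProduct.productMap (consL k A (n + 1))
      ((consR k A (n + 1)).comp (consL k A n))).comp (Bialgebra.comulAlgHom k A))
      ((consR k A (n + 1)).comp (consR k A n)) := rfl

lemma comulAtAlg_succ (n : ℕ) (j : Fin n) : comulAtAlg k A (n + 1) j.succ =
    consLift (consL k A (n + 1)) ((consR k A (n + 1)).comp (comulAtAlg k A n j)) := rfl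

set_option synthInstance.maxHeartbeats 200000 in
lemma comulAtAlg_toLinearMap (n : ℕ) (i : Fin n) :
    (comulAtAlg k A n i).toLinearMap = comulAt k A n i := by
  induction n with
  | zero => exact i.elim0
  | succ n ih =>
    refine cons_ext fun a x => ?_
    refine Fin.cases ?_ (fun j => ?_) i
    · rw [comulAt_zero, comulAtAlg_zero, AlgHom.toLinearMap_apply, consLift_cons,
        AlgHom.comp_apply, Bialgebra.comulAlgHom_apply]
      induction (Coalgebra.comul (R := k) a) with
      | zero => simp
      | tmul b c =>
        rw [Algebra.TensorProduct.productMap_apply_tmul, AlgHom.comp_apply, AlgHom.comp_apply,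
          mul_assoc, ← map_mul, consL_mul_consR, consL_mul_consR]
        simp
      | add y z hy hz => simp only [map_add, add_mul, TensorProduct.add_tmul, hy, hz]
    · rw [comulAt_succ, ← ih, comulAtAlg_succ, AlgHom.toLinearMap_apply, consLift_cons,
        AlgHom.comp_apply, consL_mul_consR, AlgHom.toLinearMap_apply]

variable (k A) in
/-- `comulPow` as an algebra homomorphism. -/
def comulPowAlg : (n : ℕ) → (A →ₐ[k] ⨂[k]^n A)
  | 0 => (Algebra.ofId k (⨂[k]^0 A)).comp (Bialgebra.counitAlgHom k A)
  | n + 1 => (Algebra.TensorProduct.productMap (consL k A n)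
      ((consR k A n).comp (comulPowAlg n))).comp (Bialgebra.comulAlgHom k A)

lemma comulPowAlg_toLinearMap (n : ℕ) : (comulPowAlg k A n).toLinearMap = comulPow k A n := by
  induction n with
  | zero => rfl
  | succ n ih =>
    ext a
    rw [comulPow, ← ih, comulPowAlg]
    simp only [AlgHom.toLinearMap_apply, AlgHom.comp_apply, LinearMap.comp_apply,
      Bialgebra.comulAlgHom_apply]
    induction (Coalgebra.comul (R := k) a) with
    | zero => simp
    | tmul b c => simp [consL_mul_consR]
    | add y z hy hz => simp only [map_add, hy, hz]

variable (k A) in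
/-- `coactL` as an algebra homomorphism. -/
def coactLAlg : (m : ℕ) → (⨂[k]^m A →ₐ[k] A ⊗[k] (⨂[k]^m A))
  | 0 => Algebra.TensorProduct.includeRight
  | m + 1 => consLift
      ((Algebra.TensorProduct.map (AlgHom.id k A) (consL k A m)).comp (Bialgebra.comulAlgHom k A))
      ((Algebra.TensorProduct.map (AlgHom.id k A) (consR k A m)).comp (coactLAlg m))

set_option synthInstance.maxHeartbeats 200000 in
lemma coactLAlg_toLinearMap (m : ℕ) : (coactLAlg k A m).toLinearMap = coactL k A m := by
  induction m with
  | zero => rfl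
  | succ m ih =>
    refine cons_ext fun a x => ?_
    rw [coactL, ← ih, coactLAlg]
    simp only [AlgHom.toLinearMap_apply, AlgHom.comp_apply, LinearMap.comp_apply, consLift_cons,
      Bialgebra.comulAlgHom_apply, LinearEquiv.coe_coe, LinearEquiv.symm_apply_apply,
      TensorProduct.map_tmul]
    induction (Coalgebra.comul (R := k) a) with
    | zero => simp
    | tmul b c =>
      induction (coactLAlg k A m x) with
      | zero => simp
      | tmul d y => simp [consL_mul_consR]
      | add y z hy hz => simp only [map_add, TensorProduct.tmul_add, mul_add, hy, hz]
    | add y z hy hz => simp only [map_add, TensorProduct.add_tmul, add_mul, hy, hz]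

variable (k A) in
/-- `coactR` as an algebra homomorphism. -/
def coactRAlg : (m : ℕ) → (⨂[k]^m A →ₐ[k] (⨂[k]^m A) ⊗[k] A)
  | 0 => Algebra.TensorProduct.includeLeft
  | m + 1 => consLift
      ((Algebra.TensorProduct.map (consL k A m) (AlgHom.id k A)).comp (Bialgebra.comulAlgHom k A))
      ((Algebra.TensorProduct.map (consR k A m) (AlgHom.id k A)).comp (coactRAlg m))

set_option synthInstance.maxHeartbeats 200000 in
lemma coactRAlg_toLinearMap (m : ℕ) : (coactRAlg k A m).toLinearMap = coactR k A m := by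
  induction m with
  | zero => rfl
  | succ m ih =>
    refine cons_ext fun a x => ?_
    rw [coactR, ← ih, coactRAlg]
    simp only [AlgHom.toLinearMap_apply, AlgHom.comp_apply, LinearMap.comp_apply, consLift_cons,
      Bialgebra.comulAlgHom_apply, LinearEquiv.coe_coe, LinearEquiv.symm_apply_apply,
      TensorProduct.map_tmul]
    induction (Coalgebra.comul (R := k) a) with
    | zero => simp
    | tmul b c =>
      induction (coactRAlg k A m x) with
      | zero => simp
      | tmul d y => simp [consL_mul_consR]
      | add y z hy hz => simp only [map_add, TensorProduct.tmul_add, mul_add, hy, hz]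
    | add y z hy hz => simp only [map_add, TensorProduct.add_tmul, add_mul, hy, hz]

end Bialgebra

end TensorPowerAlgebra

/-- The data exhibiting `A` as the polynomial bialgebra on finitely many primitive variables. -/
class PolynomialBialgebra (k : Type*) (A : Type*) [CommRing k] [CommRing A] [Bialgebra k A] where
  /-- The number of variables. -/
  dim : ℕ
  /-- The identification with the polynomial algebra. -/
  equiv : MvPolynomial (Fin dim) k ≃ₐ[k] A
  comul_X : ∀ i, Coalgebra.comul (R := k) (equiv (MvPolynomial.X i)) =
    equiv (MvPolynomial.X i) ⊗ₜ 1 + 1 ⊗ₜ equiv (MvPolynomial.X i)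
  counit_X : ∀ i, Coalgebra.counit (R := k) (equiv (MvPolynomial.X i)) = 0

/-! ### Generators of tensor powers and identities checked on them. -/

section Generators

open PolynomialBialgebra

variable {k : Type*} [CommRing k] {A : Type*} [CommRing A] [Bialgebra k A]
  [PolynomialBialgebra k A]

variable (k A) in
/-- The variables of `A`. -/
def var (i : Fin (dim k A)) : A := equiv (k := k) (MvPolynomial.X i)

@[simp] lemma comul_var (i : Fin (dim k A)) :
    Coalgebra.comul (R := k) (var k A i) = var k A i ⊗ₜ 1 + 1 ⊗ₜ var k A i := comul_X i

@[simp] lemma counit_var (i : Fin (dim k A)) : Coalgebra.counit (R := k) (var k A i) = 0 :=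
  counit_X i

lemma var_induction {P : A → Prop} (halg : ∀ r, P (algebraMap k A r))
    (hadd : ∀ a b, P a → P b → P (a + b)) (hmul : ∀ a i, P a → P (a * var k A i)) (a : A) : P a := by
  obtain ⟨q, rfl⟩ := (equiv (k := k) (A := A)).surjective a
  induction q using MvPolynomial.induction_on with
  | C r => rw [← MvPolynomial.algebraMap_eq, AlgEquiv.commutes]; exact halg r
  | add p q hp hq => rw [map_add]; exact hadd _ _ hp hq
  | mul_X p i hp => rw [map_mul]; exact hmul _ i hp

lemma algHom_ext {S : Type*} [Semiring S] [Algebra k S] {f g : A →ₐ[k] S}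
    (h : ∀ i, f (var k A i) = g (var k A i)) : f = g := by
  refine AlgHom.ext fun a => ?_
  refine var_induction (k := k) (P := fun a => f a = g a) (fun r => ?_) (fun a b ha hb => ?_) (fun a i ha => ?_) a
  · simp
  · simp only [map_add, ha, hb]
  · simp only [map_mul, ha, h]

instance : Coalgebra.IsCocomm k A where
  comm_comp_comul := by
    have : (Algebra.TensorProduct.comm k A A).toAlgHom.comp (Bialgebra.comulAlgHom k A) =
        Bialgebra.comulAlgHom k A := algHom_ext fun i => by simp [add_comm]
    ext a
    exact AlgHom.congr_fun this a

variable (k A) in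
/-- The generator `1 ⊗ ⋯ ⊗ v ⊗ ⋯ ⊗ 1` of `A^{⊗m}`, with `v` in position `i`. -/
def gen (v : Fin (dim k A)) : (m : ℕ) → Fin m → ⨂[k]^m A
  | 0, i => i.elim0
  | m + 1, i => Fin.cases (motive := fun _ => ⨂[k]^(m + 1) A) (consL k A m (var k A v))
      (fun j => consR k A m (gen v m j)) i

@[simp] lemma gen_zero (v : Fin (dim k A)) (m : ℕ) : gen k A v (m + 1) 0 = consL k A m (var k A v) := rfl

@[simp] lemma gen_succ (v : Fin (dim k A)) (m : ℕ) (j : Fin m) :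
    gen k A v (m + 1) j.succ = consR k A m (gen k A v m j) := rfl

lemma gen_ext {m : ℕ} {S : Type*} [Semiring S] [Algebra k S] {f g : ⨂[k]^m A →ₐ[k] S}
    (h : ∀ v i, f (gen k A v m i) = g (gen k A v m i)) : f = g := by
  induction m with
  | zero => exact zeroAlg_ext f g
  | succ m ih =>
    refine consAlg_ext (fun a => ?_) (fun x => ?_)
    · exact AlgHom.congr_fun (algHom_ext (f := f.comp (consL k A m)) (g := g.comp (consL k A m))
        fun v => h v 0) a
    · have : f.comp (consR k A m) = g.comp (consR k A m) := ih fun v i => h v i.succ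
      exact AlgHom.congr_fun this x

/-- Only position `i` is not a unit, and its entry is primitive, so each generator behaves like a
primitive element for the diagonal coaction. -/
lemma coactLAlg_gen (v : Fin (dim k A)) (m : ℕ) (i : Fin m) :
    coactLAlg k A m (gen k A v m i) = var k A v ⊗ₜ 1 + 1 ⊗ₜ gen k A v m i := by
  induction m with
  | zero => exact i.elim0
  | succ m ih => refine Fin.cases ?_ (fun j => ?_) i <;> simp [coactLAlg, ih]

lemma coactRAlg_gen (v : Fin (dim k A)) (m : ℕ) (i : Fin m) :
    coactRAlg k A m (gen k A v m i) = gen k A v m i ⊗ₜ 1 + 1 ⊗ₜ var k A v := by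
  induction m with
  | zero => exact i.elim0
  | succ m ih => refine Fin.cases ?_ (fun j => ?_) i <;> simp [coactRAlg, ih]

/-- A form of cocommutativity: it lets the right coface be treated with the left coaction that
defines the twist. -/
lemma coactRAlg_eq (m : ℕ) : coactRAlg k A m =
    ((Algebra.TensorProduct.comm k A (⨂[k]^m A)).toAlgHom).comp (coactLAlg k A m) := by
  refine gen_ext fun v i => ?_
  simp [coactLAlg_gen, coactRAlg_gen, add_comm]

lemma coactLAlg_coassoc (m : ℕ) :
    (Algebra.TensorProduct.map (AlgHom.id k A) (coactLAlg k A m)).comp (coactLAlg k A m) =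
      (Algebra.TensorProduct.assoc k k k A A (⨂[k]^m A)).toAlgHom.comp
        ((Algebra.TensorProduct.map (Bialgebra.comulAlgHom k A) (AlgHom.id k _)).comp
          (coactLAlg k A m)) := by
  refine gen_ext fun v i => ?_
  simp [coactLAlg_gen, TensorProduct.tmul_add, TensorProduct.add_tmul,
    Algebra.TensorProduct.one_def, add_assoc]

lemma coactLAlg_counit (m : ℕ) :
    (Algebra.TensorProduct.lid k (⨂[k]^m A)).toAlgHom.comp
      ((Algebra.TensorProduct.map (Bialgebra.counitAlgHom k A) (AlgHom.id k _)).comp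
        (coactLAlg k A m)) = AlgHom.id k _ := by
  refine gen_ext fun v i => ?_
  simp [coactLAlg_gen, counit_var]

/-- Multiplying a variable by the unit next to it only moves its position. This is all that is
needed to see that `mulAt` respects the coaction. -/
lemma exists_mulAtAlg_gen (m : ℕ) (j : Fin m) (i : Fin (m + 1)) :
    ∃ i', ∀ v : Fin (dim k A), mulAtAlg k A m j (gen k A v (m + 1) i) = gen k A v m i' := by
  induction m with
  | zero => exact j.elim0
  | succ m ih =>
    refine Fin.cases ?_ (fun i => ?_) i
    · exact ⟨0, fun v => by refine Fin.cases ?_ (fun j => ?_) j <;> simp [mulAtAlg_zero, mulAtAlg_succ]⟩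
    · refine Fin.cases ?_ (fun j => ?_) j
      · exact ⟨i, fun v => by rw [gen_succ]; simp [mulAtAlg_zero]⟩
      · obtain ⟨i', h⟩ := ih j i
        exact ⟨i'.succ, fun v => by rw [gen_succ]; simp [mulAtAlg_succ, h]⟩

lemma coactLAlg_mulAtAlg (m : ℕ) (j : Fin m) :
    (coactLAlg k A m).comp (mulAtAlg k A m j) =
      (Algebra.TensorProduct.map (AlgHom.id k A) (mulAtAlg k A m j)).comp
        (coactLAlg k A (m + 1)) := by
  refine gen_ext fun v i => ?_
  obtain ⟨i', h⟩ := exists_mulAtAlg_gen (k := k) (A := A) m j i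
  simp [coactLAlg_gen, h]

lemma snocAlg_gen (v : Fin (dim k A)) (m : ℕ) (i : Fin m) :
    snoc k A m (gen k A v m i ⊗ₜ 1) = gen k A v (m + 1) i.castSucc := by
  induction m with
  | zero => exact i.elim0
  | succ m ih =>
    refine Fin.cases ?_ (fun j => ?_) i
    · rw [gen_zero, consL_apply, snoc_cons, snoc_one]
      rfl
    · rw [gen_succ, consR_apply, snoc_cons, ih, ← Fin.succ_castSucc, gen_succ, consR_apply]

lemma snocAlg_var (v : Fin (dim k A)) (m : ℕ) : snoc k A m (1 ⊗ₜ var k A v) = gen k A v (m + 1) (Fin.last m) := by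
  induction m with
  | zero => exact snoc_zero _
  | succ m ih =>
    rw [← cons_one, snoc_cons, ih, ← Fin.succ_last, gen_succ, consR_apply]

/-- Algebra homomorphisms out of `A^{⊗m} ⊗ A` are determined by generators. -/
lemma gen_tensor_ext {m : ℕ} {S : Type*} [CommSemiring S] [Algebra k S]
    {f g : (⨂[k]^m A) ⊗[k] A →ₐ[k] S} (h : ∀ v i, f (gen k A v m i ⊗ₜ 1) = g (gen k A v m i ⊗ₜ 1))
    (h' : ∀ v, f (1 ⊗ₜ var k A v) = g (1 ⊗ₜ var k A v)) : f = g := by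
  refine Algebra.TensorProduct.ext ?_ ?_
  · exact gen_ext h
  · exact algHom_ext h'

lemma comulPowAlg_var_succ (n : ℕ) (v : Fin (dim k A)) : comulPowAlg k A (n + 1) (var k A v) =
    consL k A n (var k A v) + consR k A n (comulPowAlg k A n (var k A v)) := by
  simp [comulPowAlg]

/-- The iterated coproduct of a variable is the sum of its copies in all positions, so the last
summand can be split off as well as the first. -/
lemma comulPowAlg_var_snoc (n : ℕ) (v : Fin (dim k A)) : comulPowAlg k A (n + 1) (var k A v) =
    snoc k A n (comulPowAlg k A n (var k A v) ⊗ₜ 1) + snoc k A n (1 ⊗ₜ var k A v) := by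
  induction n with
  | zero => simp [comulPowAlg, snoc_zero, consL_apply, Algebra.ofId_apply, counit_var]
  | succ n ih =>
    conv_lhs => rw [comulPowAlg_var_succ, ih, map_add, ← add_assoc]
    congr 1
    · rw [comulPowAlg_var_succ, TensorProduct.add_tmul, map_add, consL_apply, consL_apply, snoc_cons,
        snoc_one, consR_apply, consR_apply, snoc_cons]
    · rw [consR_apply, ← snoc_cons, cons_one]

/-- The iterated coproduct, splitting off the last factor. -/
lemma comulPowAlg_eq_snoc (n : ℕ) : comulPowAlg k A (n + 1) =
    (snocAlg k A n).toAlgHom.comp ((Algebra.TensorProduct.map (comulPowAlg k A n)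
      (AlgHom.id k A)).comp (Bialgebra.comulAlgHom k A)) := by
  refine algHom_ext fun v => ?_
  simp [comulPowAlg_var_snoc]

lemma comulAtAlg_comp_comulPowAlg (n : ℕ) (j : Fin n) :
    (comulAtAlg k A n j).comp (comulPowAlg k A n) = comulPowAlg k A (n + 1) := by
  have : ∀ v, comulAtAlg k A n j (comulPowAlg k A n (var k A v)) =
      comulPowAlg k A (n + 1) (var k A v) := by
    intro v
    induction n with
    | zero => exact j.elim0
    | succ n ih =>
      rw [comulPowAlg_var_succ (n + 1), comulPowAlg_var_succ n, map_add]
      refine Fin.cases ?_ (fun j => ?_) j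
      · simp [comulAtAlg_zero, add_assoc]
      · simp [comulAtAlg_succ, ih, comulPowAlg_var_succ n]
  refine algHom_ext fun v => ?_
  exact this v

end Generators

set_option linter.unusedSectionVars false

/-! ### Untwisting: reduction to trivial coefficients. -/

section Twist

open PolynomialBialgebra

variable {k : Type*} [CommRing k] {A : Type*} [CommRing A] [Bialgebra k A]
  [PolynomialBialgebra k A]

/-- The map `a ⊗ x ↦ f a * Φ x`. -/
def mulMap {m n : ℕ} (f : A →ₐ[k] ⨂[k]^n A) (Φ : ⨂[k]^m A →ₗ[k] ⨂[k]^n A) :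
    A ⊗[k] (⨂[k]^m A) →ₗ[k] ⨂[k]^n A :=
  LinearMap.mul' k (⨂[k]^n A) ∘ₗ TensorProduct.map f.toLinearMap Φ

@[simp] lemma mulMap_tmul {m n : ℕ} (f : A →ₐ[k] ⨂[k]^n A) (Φ : ⨂[k]^m A →ₗ[k] ⨂[k]^n A)
    (a : A) (x : ⨂[k]^m A) : mulMap f Φ (a ⊗ₜ x) = f a * Φ x := by
  simp [mulMap]

/-- The convolution of `f` with `Φ`, `x ↦ f x⁽⁻¹⁾ * Φ x⁽⁰⁾`. -/
def act {m n : ℕ} (f : A →ₐ[k] ⨂[k]^n A) :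
    (⨂[k]^m A →ₗ[k] ⨂[k]^n A) →ₗ[k] (⨂[k]^m A →ₗ[k] ⨂[k]^n A) where
  toFun Φ := mulMap f Φ ∘ₗ (coactLAlg k A m).toLinearMap
  map_add' Φ Ψ := by
    simp only [mulMap, TensorProduct.map_add_right, LinearMap.comp_add, LinearMap.add_comp]
  map_smul' r Φ := by
    simp only [mulMap, TensorProduct.map_smul_right, LinearMap.comp_smul, LinearMap.smul_comp,
      RingHom.id_apply]

lemma act_apply {m n : ℕ} (f : A →ₐ[k] ⨂[k]^n A) (Φ : ⨂[k]^m A →ₗ[k] ⨂[k]^n A)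
    (x : ⨂[k]^m A) : act f Φ x = mulMap f Φ (coactLAlg k A m x) := rfl

lemma lTensor_coactLAlg (m : ℕ) (x : ⨂[k]^m A) :
    (coactLAlg k A m).toLinearMap.lTensor A (coactLAlg k A m x) =
      TensorProduct.assoc k A A (⨂[k]^m A)
        ((Coalgebra.comul (R := k) (A := A)).rTensor (⨂[k]^m A) (coactLAlg k A m x)) :=
  AlgHom.congr_fun (coactLAlg_coassoc (k := k) (A := A) m) x

lemma rTensor_counit_coactLAlg (m : ℕ) (x : ⨂[k]^m A) :
    TensorProduct.lid k (⨂[k]^m A)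
      ((Coalgebra.counit (R := k) (A := A)).rTensor (⨂[k]^m A) (coactLAlg k A m x)) = x :=
  AlgHom.congr_fun (coactLAlg_counit (k := k) (A := A) m) x

/-- Two linear maps agree after the coaction if they agree on `a ⊗ x`. -/
lemma comp_coactLAlg_ext {m : ℕ} {M : Type*} [AddCommGroup M] [Module k M]
    {F : A ⊗[k] (A ⊗[k] (⨂[k]^m A)) →ₗ[k] M} {G : A ⊗[k] (⨂[k]^m A) →ₗ[k] M}
    (h : ∀ a x, F (TensorProduct.assoc k A A _ (Coalgebra.comul (R := k) a ⊗ₜ x)) = G (a ⊗ₜ x))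
    (x : ⨂[k]^m A) :
    F ((coactLAlg k A m).toLinearMap.lTensor A (coactLAlg k A m x)) = G (coactLAlg k A m x) := by
  rw [lTensor_coactLAlg]
  have : F ∘ₗ (TensorProduct.assoc k A A (⨂[k]^m A)).toLinearMap ∘ₗ
      (Coalgebra.comul (R := k) (A := A)).rTensor (⨂[k]^m A) = G := by
    refine TensorProduct.ext' fun a x => ?_
    simpa using h a x
  exact LinearMap.congr_fun this _

lemma lTensor_act {m n : ℕ} (f : A →ₐ[k] ⨂[k]^n A) (Φ : ⨂[k]^m A →ₗ[k] ⨂[k]^n A) (z) :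
    (act f Φ).lTensor A z =
      (mulMap f Φ).lTensor A ((coactLAlg k A m).toLinearMap.lTensor A z) := by
  rw [← LinearMap.lTensor_comp_apply]
  rfl

set_option synthInstance.maxHeartbeats 200000 in
/-- Convolution with `f` is inverse to convolution with `g` if `f * g = ε`. -/
lemma act_act {m n : ℕ} {f g : A →ₐ[k] ⨂[k]^n A}
    (h : ∀ a, Algebra.TensorProduct.productMap f g (Coalgebra.comul (R := k) a) =
      algebraMap k _ (Coalgebra.counit (R := k) a)) (Φ : ⨂[k]^m A →ₗ[k] ⨂[k]^n A) :
    act f (act g Φ) = Φ := by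
  ext1
  ext x
  simp only [LinearMap.compMultilinearMap_apply]
  generalize PiTensorProduct.tprod k x = x
  have h1 : act f (act g Φ) x = (LinearMap.mul' k (⨂[k]^n A) ∘ₗ TensorProduct.map f.toLinearMap
      (mulMap g Φ)) ((coactLAlg k A m).toLinearMap.lTensor A (coactLAlg k A m x)) := by
    rw [act_apply]
    generalize coactLAlg k A m x = w
    induction w with
    | zero => simp
    | tmul a y => simp [act_apply]
    | add y z hy hz => simp only [map_add, hy, hz]
  -- Coassociativity replaces two successive coactions by one coaction followed by a coproduct, on
  -- which `f` and `g` convolve to the counit.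
  rw [h1, comp_coactLAlg_ext (G := Φ ∘ₗ (TensorProduct.lid k (⨂[k]^m A)).toLinearMap ∘ₗ
    (Coalgebra.counit (R := k) (A := A)).rTensor (⨂[k]^m A))]
  · exact congrArg Φ (rTensor_counit_coactLAlg m x)
  · intro a y
    have h2 : ∀ z : A ⊗[k] A, (LinearMap.mul' k (⨂[k]^n A) ∘ₗ TensorProduct.map f.toLinearMap
        (mulMap g Φ)) (TensorProduct.assoc k A A _ (z ⊗ₜ y)) =
          Algebra.TensorProduct.productMap f g z * Φ y := by
      intro z
      induction z with
      | zero => simp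
      | tmul b c => simp [mul_assoc]
      | add z w hz hw => simp only [TensorProduct.add_tmul, map_add, add_mul, hz, hw]
    rw [h2, h]
    simp [Algebra.algebraMap_eq_smul_one]

variable (k A) in
/-- The antipode of `A`. -/
def antipode : A →ₐ[k] A :=
  (MvPolynomial.aeval fun i => -var k A i).comp (equiv (k := k) (A := A)).symm.toAlgHom

@[simp] lemma antipode_var (i : Fin (dim k A)) : antipode k A (var k A i) = -var k A i := by
  simp [antipode, var]

lemma productMap_antipode_right (a : A) :
    Algebra.TensorProduct.productMap (AlgHom.id k A) (antipode k A) (Coalgebra.comul (R := k) a) =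
      algebraMap k _ (Coalgebra.counit (R := k) a) := by
  have : (Algebra.TensorProduct.productMap (AlgHom.id k A) (antipode k A)).comp
      (Bialgebra.comulAlgHom k A) = (Algebra.ofId k A).comp (Bialgebra.counitAlgHom k A) := by
    refine algHom_ext fun v => ?_
    simp
  exact AlgHom.congr_fun this a

lemma productMap_antipode_left (a : A) :
    Algebra.TensorProduct.productMap (antipode k A) (AlgHom.id k A) (Coalgebra.comul (R := k) a) =
      algebraMap k _ (Coalgebra.counit (R := k) a) := by
  have : (Algebra.TensorProduct.productMap (antipode k A) (AlgHom.id k A)).comp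
      (Bialgebra.comulAlgHom k A) = (Algebra.ofId k A).comp (Bialgebra.counitAlgHom k A) := by
    refine algHom_ext fun v => ?_
    simp
  exact AlgHom.congr_fun this a

lemma productMap_comp_apply {S : Type*} [CommSemiring S] [Algebra k S] (ρ : A →ₐ[k] S)
    (f g : A →ₐ[k] A) (z : A ⊗[k] A) :
    Algebra.TensorProduct.productMap (ρ.comp f) (ρ.comp g) z =
      ρ (Algebra.TensorProduct.productMap f g z) := by
  induction z with
  | zero => simp
  | tmul a b => simp
  | add z w hz hw => simp only [map_add, hz, hw]

/-- Composing with an algebra homomorphism preserves convolution inverses, so `Δ^{n-1} ∘ S` is the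
convolution inverse of `Δ^{n-1}`, with `S` the antipode. -/
lemma act_comulPowAlg_antipode {m n : ℕ} (Φ : ⨂[k]^m A →ₗ[k] ⨂[k]^n A) :
    act (comulPowAlg k A n) (act ((comulPowAlg k A n).comp (antipode k A)) Φ) = Φ := by
  refine act_act (fun a => ?_) Φ
  have := productMap_comp_apply (comulPowAlg k A n) (AlgHom.id k A) (antipode k A)
    (Coalgebra.comul (R := k) a)
  rwa [AlgHom.comp_id, productMap_antipode_right, AlgHom.commutes] at this

lemma act_antipode_comulPowAlg {m n : ℕ} (Φ : ⨂[k]^m A →ₗ[k] ⨂[k]^n A) :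
    act ((comulPowAlg k A n).comp (antipode k A)) (act (comulPowAlg k A n) Φ) = Φ := by
  refine act_act (fun a => ?_) Φ
  have := productMap_comp_apply (comulPowAlg k A n) (antipode k A) (AlgHom.id k A)
    (Coalgebra.comul (R := k) a)
  rwa [AlgHom.comp_id, productMap_antipode_left, AlgHom.commutes] at this

/-- The convolution with the iterated coproduct, an automorphism of `Hom(A^{⊗m}, A^{⊗n})`. -/
def twist (m n : ℕ) :
    (⨂[k]^m A →ₗ[k] ⨂[k]^n A) ≃ₗ[k] (⨂[k]^m A →ₗ[k] ⨂[k]^n A) where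
  __ := act (comulPowAlg k A n)
  invFun := act ((comulPowAlg k A n).comp (antipode k A))
  left_inv := act_antipode_comulPowAlg
  right_inv := act_comulPowAlg_antipode

lemma twist_apply {m n : ℕ} (Φ : ⨂[k]^m A →ₗ[k] ⨂[k]^n A) (x : ⨂[k]^m A) :
    twist m n Φ x = mulMap (comulPowAlg k A n) Φ (coactLAlg k A m x) := rfl

variable (k A) in
/-- `a ⊗ x ↦ ε(a) x`. -/
def counitL (m : ℕ) : ⨂[k]^(m + 1) A →ₗ[k] ⨂[k]^m A :=
  (TensorProduct.lid k _).toLinearMap ∘ₗ (Coalgebra.counit (R := k) (A := A)).rTensor _ ∘ₗ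
    (cons k A m).symm.toLinearMap

variable (k A) in
/-- `x ⊗ a ↦ ε(a) x`. -/
def counitR (m : ℕ) : ⨂[k]^(m + 1) A →ₗ[k] ⨂[k]^m A :=
  (TensorProduct.rid k _).toLinearMap ∘ₗ (Coalgebra.counit (R := k) (A := A)).lTensor _ ∘ₗ
    (snoc k A m).symm.toLinearMap

@[simp] lemma counitL_cons (m : ℕ) (a : A) (x : ⨂[k]^m A) :
    counitL k A m (cons k A m (a ⊗ₜ x)) = Coalgebra.counit (R := k) a • x := by
  simp [counitL]

@[simp] lemma counitR_snoc (m : ℕ) (a : A) (x : ⨂[k]^m A) :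
    counitR k A m (snoc k A m (x ⊗ₜ a)) = Coalgebra.counit (R := k) a • x := by
  simp [counitR]

lemma snoc_mul (n : ℕ) (x y : ⨂[k]^n A) (a b : A) :
    snoc k A n (x ⊗ₜ a) * snoc k A n (y ⊗ₜ b) = snoc k A n ((x * y) ⊗ₜ (a * b)) := by
  rw [← Algebra.TensorProduct.tmul_mul_tmul, ← snocAlg_apply, ← snocAlg_apply, ← snocAlg_apply,
    map_mul]

lemma mulMap_lTensor {m m' n : ℕ} (f : A →ₐ[k] ⨂[k]^n A) (Φ : ⨂[k]^m A →ₗ[k] ⨂[k]^n A)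
    (g : ⨂[k]^m' A →ₐ[k] ⨂[k]^m A) (z : A ⊗[k] (⨂[k]^m' A)) :
    mulMap f Φ (Algebra.TensorProduct.map (AlgHom.id k A) g z) =
      mulMap f (Φ ∘ₗ g.toLinearMap) z := by
  induction z with
  | zero => simp
  | tmul a x => simp
  | add z w hz hw => simp only [map_add, hz, hw]

lemma twist_comp_mulAt {m n : ℕ} (Φ : ⨂[k]^m A →ₗ[k] ⨂[k]^n A) (i : Fin m) :
    twist m n Φ ∘ₗ mulAt k A m i = twist (m + 1) n (Φ ∘ₗ mulAt k A m i) := by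
  refine LinearMap.ext fun x => ?_
  rw [← mulAtAlg_toLinearMap, LinearMap.comp_apply, twist_apply, twist_apply, ← mulMap_lTensor]
  congr 1
  exact AlgHom.congr_fun (coactLAlg_mulAtAlg m i) x

/-- The factor `Δ^{n-1}(a)` is already supplied by the twist: the coaction on `a ⊗ x` produces
`a⁽¹⁾` on the left, and the counit applied to `a⁽²⁾` recovers `a`. -/
lemma faceL_twist {m n : ℕ} (Φ : ⨂[k]^m A →ₗ[k] ⨂[k]^n A) :
    faceL (twist m n Φ) = twist (m + 1) n (Φ ∘ₗ counitL k A m) := by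
  refine cons_ext fun a x => ?_
  have key : ∀ (z : A ⊗[k] A) (y : A ⊗[k] (⨂[k]^m A)),
      mulMap (comulPowAlg k A n) (Φ ∘ₗ counitL k A m)
        (Algebra.TensorProduct.map (AlgHom.id k A) (consL k A m) z *
          Algebra.TensorProduct.map (AlgHom.id k A) (consR k A m) y) =
      comulPowAlg k A n (TensorProduct.rid k A
        ((Coalgebra.counit (R := k) (A := A)).lTensor A z)) * mulMap (comulPowAlg k A n) Φ y := by
    intro z y
    induction z with
    | zero => simp
    | tmul a b =>
      induction y with
      | zero => simp
      | tmul c x =>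
        simp [consL_mul_consR, mul_assoc]
      | add y z hy hz => simp only [map_add, mul_add, hy, hz]
    | add y z hy hz => simp only [map_add, add_mul, hy, hz]
  have h1 : coactLAlg k A (m + 1) (cons k A m (a ⊗ₜ x)) =
      Algebra.TensorProduct.map (AlgHom.id k A) (consL k A m) (Coalgebra.comul (R := k) a) *
          Algebra.TensorProduct.map (AlgHom.id k A) (consR k A m) (coactLAlg k A m x) := by
    simp [coactLAlg]
  rw [twist_apply, h1, key, Coalgebra.lTensor_counit_comul, TensorProduct.rid_tmul, one_smul,
    ← twist_apply, faceL, ← comulPowAlg_toLinearMap]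
  simp

lemma coactLAlg_snoc (m : ℕ) (x : ⨂[k]^m A) (a : A) :
    coactLAlg k A (m + 1) (snoc k A m (x ⊗ₜ a)) =
      Algebra.TensorProduct.map (AlgHom.id k A)
        ((snocAlg k A m).toAlgHom.comp Algebra.TensorProduct.includeLeft) (coactLAlg k A m x) *
      Algebra.TensorProduct.map (AlgHom.id k A)
        ((snocAlg k A m).toAlgHom.comp Algebra.TensorProduct.includeRight)
          (Coalgebra.comul (R := k) a) := by
  have : (coactLAlg k A (m + 1)).comp (snocAlg k A m).toAlgHom =
      Algebra.TensorProduct.productMap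
        ((Algebra.TensorProduct.map (AlgHom.id k A)
        ((snocAlg k A m).toAlgHom.comp Algebra.TensorProduct.includeLeft)).comp (coactLAlg k A m))
        ((Algebra.TensorProduct.map (AlgHom.id k A)
        ((snocAlg k A m).toAlgHom.comp Algebra.TensorProduct.includeRight)).comp
          (Bialgebra.comulAlgHom k A)) := by
    refine gen_tensor_ext (fun v i => ?_) (fun v => ?_)
    · simp [snocAlg_gen, coactLAlg_gen]
    · simp [snocAlg_var, coactLAlg_gen]
  exact AlgHom.congr_fun this (x ⊗ₜ a)

lemma snoc_ext {n : ℕ} {M : Type*} [AddCommMonoid M] [Module k M]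
    {f g : ⨂[k]^(n + 1) A →ₗ[k] M} (h : ∀ x a, f (snoc k A n (x ⊗ₜ a)) = g (snoc k A n (x ⊗ₜ a))) :
    f = g := by
  have : f ∘ₗ (snoc k A n).toLinearMap = g ∘ₗ (snoc k A n).toLinearMap :=
    TensorProduct.ext' h
  refine LinearMap.ext fun x => ?_
  have h2 := LinearMap.congr_fun this ((snoc k A n).symm x)
  simpa using h2

/-- As for the left face, except that the factor `Δ^{n-1}(a)` must be moved past `Φ`, which uses
commutativity of `A^{⊗n}`. -/
lemma faceR_twist {m n : ℕ} (Φ : ⨂[k]^m A →ₗ[k] ⨂[k]^n A) :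
    faceR (twist m n Φ) = twist (m + 1) n (Φ ∘ₗ counitR k A m) := by
  refine snoc_ext fun x a => ?_
  have key : ∀ (z : A ⊗[k] A) (y : A ⊗[k] (⨂[k]^m A)),
      mulMap (comulPowAlg k A n) (Φ ∘ₗ counitR k A m)
        (Algebra.TensorProduct.map (AlgHom.id k A)
          ((snocAlg k A m).toAlgHom.comp Algebra.TensorProduct.includeLeft) y *
          Algebra.TensorProduct.map (AlgHom.id k A)
            ((snocAlg k A m).toAlgHom.comp Algebra.TensorProduct.includeRight) z) =
      mulMap (comulPowAlg k A n) Φ y * comulPowAlg k A n (TensorProduct.rid k A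
        ((Coalgebra.counit (R := k) (A := A)).lTensor A z)) := by
    intro z y
    induction z with
    | zero => simp
    | tmul a b =>
      induction y with
      | zero => simp
      | tmul c x =>
        simp [snoc_mul, mul_assoc, mul_comm]
      | add y z hy hz => simp only [map_add, add_mul, hy, hz]
    | add y z hy hz => simp only [map_add, mul_add, hy, hz]
  rw [twist_apply, coactLAlg_snoc, key, Coalgebra.lTensor_counit_comul, TensorProduct.rid_tmul,
    one_smul, ← twist_apply, faceR, ← comulPowAlg_toLinearMap]
  simp

-- By coassociativity the twist by `Δ^n` splits as `a⁽¹⁾ ⊗ Δ^{n-1}(a⁽²⁾)`; its first leg is exactly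
-- the product that the coface inserts, so before twisting only a unit is inserted.
set_option synthInstance.maxHeartbeats 200000 in
lemma cofaceL_twist {m n : ℕ} (Φ : ⨂[k]^m A →ₗ[k] ⨂[k]^n A) :
    cofaceL (twist m n Φ) = twist m (n + 1) ((consR k A n).toLinearMap ∘ₗ Φ) := by
  refine LinearMap.ext fun x => ?_
  rw [twist_apply, cofaceL, ← coactLAlg_toLinearMap, LinearMap.comp_apply, LinearMap.comp_apply]
  change (cons k A n).toLinearMap ((act _ Φ).lTensor A (coactLAlg k A m x)) = _
  rw [lTensor_act]
  refine comp_coactLAlg_ext (F := (cons k A n).toLinearMap ∘ₗ (mulMap _ Φ).lTensor A) ?_ x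
  intro a y
  rw [mulMap_tmul, comulPowAlg, AlgHom.comp_apply, Bialgebra.comulAlgHom_apply]
  induction (Coalgebra.comul (R := k) a) with
  | zero => simp
  | tmul b c =>
    simp [consL_apply, consR_apply, cons_mul]
  | add y z hy hz => simp only [map_add, TensorProduct.add_tmul, add_mul, hy, hz]

set_option synthInstance.maxHeartbeats 200000 in
lemma cofaceR_twist {m n : ℕ} (Φ : ⨂[k]^m A →ₗ[k] ⨂[k]^n A) :
    cofaceR (twist m n Φ) = twist m (n + 1)
      ((snoc k A n).toLinearMap ∘ₗ (TensorProduct.mk k _ A).flip 1 ∘ₗ Φ) := by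
  refine LinearMap.ext fun x => ?_
  have h1 : ∀ z, (act (comulPowAlg k A n) Φ).rTensor A (TensorProduct.comm k A (⨂[k]^m A) z) =
      TensorProduct.comm k A _ ((act (comulPowAlg k A n) Φ).lTensor A z) := by
    intro z
    induction z with
    | zero => simp
    | tmul a x => simp
    | add y z hy hz => simp only [map_add, hy, hz]
  have h2 : coactR k A m x = TensorProduct.comm k A (⨂[k]^m A) (coactLAlg k A m x) := by
    rw [← coactRAlg_toLinearMap, coactRAlg_eq]
    rfl
  rw [twist_apply, cofaceR, LinearMap.comp_apply, LinearMap.comp_apply, h2]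
  change (snoc k A n).toLinearMap ((act _ Φ).rTensor A _) = _
  rw [h1, lTensor_act]
  refine comp_coactLAlg_ext (F := (snoc k A n).toLinearMap ∘ₗ
    (TensorProduct.comm k A _).toLinearMap ∘ₗ (mulMap _ Φ).lTensor A) ?_ x
  intro a y
  rw [mulMap_tmul, comulPowAlg_eq_snoc, AlgHom.comp_apply, AlgHom.comp_apply,
    Bialgebra.comulAlgHom_apply]
  -- Splitting off the last factor gives `Δ^{n-1}(a⁽¹⁾) ⊗ a⁽²⁾`, whereas the flipped coaction gives
  -- the legs in the other order; cocommutativity reconciles them.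
  conv_rhs => rw [← Coalgebra.comm_comul k a]
  induction (Coalgebra.comul (R := k) a) with
  | zero => simp
  | tmul b c => simp [snoc_mul]
  | add y z hy hz => simp only [map_add, TensorProduct.add_tmul, add_mul, hy, hz]

lemma comulAt_comp_twist {m n : ℕ} (Φ : ⨂[k]^m A →ₗ[k] ⨂[k]^n A) (i : Fin n) :
    comulAt k A n i ∘ₗ twist m n Φ = twist m (n + 1) (comulAt k A n i ∘ₗ Φ) := by
  refine LinearMap.ext fun x => ?_
  rw [← comulAtAlg_toLinearMap, LinearMap.comp_apply, twist_apply, twist_apply]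
  generalize coactLAlg k A m x = w
  induction w with
  | zero => simp
  | tmul a x =>
    rw [mulMap_tmul, mulMap_tmul, ← comulAtAlg_comp_comulPowAlg n i]
    simp
  | add y z hy hz => simp only [map_add, hy, hz]

variable (k A) in
/-- The differential of the bar complex of `A` with trivial coefficients. -/
def barD (m : ℕ) : ⨂[k]^(m + 1) A →ₗ[k] ⨂[k]^m A :=
  counitL k A m + ∑ i : Fin m, (-1 : k) ^ (i.val + 1) • mulAt k A m i +
    (-1 : k) ^ (m + 1) • counitR k A m

variable (k A) in
/-- The differential of the cobar complex of `A` with trivial coefficients. -/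
def cobarD (n : ℕ) : ⨂[k]^n A →ₗ[k] ⨂[k]^(n + 1) A :=
  (consR k A n).toLinearMap + ∑ i : Fin n, (-1 : k) ^ (i.val + 1) • comulAt k A n i +
    (-1 : k) ^ (n + 1) • ((snoc k A n).toLinearMap ∘ₗ (TensorProduct.mk k _ A).flip 1)

lemma comp_sum_apply {M N P ι : Type*} [AddCommGroup M] [AddCommGroup N] [AddCommGroup P]
    [Module k M] [Module k N] [Module k P] (s : Finset ι) (f : N →ₗ[k] P) (g : ι → M →ₗ[k] N) :
    f ∘ₗ (∑ i ∈ s, g i) = ∑ i ∈ s, f ∘ₗ g i := by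
  ext x
  simp

lemma sum_comp_apply {M N P ι : Type*} [AddCommGroup M] [AddCommGroup N] [AddCommGroup P]
    [Module k M] [Module k N] [Module k P] (s : Finset ι) (f : M →ₗ[k] N) (g : ι → N →ₗ[k] P) :
    (∑ i ∈ s, g i) ∘ₗ f = ∑ i ∈ s, g i ∘ₗ f := by
  ext x
  simp

/-- After the twist the Hochschild differential no longer sees the target: the outer faces are
counits and the inner ones commute with the twist. -/
lemma d₁_twist {m n : ℕ} (Φ : ⨂[k]^m A →ₗ[k] ⨂[k]^n A) :
    d₁ (twist m n Φ) = twist (m + 1) n (Φ ∘ₗ barD k A m) := by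
  rw [d₁, faceL_twist, faceR_twist, barD]
  simp only [twist_comp_mulAt, LinearMap.comp_add, comp_sum_apply, LinearMap.comp_smul, map_add,
    map_sum, map_smul]

lemma d₂_twist {m n : ℕ} (Φ : ⨂[k]^m A →ₗ[k] ⨂[k]^n A) :
    d₂ (twist m n Φ) = twist m (n + 1) (cobarD k A n ∘ₗ Φ) := by
  rw [d₂, cofaceL_twist, cofaceR_twist, cobarD]
  simp only [comulAt_comp_twist, LinearMap.add_comp, sum_comp_apply, LinearMap.smul_comp, map_add,
    map_sum, map_smul, LinearMap.comp_assoc]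

end Twist

/-! ### Wedge and contraction on exterior powers. -/

section Exterior

open ExteriorAlgebra

variable {k : Type*} [CommRing k] {d : ℕ}

variable (k d) in
/-- The exterior powers of `k^d`. -/
abbrev Ext (q : ℕ) : Type _ := ⋀[k]^q (Fin d → k)

lemma contractLeft_mem {M : Type*} [AddCommGroup M] [Module k M] (φ : Module.Dual k M) {q : ℕ}
    {y : ExteriorAlgebra k M} (hy : y ∈ ⋀[k]^(q + 1) M) :
    CliffordAlgebra.contractLeft φ y ∈ ⋀[k]^q M := by
  induction q generalizing y with
  | zero =>
    rw [zero_add, exteriorPower, pow_one] at hy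
    obtain ⟨v, rfl⟩ := hy
    rw [exteriorPower, pow_zero, ι, CliffordAlgebra.contractLeft_ι]
    exact Submodule.algebraMap_mem _
  | succ q ih =>
    rw [exteriorPower, pow_succ'] at hy
    refine Submodule.mul_induction_on hy ?_ ?_
    · rintro _ ⟨v, rfl⟩ y hy
      rw [ι, CliffordAlgebra.contractLeft_ι_mul]
      refine sub_mem (Submodule.smul_mem _ _ hy) ?_
      rw [exteriorPower, pow_succ']
      exact Submodule.mul_mem_mul ⟨v, rfl⟩ (ih hy)
    · intro x y hx hy
      rw [map_add]
      exact add_mem hx hy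

/-- Exterior multiplication by the `i`-th basis vector. -/
def wedge (q : ℕ) (i : Fin d) : Ext k d q →ₗ[k] Ext k d (q + 1) :=
  (LinearMap.mulLeft k (ι k (Pi.single i 1 : Fin d → k))).restrict fun y hy => by
    rw [exteriorPower, pow_succ']
    exact Submodule.mul_mem_mul ⟨_, rfl⟩ hy

/-- Contraction with the `i`-th coordinate. -/
def contract (q : ℕ) (i : Fin d) : Ext k d (q + 1) →ₗ[k] Ext k d q :=
  (CliffordAlgebra.contractLeft (LinearMap.proj i : (Fin d → k) →ₗ[k] k)).restrict
    fun _ hy => contractLeft_mem _ hy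

lemma coe_wedge (q : ℕ) (i : Fin d) (y : Ext k d q) :
    (wedge q i y : ExteriorAlgebra k (Fin d → k)) = ι k (Pi.single i 1 : Fin d → k) * y := rfl

lemma coe_contract (q : ℕ) (i : Fin d) (y : Ext k d (q + 1)) :
    (contract q i y : ExteriorAlgebra k (Fin d → k)) =
      CliffordAlgebra.contractLeft (LinearMap.proj i : (Fin d → k) →ₗ[k] k) y.1 := rfl

lemma wedge_anticomm (q : ℕ) (i j : Fin d) (y : Ext k d q) :
    wedge (q + 1) i (wedge q j y) = - wedge (q + 1) j (wedge q i y) := by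
  apply Subtype.ext
  rw [Submodule.coe_neg, coe_wedge, coe_wedge, coe_wedge, coe_wedge, ← mul_assoc, ← mul_assoc,
    ← neg_mul, eq_neg_of_add_eq_zero_left (ι_add_mul_swap _ _)]

lemma contract_anticomm (q : ℕ) (i j : Fin d) (y : Ext k d (q + 2)) :
    contract q i (contract (q + 1) j y) = - contract q j (contract (q + 1) i y) :=
  Subtype.ext (CliffordAlgebra.contractLeft_comm _ _ _)

/-- Contraction is an antiderivation; this gives the canonical anticommutation relations. Degree 0
is stated separately because there is no degree below it to contract into. -/
lemma contract_wedge (q : ℕ) (i j : Fin d) (y : Ext k d (q + 1)) :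
    contract (q + 1) i (wedge (q + 1) j y) + wedge q j (contract q i y) =
      if i = j then y else 0 := by
  apply Subtype.ext
  rw [Submodule.coe_add, coe_wedge, coe_contract, coe_wedge, ι, CliffordAlgebra.contractLeft_ι_mul,
    coe_contract, sub_add_cancel]
  split_ifs with h <;> simp [h]

lemma contract_wedge_zero (i j : Fin d) (y : Ext k d 0) :
    contract 0 i (wedge 0 j y) = if i = j then y else 0 := by
  apply Subtype.ext
  obtain ⟨y, hy⟩ := y
  rw [exteriorPower, pow_zero, Submodule.mem_one] at hy
  obtain ⟨r, rfl⟩ := hy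
  rw [coe_contract, coe_wedge, ι, CliffordAlgebra.contractLeft_ι_mul,
    CliffordAlgebra.contractLeft_algebraMap, mul_zero, sub_zero]
  split_ifs with h <;> simp [h]

/-- The exterior counterpart of Euler's operator, counting the degree. It follows by induction on
the number of factors, each new factor contributing 1. -/
lemma sum_wedge_contract (q : ℕ) (y : Ext k d (q + 1)) :
    ∑ i, wedge q i (contract q i y) = ((q : k) + 1) • y := by
  have key : ∀ q, ∀ y ∈ ⋀[k]^q (Fin d → k), ∑ i : Fin d, ι k (Pi.single i 1 : Fin d → k) *
      CliffordAlgebra.contractLeft (LinearMap.proj i : (Fin d → k) →ₗ[k] k) y = (q : k) • y := by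
    intro q
    induction q with
    | zero =>
      intro y hy
      rw [exteriorPower, pow_zero, Submodule.mem_one] at hy
      obtain ⟨r, rfl⟩ := hy
      simp [CliffordAlgebra.contractLeft_algebraMap]
    | succ q ih =>
      intro y hy
      rw [exteriorPower, pow_succ'] at hy
      refine Submodule.mul_induction_on hy ?_ ?_
      · rintro _ ⟨v, rfl⟩ y hy
        have h1 : ∀ i : Fin d, ι k (Pi.single i 1 : Fin d → k) *
            CliffordAlgebra.contractLeft (LinearMap.proj i : (Fin d → k) →ₗ[k] k) (ι k v * y) =
            v i • ι k (Pi.single i 1 : Fin d → k) * y + ι k v *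
              (ι k (Pi.single i 1 : Fin d → k) *
              CliffordAlgebra.contractLeft (LinearMap.proj i : (Fin d → k) →ₗ[k] k) y) := by
          intro i
          rw [ι, CliffordAlgebra.contractLeft_ι_mul, mul_sub, ← mul_assoc, ← mul_assoc,
            eq_neg_of_add_eq_zero_left (ι_add_mul_swap (Pi.single i 1) v)]
          simp
        rw [Finset.sum_congr rfl fun i _ => h1 i, Finset.sum_add_distrib, ← Finset.mul_sum, ih y hy,
          ← Finset.sum_mul]
        -- Contracting `v` itself yields its coordinates, which reassemble `v`: this is the new
        -- factor's contribution to the degree.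
        have h2 : ∑ i, v i • ι k (Pi.single i 1 : Fin d → k) = ι k v := by
          conv_rhs => rw [← Finset.univ_sum_single v, map_sum]
          refine Finset.sum_congr rfl fun i _ => ?_
          rw [← map_smul, ← Pi.single_smul, smul_eq_mul, mul_one]
        rw [h2, mul_smul_comm, Nat.cast_succ, add_smul, one_smul, add_comm]
      · intro x y hx hy
        simp only [map_add, mul_add, Finset.sum_add_distrib, hx, hy, smul_add]
  apply Subtype.ext
  have := key (q + 1) y.1 y.2
  push_cast at this
  rw [Submodule.coe_smul, ← this, AddSubmonoidClass.coe_finsetSum]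
  rfl

end Exterior

/-! ### Multiplication, differentiation and Euler's identity on polynomials. -/

section PolynomialOperators

open PolynomialBialgebra

variable {k : Type*} [Field k] {A : Type*} [CommRing A] [Bialgebra k A]
  [PolynomialBialgebra k A]

variable (k A) in
/-- Multiplication by the `i`-th variable. -/
def mulVar (i : Fin (dim k A)) : Module.End k A := LinearMap.mulLeft k (var k A i)

variable (k A) in
/-- The partial derivative in the `i`-th variable. -/
def deriv (i : Fin (dim k A)) : Module.End k A :=
  (equiv (k := k) (A := A)).toLinearMap ∘ₗ (MvPolynomial.pderiv i).toLinearMap ∘ₗ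
    (equiv (k := k) (A := A)).symm.toLinearMap

variable (k A) in
/-- The operator which acts on polynomials of degree `n` by `(n + q)⁻¹`. -/
def invDegree (q : ℕ) : Module.End k A :=
  (equiv (k := k) (A := A)).toLinearMap ∘ₗ
    (MvPolynomial.basisMonomials (Fin (dim k A)) k).constr k (fun s =>
      ((s.degree + q : ℕ) : k)⁻¹ • MvPolynomial.monomial s (1 : k)) ∘ₗ
    (equiv (k := k) (A := A)).symm.toLinearMap

variable (k A) in
/-- The monomial with exponents `s`. -/
def mono (s : Fin (dim k A) →₀ ℕ) : A := equiv (k := k) (MvPolynomial.monomial s (1 : k))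

lemma mono_ext {M : Type*} [AddCommMonoid M] [Module k M] {f g : A →ₗ[k] M}
    (h : ∀ s, f (mono k A s) = g (mono k A s)) : f = g := by
  have : f ∘ₗ (equiv (k := k) (A := A)).toLinearMap = g ∘ₗ (equiv (k := k) (A := A)).toLinearMap := by
    refine (MvPolynomial.basisMonomials _ k).ext fun s => ?_
    simpa [mono] using h s
  ext a
  have h2 := LinearMap.congr_fun this (equiv.symm a)
  simpa using h2

lemma deriv_equiv (i : Fin (dim k A)) (p : MvPolynomial (Fin (dim k A)) k) :
    deriv k A i (equiv p) = equiv (MvPolynomial.pderiv i p) :=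
  congrArg (fun q => equiv (MvPolynomial.pderiv i q)) (AlgEquiv.symm_apply_apply _ p)

lemma mulVar_mono (i : Fin (dim k A)) (s) :
    mulVar k A i (mono k A s) = mono k A (s + Finsupp.single i 1) := by
  rw [mulVar, LinearMap.mulLeft_apply, mono, mono, var, ← map_mul, MvPolynomial.X,
    MvPolynomial.monomial_mul, one_mul, add_comm]

lemma deriv_mono (i : Fin (dim k A)) (s) :
    deriv k A i (mono k A s) = (s i : k) • mono k A (s - Finsupp.single i 1) := by
  rw [mono, mono, deriv_equiv, MvPolynomial.pderiv_monomial, ← map_smul,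
    MvPolynomial.smul_monomial, one_mul, smul_eq_mul, mul_one]

lemma invDegree_mono (q : ℕ) (s) :
    invDegree k A q (mono k A s) = ((s.degree + q : ℕ) : k)⁻¹ • mono k A s := by
  simp only [invDegree, mono, LinearMap.comp_apply, AlgEquiv.toLinearMap_apply,
    AlgEquiv.symm_apply_apply]
  rw [← map_smul]
  congr 1
  have := Module.Basis.constr_basis (MvPolynomial.basisMonomials (Fin (dim k A)) k) k (fun s =>
      ((s.degree + q : ℕ) : k)⁻¹ • MvPolynomial.monomial s (1 : k)) s
  rwa [MvPolynomial.coe_basisMonomials] at this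

/-- The Weyl relation, the commuting counterpart of `contract_wedge`. -/
lemma deriv_mulVar (i j : Fin (dim k A)) :
    deriv k A j * mulVar k A i = (if i = j then 1 else 0) + mulVar k A i * deriv k A j := by
  refine LinearMap.ext fun a => ?_
  obtain ⟨p, rfl⟩ := (equiv (k := k) (A := A)).surjective a
  simp only [mulVar, var, Module.End.mul_apply, LinearMap.mulLeft_apply, LinearMap.add_apply,
    ← map_mul, deriv_equiv, Derivation.leibniz, MvPolynomial.pderiv_X, map_add, smul_eq_mul]
  rw [add_comm]
  congr 1
  split_ifs with h
  · subst h; simp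
  · simp [h]

lemma mulVar_comm (i j : Fin (dim k A)) : mulVar k A i * mulVar k A j = mulVar k A j * mulVar k A i := by
  ext a
  simp only [mulVar, Module.End.mul_apply, LinearMap.mulLeft_apply]
  ring

lemma deriv_comm (i j : Fin (dim k A)) : deriv k A i * deriv k A j = deriv k A j * deriv k A i := by
  refine mono_ext fun s => ?_
  rcases eq_or_ne i j with rfl | h
  · rfl
  · simp only [Module.End.mul_apply, deriv_mono, map_smul, smul_smul, tsub_right_comm]
    congr 1
    simp [h, h.symm, mul_comm]

lemma degree_add_single {ι : Type*} (s : ι →₀ ℕ) (i : ι) :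
    (s + Finsupp.single i 1).degree = s.degree + 1 := by
  rw [map_add, Finsupp.degree_single]

/-- A variable raises the polynomial degree by one, which the shift of `q` absorbs; a derivative
lowers it, giving the next lemma. -/
lemma invDegree_mulVar (q : ℕ) (i : Fin (dim k A)) :
    invDegree k A q * mulVar k A i = mulVar k A i * invDegree k A (q + 1) := by
  refine mono_ext fun s => ?_
  simp only [Module.End.mul_apply, invDegree_mono, mulVar_mono, map_smul, degree_add_single]
  congr 3
  omega

lemma invDegree_deriv (q : ℕ) (i : Fin (dim k A)) :
    invDegree k A (q + 1) * deriv k A i = deriv k A i * invDegree k A q := by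
  refine mono_ext fun s => ?_
  simp only [Module.End.mul_apply, invDegree_mono, deriv_mono, map_smul]
  rcases Nat.eq_zero_or_pos (s i) with h | h
  · simp [h]
  · obtain ⟨t, rfl⟩ : ∃ t, s = t + Finsupp.single i 1 :=
      ⟨s - Finsupp.single i 1, (tsub_add_cancel_of_le (Finsupp.single_le_iff.2 h)).symm⟩
    rw [add_tsub_cancel_right, degree_add_single, smul_comm, add_assoc, add_comm 1 q, smul_comm]

lemma euler_mono (s) :
    (∑ i, mulVar k A i * deriv k A i) (mono k A s) = (s.degree : k) • mono k A s := by
  rw [LinearMap.sum_apply, Finsupp.degree_eq_sum, Nat.cast_sum, Finset.sum_smul]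
  refine Finset.sum_congr rfl fun i _ => ?_
  rw [Module.End.mul_apply, deriv_mono, map_smul, mulVar_mono]
  rcases Nat.eq_zero_or_pos (s i) with h | h
  · simp [h]
  · rw [tsub_add_cancel_of_le (Finsupp.single_le_iff.2 h)]

/-- The total degree, polynomial plus exterior, is at least 1 here, so it is invertible in
characteristic zero. This normalises Euler's identity to a contracting homotopy. -/
lemma euler_invDegree_succ [CharZero k] (q : ℕ) :
    ∑ i, mulVar k A i * deriv k A i * invDegree k A (q + 1) +
      ((q : k) + 1) • invDegree k A (q + 1) = 1 := by
  rw [← Finset.sum_mul]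
  refine mono_ext fun s => ?_
  rw [LinearMap.add_apply, Module.End.mul_apply, LinearMap.smul_apply, invDegree_mono, map_smul,
    euler_mono, smul_smul, smul_smul, ← add_smul]
  have : ((s.degree + (q + 1) : ℕ) : k) ≠ 0 :=
    Nat.cast_ne_zero.2 (by omega)
  rw [mul_comm _ (s.degree : k), ← add_mul]
  push_cast at this ⊢
  rw [mul_inv_cancel₀ this, one_smul, Module.End.one_apply]

lemma euler_invDegree_zero [CharZero k] (a : A) :
    (∑ i, mulVar k A i * deriv k A i * invDegree k A 0) a =
      a - algebraMap k A (Coalgebra.counit (R := k) a) := by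
  rw [← Finset.sum_mul]
  revert a
  suffices (∑ i, mulVar k A i * deriv k A i) * invDegree k A 0 =
      LinearMap.id - Algebra.linearMap k A ∘ₗ Coalgebra.counit from LinearMap.congr_fun this
  refine mono_ext fun s => ?_
  rw [Module.End.mul_apply, invDegree_mono, map_smul, euler_mono, smul_smul]
  -- At `q = 0` the constants are the exception: Euler's operator kills them and the convention `0⁻¹
  -- = 0` is harmless. They account for the counit term.
  rcases eq_or_ne s 0 with rfl | hs
  · simp [mono]
  · have h1 : ((s.degree : ℕ) : k) ≠ 0 := by
      rw [Nat.cast_ne_zero, Ne, Finsupp.degree_eq_zero_iff]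
      exact hs
    have h2 : Coalgebra.counit (R := k) (mono k A s) = 0 := by
      obtain ⟨i, hi⟩ := Finsupp.ne_iff.1 hs
      have : 1 ≤ s i := Nat.one_le_iff_ne_zero.2 hi
      rw [← tsub_add_cancel_of_le (Finsupp.single_le_iff.2 this), ← mulVar_mono, mulVar, LinearMap.mulLeft_apply, Bialgebra.counit_mul, counit_var, zero_mul]
    rw [add_zero, inv_mul_cancel₀ h1]
    simp [h2]

lemma deriv_one (i : Fin (dim k A)) : deriv k A i 1 = 0 := by
  simp [deriv]

lemma deriv_mul (i : Fin (dim k A)) (a b : A) :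
    deriv k A i (a * b) = deriv k A i a * b + a * deriv k A i b := by
  simp [deriv, Derivation.leibniz, mul_comm, add_comm]

lemma rTensor_deriv_mul (i : Fin (dim k A)) (y z : A ⊗[k] A) :
    (deriv k A i).rTensor A (y * z) =
      (deriv k A i).rTensor A y * z + y * (deriv k A i).rTensor A z := by
  induction y with
  | zero => simp
  | add x y hx hy => simp only [add_mul, map_add, hx, hy]; abel
  | tmul a b =>
    induction z with
    | zero => simp
    | add x y hx hy => simp only [mul_add, map_add, hx, hy]; abel
    | tmul c d => simp [deriv_mul, TensorProduct.add_tmul]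

lemma deriv_var (i j : Fin (dim k A)) : deriv k A i (var k A j) = if j = i then 1 else 0 := by
  have := LinearMap.congr_fun (deriv_mulVar (k := k) (A := A) j i) 1
  simp only [Module.End.mul_apply, mulVar, LinearMap.mulLeft_apply, mul_one, LinearMap.add_apply,
    deriv_one, mul_zero, add_zero] at this
  rw [this]
  split_ifs <;> rfl

/-- Derivatives are compatible with the comultiplication. -/
lemma comul_deriv (i : Fin (dim k A)) (a : A) : Coalgebra.comul (R := k) (deriv k A i a) =
    (deriv k A i).rTensor A (Coalgebra.comul (R := k) a) := by
  refine var_induction (k := k) (P := fun a => Coalgebra.comul (R := k) (deriv k A i a) =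
    (deriv k A i).rTensor A (Coalgebra.comul (R := k) a)) (fun r => ?_) (fun a b ha hb => ?_)
    (fun a j ha => ?_) a
  · simp [Algebra.algebraMap_eq_smul_one, deriv_one, Algebra.TensorProduct.one_def]
  · simp only [map_add, ha, hb]
  · rw [deriv_mul, map_add, Bialgebra.comul_mul, Bialgebra.comul_mul, ha, Bialgebra.comul_mul,
      rTensor_deriv_mul, deriv_var, comul_var]
    congr 2
    split_ifs with h <;> simp [deriv_var, h, deriv_one, Algebra.TensorProduct.one_def]

end PolynomialOperators

/-! ### Bar and cobar complexes and their resolutions. -/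

section BarCobar

open PolynomialBialgebra

variable {k : Type*} [Field k] {A : Type*} [CommRing A] [Bialgebra k A]
  [PolynomialBialgebra k A]

lemma counitR_cons (m : ℕ) (a : A) (x : ⨂[k]^(m + 1) A) :
    counitR k A (m + 1) (cons k A (m + 1) (a ⊗ₜ x)) = cons k A m (a ⊗ₜ counitR k A m x) := by
  obtain ⟨z, rfl⟩ := (snoc k A m).surjective x
  induction z with
  | zero => simp
  | tmul y b => rw [← snoc_cons, counitR_snoc, counitR_snoc, TensorProduct.tmul_smul, map_smul]
  | add x y hx hy => simp only [map_add, TensorProduct.tmul_add, hx, hy]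

lemma counitR_zero (a : A) :
    counitR k A 0 (cons k A 0 (a ⊗ₜ 1)) = Coalgebra.counit (R := k) a • 1 := by
  rw [← snoc_zero, counitR_snoc]

variable (k A) in
/-- The part of the bar differential which does not involve the counit on the first factor. -/
def barTail (m : ℕ) : ⨂[k]^(m + 1) A →ₗ[k] ⨂[k]^m A := counitL k A m - barD k A m

lemma barD_eq (m : ℕ) : barD k A m = counitL k A m - barTail k A m := by
  rw [barTail, sub_sub_cancel]

lemma barTail_eq (m : ℕ) : barTail k A m =
    ∑ i : Fin m, (-1 : k) ^ i.val • mulAt k A m i + (-1 : k) ^ m • counitR k A m := by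
  refine LinearMap.ext fun x => ?_
  rw [barTail, barD]
  simp only [LinearMap.add_apply, LinearMap.sub_apply, LinearMap.sum_apply, LinearMap.smul_apply, pow_succ, mul_neg, mul_one, neg_smul, Finset.sum_neg_distrib]
  abel

lemma barTail_zero (a : A) :
    barTail k A 0 (cons k A 0 (a ⊗ₜ 1)) = Coalgebra.counit (R := k) a • 1 := by
  simp [barTail_eq, counitR_zero]

lemma mulAt_zero' (m : ℕ) (a : A) (x : ⨂[k]^(m + 1) A) :
    mulAt k A (m + 1) 0 (cons k A (m + 1) (a ⊗ₜ x)) = consL k A m a * x := by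
  rw [← mulAtAlg_toLinearMap, mulAtAlg_zero, AlgHom.toLinearMap_apply, consLift_cons,
    AlgHom.id_apply]

/-- This recursion exhibits `barTail` as the differential of the bar resolution of the trivial
module, with the first factor as free coefficients. Linearity in that factor, the square-zero
property and the contraction by `1 ⊗ x` all follow from it. -/
lemma barTail_succ (m : ℕ) (a : A) (x : ⨂[k]^(m + 1) A) :
    barTail k A (m + 1) (cons k A (m + 1) (a ⊗ₜ x)) =
      consL k A m a * x - cons k A m (a ⊗ₜ barTail k A m x) := by
  simp only [barTail_eq, LinearMap.add_apply, LinearMap.sum_apply, LinearMap.smul_apply,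
    Fin.sum_univ_succ, mulAt_zero', mulAt_succ, counitR_cons, TensorProduct.tmul_add,
    TensorProduct.tmul_sum, TensorProduct.tmul_smul, map_add, map_sum, map_smul, Fin.val_zero,
    Fin.val_succ, pow_succ, mul_neg, mul_one, neg_smul, Finset.sum_neg_distrib, pow_zero, one_smul]
  abel

lemma consL_mul_cons (m : ℕ) (a b : A) (x : ⨂[k]^m A) :
    consL k A m a * cons k A m (b ⊗ₜ x) = cons k A m ((a * b) ⊗ₜ x) := by
  rw [consL_apply, cons_mul, one_mul]

lemma barTail_consL_mul (m : ℕ) (a : A) (x : ⨂[k]^(m + 2) A) :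
    barTail k A (m + 1) (consL k A (m + 1) a * x) = consL k A m a * barTail k A (m + 1) x := by
  induction x using cons_induction with
  | h0 => simp
  | h b x =>
    rw [consL_mul_cons, barTail_succ, barTail_succ, mul_sub, consL_mul_cons, map_mul, mul_assoc]
  | hadd x y hx hy =>
    simp only [mul_add, map_add, hx, hy]

lemma zero_eq_smul_one (x : ⨂[k]^0 A) : ∃ r : k, x = r • 1 := by
  obtain ⟨r, rfl⟩ := (PiTensorProduct.isEmptyEquiv (R := k) (s := fun _ : Fin 0 => A) (Fin 0)).symm.surjective x
  refine ⟨r, ?_⟩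
  rw [PiTensorProduct.isEmptyEquiv_symm_apply, PiTensorProduct.one_def]
  congr 2
  exact Subsingleton.elim _ _

lemma barTail_zero_consL_mul (a : A) (x : ⨂[k]^1 A) :
    barTail k A 0 (consL k A 0 a * x) = Coalgebra.counit (R := k) a • barTail k A 0 x := by
  induction x using cons_induction with
  | h0 => simp
  | h b x =>
    obtain ⟨r, rfl⟩ := zero_eq_smul_one x
    rw [consL_mul_cons]
    simp only [TensorProduct.tmul_smul, map_smul, barTail_zero, Bialgebra.counit_mul, mul_smul]
    rw [smul_comm]
  | hadd x y hx hy =>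
    simp only [mul_add, map_add, hx, hy, smul_add]

lemma barTail_barTail (m : ℕ) (x : ⨂[k]^(m + 2) A) :
    barTail k A m (barTail k A (m + 1) x) = 0 := by
  induction m with
  | zero =>
    induction x using cons_induction with
    | h0 => simp
    | h a x =>
      obtain ⟨r, hr⟩ := zero_eq_smul_one (barTail k A 0 x)
      rw [barTail_succ, map_sub, barTail_zero_consL_mul, hr, TensorProduct.tmul_smul, map_smul,
        map_smul, barTail_zero, smul_comm, sub_self]
    | hadd x y hx hy =>
      simp only [map_add, hx, hy, add_zero]
  | succ m ih =>
    induction x using cons_induction with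
    | h0 => simp
    | h a x =>
      rw [barTail_succ, map_sub, barTail_consL_mul, barTail_succ m, ih, TensorProduct.tmul_zero,
        map_zero, sub_zero, sub_self]
    | hadd x y hx hy =>
      simp only [map_add, hx, hy, add_zero]

lemma barTail_consR (m : ℕ) (x : ⨂[k]^(m + 1) A) :
    barTail k A (m + 1) (consR k A (m + 1) x) = x - consR k A m (barTail k A m x) := by
  rw [consR_apply, barTail_succ, map_one, one_mul, consR_apply]

lemma barTail_zero_consR (x : ⨂[k]^0 A) : barTail k A 0 (consR k A 0 x) = x := by
  obtain ⟨r, rfl⟩ := zero_eq_smul_one x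
  simp only [map_smul, consR_apply, barTail_zero, Bialgebra.counit_one, one_smul]

lemma counitL_consL_mul (m : ℕ) (a : A) (x : ⨂[k]^(m + 1) A) :
    counitL k A m (consL k A m a * x) = Coalgebra.counit (R := k) a • counitL k A m x := by
  induction x using cons_induction with
  | h0 => simp
  | h b x =>
    rw [consL_mul_cons, counitL_cons, counitL_cons, Bialgebra.counit_mul, mul_smul]
  | hadd x y hx hy =>
    simp only [mul_add, map_add, hx, hy, smul_add]

lemma counitL_consR (m : ℕ) (x : ⨂[k]^m A) : counitL k A m (consR k A m x) = x := by
  rw [consR_apply, counitL_cons, Bialgebra.counit_one, one_smul]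

/-- The counit on the first factor carries the tail of the bar differential to the bar
differential. -/
lemma counitL_barTail (m : ℕ) (x : ⨂[k]^(m + 2) A) :
    counitL k A m (barTail k A (m + 1) x) = barD k A m (counitL k A (m + 1) x) := by
  induction x using cons_induction with
  | h0 => simp
  | h a x =>
    rw [barTail_succ, map_sub, counitL_consL_mul, counitL_cons, counitL_cons, barD_eq, map_smul,
      LinearMap.sub_apply, smul_sub]
  | hadd x y hx hy =>
    simp only [map_add, hx, hy]

/-- The counit on the first factor is a chain map from the resolution to the bar complex, so the
claim reduces to `barTail_barTail`. -/
lemma barD_comp_barD (m : ℕ) : barD k A m ∘ₗ barD k A (m + 1) = 0 := by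
  ext1
  ext x
  simp only [LinearMap.compMultilinearMap_apply, LinearMap.comp_apply]
  generalize PiTensorProduct.tprod k x = x
  rw [barD_eq (m + 1), LinearMap.sub_apply, map_sub, ← counitL_barTail, barD_eq,
    LinearMap.sub_apply, barTail_barTail]
  simp

variable (k A) in
/-- `x ↦ x ⊗ 1`. -/
def snocOne (n : ℕ) : ⨂[k]^n A →ₗ[k] ⨂[k]^(n + 1) A :=
  (snoc k A n).toLinearMap ∘ₗ (TensorProduct.mk k _ A).flip 1

lemma snocOne_apply (n : ℕ) (x : ⨂[k]^n A) : snocOne k A n x = snoc k A n (x ⊗ₜ 1) := rfl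

variable (k A) in
/-- The part of the cobar differential which does not insert a unit as the first factor. -/
def cobarTail (n : ℕ) : ⨂[k]^n A →ₗ[k] ⨂[k]^(n + 1) A :=
  (consR k A n).toLinearMap - cobarD k A n

lemma cobarD_eq (n : ℕ) : cobarD k A n = (consR k A n).toLinearMap - cobarTail k A n := by
  rw [cobarTail, sub_sub_cancel]

lemma cobarTail_eq (n : ℕ) : cobarTail k A n =
    ∑ i : Fin n, (-1 : k) ^ i.val • comulAt k A n i + (-1 : k) ^ n • snocOne k A n := by
  refine LinearMap.ext fun x => ?_
  rw [cobarTail, cobarD, snocOne]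
  simp only [LinearMap.add_apply, LinearMap.sub_apply, LinearMap.sum_apply, LinearMap.smul_apply, pow_succ, mul_neg, mul_one, neg_smul, Finset.sum_neg_distrib]
  abel

lemma cobarTail_zero (x : ⨂[k]^0 A) : cobarTail k A 0 x = consR k A 0 x := by
  obtain ⟨r, rfl⟩ := zero_eq_smul_one x
  simp [cobarTail_eq, snocOne_apply]

lemma cobarTail_succ (n : ℕ) (a : A) (x : ⨂[k]^n A) :
    cobarTail k A (n + 1) (cons k A n (a ⊗ₜ x)) =
      comulAt k A (n + 1) 0 (cons k A n (a ⊗ₜ x)) -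
        cons k A (n + 1) (a ⊗ₜ cobarTail k A n x) := by
  simp only [cobarTail_eq, LinearMap.add_apply, LinearMap.sum_apply, LinearMap.smul_apply,
    Fin.sum_univ_succ, comulAt_succ, snocOne_apply, snoc_cons, TensorProduct.tmul_add,
    TensorProduct.tmul_sum, TensorProduct.tmul_smul, map_add, map_sum, map_smul, Fin.val_zero,
    Fin.val_succ, pow_succ, mul_neg, mul_one, neg_smul, Finset.sum_neg_distrib, pow_zero, one_smul]
  abel

/-- The map `a ⊗ b ↦ a ⊗ b ⊗ x`. -/
def consTwo {n : ℕ} (x : ⨂[k]^n A) : A ⊗[k] A →ₗ[k] ⨂[k]^(n + 2) A :=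
  (cons k A (n + 1)).toLinearMap ∘ₗ
    ((cons k A n).toLinearMap ∘ₗ (TensorProduct.mk k A _).flip x).lTensor A

@[simp] lemma consTwo_tmul {n : ℕ} (x : ⨂[k]^n A) (a b : A) :
    consTwo x (a ⊗ₜ b) = cons k A (n + 1) (a ⊗ₜ cons k A n (b ⊗ₜ x)) := rfl

set_option synthInstance.maxHeartbeats 200000 in
lemma comulAt_zero' (n : ℕ) (a : A) (x : ⨂[k]^n A) :
    comulAt k A (n + 1) 0 (cons k A n (a ⊗ₜ x)) = consTwo x (Coalgebra.comul (R := k) a) := by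
  rw [comulAt_zero]
  induction (Coalgebra.comul (R := k) a) with
  | zero => simp
  | tmul b c => simp
  | add y z hy hz => simp only [TensorProduct.add_tmul, map_add, hy, hz]

set_option synthInstance.maxHeartbeats 200000 in
lemma comulAt_consTwo_comul (n : ℕ) (a : A) (x : ⨂[k]^n A) :
    comulAt k A (n + 2) 0 (consTwo x (Coalgebra.comul (R := k) a)) =
      cons k A (n + 2) ((consTwo x ∘ₗ Coalgebra.comul (R := k)).lTensor A
        (Coalgebra.comul (R := k) a)) := by
  have h1 : ∀ z : A ⊗[k] A, comulAt k A (n + 2) 0 (consTwo x z) =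
      cons k A (n + 2) ((consTwo x).lTensor A (TensorProduct.assoc k A A A
        ((Coalgebra.comul (R := k)).rTensor A z))) := by
    intro z
    induction z with
    | zero => simp
    | tmul b c =>
      rw [consTwo_tmul, comulAt_zero', LinearMap.rTensor_tmul]
      induction (Coalgebra.comul (R := k) b) with
      | zero => simp
      | tmul b c => simp
      | add y z hy hz => simp only [TensorProduct.add_tmul, map_add, hy, hz]
    | add y z hy hz => simp only [map_add, hy, hz]
  rw [h1, Coalgebra.coassoc_apply, LinearMap.lTensor_comp_apply]

lemma cobarTail_consTwo (n : ℕ) (x : ⨂[k]^n A) (z : A ⊗[k] A) :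
    cobarTail k A (n + 2) (consTwo x z) = comulAt k A (n + 2) 0 (consTwo x z) -
      cons k A (n + 2) ((consTwo x ∘ₗ Coalgebra.comul (R := k)).lTensor A z) +
        consTwo (cobarTail k A n x) z := by
  induction z with
  | zero => simp
  | tmul b c =>
    rw [consTwo_tmul, cobarTail_succ, cobarTail_succ, comulAt_zero' n, TensorProduct.tmul_sub, map_sub,
      ← sub_add, consTwo_tmul]
    rfl
  | add y z hy hz => simp only [map_add, hy, hz]; abel

/-- Unfolding the recursion twice, coassociativity cancels the terms with two coproducts on the
first factor, the mixed terms cancel by sign, and induction handles the rest. -/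
lemma cobarTail_cobarTail (n : ℕ) (x : ⨂[k]^n A) :
    cobarTail k A (n + 1) (cobarTail k A n x) = 0 := by
  induction n with
  | zero =>
    rw [cobarTail_zero, consR_apply, cobarTail_succ, comulAt_zero', Bialgebra.comul_one,
      cobarTail_zero, Algebra.TensorProduct.one_def, consTwo_tmul, consR_apply, sub_self]
  | succ n ih =>
    induction x using cons_induction with
    | h0 => simp
    | h a x =>
      rw [cobarTail_succ, comulAt_zero', map_sub, cobarTail_consTwo, comulAt_consTwo_comul, sub_self,
        zero_add, cobarTail_succ, ih, comulAt_zero']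
      simp
    | hadd x y hx hy =>
      simp only [map_add, hx, hy, add_zero]

lemma counitL_comulAt (n : ℕ) (x : ⨂[k]^(n + 1) A) :
    counitL k A (n + 1) (comulAt k A (n + 1) 0 x) = x := by
  induction x using cons_induction with
  | h0 => simp
  | h a x =>
    rw [comulAt_zero']
    have h : ∀ z : A ⊗[k] A, counitL k A (n + 1) (consTwo x z) =
        cons k A n (TensorProduct.lid k A ((Coalgebra.counit (R := k)).rTensor A z) ⊗ₜ x) := by
      intro z
      induction z with
      | zero => simp
      | tmul b c => simp [← TensorProduct.smul_tmul']
      | add y z hy hz => simp only [map_add, TensorProduct.add_tmul, hy, hz]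
    rw [h, Coalgebra.rTensor_counit_comul, TensorProduct.lid_tmul, one_smul]
  | hadd x y hx hy =>
    simp only [map_add, hx, hy]

/-- The counit law on the first factor makes `counitL` a contracting homotopy for the cobar
resolution. -/
lemma counitL_cobarTail (n : ℕ) (x : ⨂[k]^(n + 1) A) :
    counitL k A (n + 1) (cobarTail k A (n + 1) x) + cobarTail k A n (counitL k A n x) = x := by
  induction x using cons_induction with
  | h0 => simp
  | h a x =>
    rw [cobarTail_succ, map_sub, counitL_comulAt, counitL_cons, counitL_cons, map_smul,
      sub_add_cancel]
  | hadd x y hx hy =>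
    simp only [map_add]
    rw [add_add_add_comm, hx, hy]

lemma counitL_cobarTail_zero (x : ⨂[k]^0 A) : counitL k A 0 (cobarTail k A 0 x) = x := by
  rw [cobarTail_zero, counitL_consR]

/-- Inserting a unit carries the cobar differential to its tail. -/
lemma cobarTail_consR (n : ℕ) (x : ⨂[k]^n A) :
    cobarTail k A (n + 1) (consR k A n x) = consR k A (n + 1) (cobarD k A n x) := by
  rw [consR_apply, cobarTail_succ, comulAt_zero', Bialgebra.comul_one,
    Algebra.TensorProduct.one_def, consTwo_tmul, cobarD_eq, LinearMap.sub_apply, map_sub]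
  rfl

lemma cobarD_comp_cobarD (n : ℕ) : cobarD k A (n + 1) ∘ₗ cobarD k A n = 0 := by
  ext1
  ext x
  simp only [LinearMap.compMultilinearMap_apply, LinearMap.comp_apply]
  generalize PiTensorProduct.tprod k x = x
  rw [cobarD_eq (n + 1), LinearMap.sub_apply, AlgHom.toLinearMap_apply, ← cobarTail_consR,
    ← map_sub, cobarD_eq, LinearMap.sub_apply, AlgHom.toLinearMap_apply, sub_sub_cancel,
    cobarTail_cobarTail]
  rfl

variable (k A) in
/-- The action of operators on the first tensor factor. -/
def onHead (n : ℕ) : Module.End k A →ₐ[k] Module.End k (⨂[k]^(n + 1) A) :=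
  ((cons k A n).conjAlgEquiv k).toAlgHom.comp (Module.End.rTensorAlgHom k A (⨂[k]^n A))

@[simp] lemma onHead_cons (n : ℕ) (φ : Module.End k A) (a : A) (x : ⨂[k]^n A) :
    onHead k A n φ (cons k A n (a ⊗ₜ x)) = cons k A n (φ a ⊗ₜ x) := by
  change cons k A n (φ.rTensor _ ((cons k A n).symm (cons k A n (a ⊗ₜ x)))) = _
  rw [LinearEquiv.symm_apply_apply, LinearMap.rTensor_tmul]

lemma onHead_mulVar (n : ℕ) (i : Fin (dim k A)) (x : ⨂[k]^(n + 1) A) :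
    onHead k A n (mulVar k A i) x = consL k A n (var k A i) * x := by
  induction x using cons_induction with
  | h0 => simp
  | h a x =>
    rw [onHead_cons, consL_mul_cons, mulVar, LinearMap.mulLeft_apply]
  | hadd x y hx hy =>
    simp only [map_add, mul_add, hx, hy]

lemma barTail_onHead (n : ℕ) (i : Fin (dim k A)) (x : ⨂[k]^(n + 2) A) :
    barTail k A (n + 1) (onHead k A (n + 1) (mulVar k A i) x) =
      onHead k A n (mulVar k A i) (barTail k A (n + 1) x) := by
  rw [onHead_mulVar, onHead_mulVar, barTail_consL_mul]

lemma barTail_zero_onHead (i : Fin (dim k A)) (x : ⨂[k]^1 A) :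
    barTail k A 0 (onHead k A 0 (mulVar k A i) x) = 0 := by
  rw [onHead_mulVar, barTail_zero_consL_mul, counit_var, zero_smul]

lemma counitL_onHead (n : ℕ) (i : Fin (dim k A)) (x : ⨂[k]^(n + 1) A) :
    counitL k A n (onHead k A n (mulVar k A i) x) = 0 := by
  rw [onHead_mulVar, counitL_consL_mul, counit_var, zero_smul]

lemma onHead_deriv_consR (n : ℕ) (i : Fin (dim k A)) (x : ⨂[k]^n A) :
    onHead k A n (deriv k A i) (consR k A n x) = 0 := by
  rw [consR_apply, onHead_cons, deriv_one, TensorProduct.zero_tmul, map_zero]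

/-- Only the coproduct of the first factor could interfere, and by `comul_deriv` the derivative
passes to its first leg. This lets de Rham and cobar differentials share a bicomplex. -/
lemma cobarTail_onHead (n : ℕ) (i : Fin (dim k A)) (x : ⨂[k]^(n + 1) A) :
    cobarTail k A (n + 1) (onHead k A n (deriv k A i) x) =
      onHead k A (n + 1) (deriv k A i) (cobarTail k A (n + 1) x) := by
  induction x using cons_induction with
  | h0 => simp
  | h a x =>
    rw [onHead_cons, cobarTail_succ, cobarTail_succ, map_sub, onHead_cons, comulAt_zero',
      comulAt_zero', comul_deriv]
    congr 1
    induction (Coalgebra.comul (R := k) a) with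
    | zero => simp
    | tmul b c => simp
    | add y z hy hz => simp only [map_add, hy, hz]
  | hadd x y hx hy =>
    simp only [map_add, hx, hy]

lemma onHead_euler [CharZero k] (n : ℕ) (x : ⨂[k]^(n + 1) A) :
    onHead k A n (∑ i, mulVar k A i * deriv k A i * invDegree k A 0) x =
      x - consR k A n (counitL k A n x) := by
  induction x using cons_induction with
  | h0 => simp
  | h a x =>
    rw [onHead_cons, euler_invDegree_zero, TensorProduct.sub_tmul, map_sub, counitL_cons, map_smul,
      consR_apply, Algebra.algebraMap_eq_smul_one, ← TensorProduct.smul_tmul', map_smul]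
  | hadd x y hx hy =>
    simp only [map_add, hx, hy]
    abel

end BarCobar

/-! ### Koszul-type operators on a tensor product. -/

section Pairing

variable {k : Type*} [Field k] {ι : Type*} [Fintype ι] {L L' L'' T : Type*} [AddCommGroup L]
  [Module k L] [AddCommGroup L'] [Module k L'] [AddCommGroup L''] [Module k L''] [AddCommGroup T]
  [Module k T]

/-- The operator `∑ i, c i ⊗ P i`. -/
def pairing (c : ι → L →ₗ[k] L') (P : ι → Module.End k T) : L ⊗[k] T →ₗ[k] L' ⊗[k] T :=
  ∑ i, TensorProduct.map (c i) (P i)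

lemma pairing_tmul (c : ι → L →ₗ[k] L') (P : ι → Module.End k T) (y : L) (x : T) :
    pairing c P (y ⊗ₜ x) = ∑ i, c i y ⊗ₜ P i x := by
  simp [pairing]

lemma pairing_pairing_tmul (c : ι → L' →ₗ[k] L'') (c' : ι → L →ₗ[k] L') (P P' : ι → Module.End k T)
    (y : L) (x : T) :
    pairing c P (pairing c' P' (y ⊗ₜ x)) = ∑ j, ∑ i, c i (c' j y) ⊗ₜ (P i * P' j) x := by
  rw [pairing_tmul, map_sum]
  simp [pairing_tmul]

/-- Pairing anticommuting with commuting operators gives a differential. -/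
lemma pairing_sq [CharZero k] {c : ι → L' →ₗ[k] L''} {c' : ι → L →ₗ[k] L'} {P : ι → Module.End k T}
    (hc : ∀ i j y, c i (c' j y) = -c j (c' i y)) (hP : ∀ i j, P i * P j = P j * P i) (z : L ⊗[k] T) :
    pairing c P (pairing c' P z) = 0 := by
  induction z with
  | zero => simp
  | tmul y x =>
    -- Exchanging the summation indices costs one sign, from the anticommuting factor only. An
    -- element equal to its own negative is zero because 2 is invertible.
    have h : pairing c P (pairing c' P (y ⊗ₜ x)) = - pairing c P (pairing c' P (y ⊗ₜ x)) := by
      rw [pairing_pairing_tmul]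
      conv_rhs => rw [Finset.sum_comm]
      rw [← Finset.sum_neg_distrib]
      refine Finset.sum_congr rfl fun j _ => ?_
      rw [← Finset.sum_neg_distrib]
      refine Finset.sum_congr rfl fun i _ => ?_
      rw [hc i j, hP i j, TensorProduct.neg_tmul]
    have h2 : (2 : k) • pairing c P (pairing c' P (y ⊗ₜ x)) = 0 := by
      rw [two_smul]
      nth_rewrite 1 [h]
      rw [neg_add_cancel]
    exact (smul_eq_zero.1 h2).resolve_left two_ne_zero
  | add y z hy hz => simp only [map_add, hy, hz, add_zero]

lemma smul_pairing_sq [CharZero k] {r : k} {c : ι → L' →ₗ[k] L''} {c' : ι → L →ₗ[k] L'}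
    {P : ι → Module.End k T} (hc : ∀ i j y, c i (c' j y) = -c j (c' i y))
    (hP : ∀ i j, P i * P j = P j * P i) (z : L ⊗[k] T) :
    (r • pairing c P) ((r • pairing c' P) z) = 0 := by
  rw [LinearMap.smul_apply, LinearMap.smul_apply, map_smul, pairing_sq hc hP, smul_zero, smul_zero]

variable [DecidableEq ι]

lemma pairing_contract_zero {c : ι → L' →ₗ[k] L} {w : ι → L →ₗ[k] L'} {P Q : ι → Module.End k T}
    (h : ∀ i j y, c i (w j y) = if i = j then y else 0) (z : L ⊗[k] T) :
    pairing c P (pairing w Q z) = (∑ i, P i * Q i).lTensor L z := by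
  induction z with
  | zero => simp
  | tmul y x =>
    rw [pairing_pairing_tmul, LinearMap.lTensor_tmul, LinearMap.sum_apply, TensorProduct.tmul_sum]
    refine Finset.sum_congr rfl fun j _ => ?_
    rw [Finset.sum_eq_single j]
    · rw [h, if_pos rfl]
    · intro i _ hi
      rw [h, if_neg hi, TensorProduct.zero_tmul]
    · simp
  | add y z hy hz => simp only [map_add, hy, hz]

/-- The anticommutation and Weyl relations cancel the off-diagonal terms. The diagonal gives
polynomial degree plus exterior degree, both weighted by the inverse total degree, hence the
identity. -/
lemma pairing_contract_succ {c : ι → L' →ₗ[k] L} {w : ι → L →ₗ[k] L'} {c' : ι → L →ₗ[k] L''}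
    {w' : ι → L'' →ₗ[k] L} {P Q P' Q' : ι → Module.End k T} {H : Module.End k T} {r : k}
    (h : ∀ i j y, c i (w j y) + w' j (c' i y) = if i = j then y else 0)
    (hr : ∀ y, ∑ i, w' i (c' i y) = r • y)
    (hQ : ∀ i j, Q' j * P' i = (if i = j then H else 0) + P i * Q j)
    (h1 : ∑ i, P i * Q i + r • H = 1) (z : L ⊗[k] T) :
    pairing c P (pairing w Q z) + pairing w' Q' (pairing c' P' z) = z := by
  induction z with
  | zero => simp
  | tmul y x =>
    have e1 : ∀ i j, c i (w j y) ⊗ₜ[k] (P i * Q j) x + w' j (c' i y) ⊗ₜ[k] (Q' j * P' i) x =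
        (if i = j then y ⊗ₜ[k] (P i * Q j) x else 0) +
          if i = j then w' j (c' i y) ⊗ₜ[k] H x else 0 := by
      intro i j
      rw [hQ, LinearMap.add_apply, TensorProduct.tmul_add, add_left_comm, ← TensorProduct.add_tmul,
        h, add_comm]
      split_ifs <;> simp
    rw [pairing_pairing_tmul, pairing_pairing_tmul, Finset.sum_comm, ← Finset.sum_add_distrib]
    simp only [← Finset.sum_add_distrib, e1]
    simp only [Finset.sum_add_distrib, Finset.sum_ite_eq, Finset.mem_univ, if_true]
    rw [← TensorProduct.tmul_sum, ← TensorProduct.sum_tmul, hr, ← LinearMap.sum_apply,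
      TensorProduct.smul_tmul, ← TensorProduct.tmul_add, ← LinearMap.smul_apply,
      ← LinearMap.add_apply, h1, Module.End.one_apply]
  | add y z hy hz =>
    simp only [map_add]
    rw [add_add_add_comm, hy, hz]

lemma lTensor_pairing {T' : Type*} [AddCommGroup T'] [Module k T'] {c : ι → L →ₗ[k] L'}
    {P : ι → Module.End k T} {P' : ι → Module.End k T'} {f : T →ₗ[k] T'}
    (h : ∀ i x, f (P i x) = P' i (f x)) (z : L ⊗[k] T) :
    f.lTensor L' (pairing c P z) = pairing c P' (f.lTensor L z) := by
  induction z with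
  | zero => simp
  | tmul y x => simp [pairing_tmul, h]
  | add y z hy hz => simp only [map_add, hy, hz]

section Augmentation

variable {T' T'' : Type*} [AddCommGroup T'] [Module k T'] [AddCommGroup T''] [Module k T'']

lemma lTensor_lTensor_zero {f : T' →ₗ[k] T''} {g : T →ₗ[k] T'} (h : ∀ x, f (g x) = 0)
    (z : L ⊗[k] T) : f.lTensor L (g.lTensor L z) = 0 := by
  rw [← LinearMap.lTensor_comp_apply, show f ∘ₗ g = 0 from LinearMap.ext h, LinearMap.lTensor_zero,
    LinearMap.zero_apply]

lemma lTensor_lTensor_id {f : T' →ₗ[k] T} {g : T →ₗ[k] T'} (h : ∀ x, f (g x) = x)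
    (z : L ⊗[k] T) : f.lTensor L (g.lTensor L z) = z := by
  rw [← LinearMap.lTensor_comp_apply, show f ∘ₗ g = LinearMap.id from LinearMap.ext h,
    LinearMap.lTensor_id_apply]

lemma lTensor_add_lTensor {f : T' →ₗ[k] T} {g : T →ₗ[k] T'} {f' : T'' →ₗ[k] T} {g' : T →ₗ[k] T''}
    (h : ∀ x, f (g x) + f' (g' x) = x) (z : L ⊗[k] T) :
    f.lTensor L (g.lTensor L z) + f'.lTensor L (g'.lTensor L z) = z := by
  rw [← LinearMap.lTensor_comp_apply, ← LinearMap.lTensor_comp_apply, ← LinearMap.add_apply,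
    ← LinearMap.lTensor_add, show f ∘ₗ g + f' ∘ₗ g' = LinearMap.id from LinearMap.ext h,
    LinearMap.lTensor_id_apply]

lemma smul_lTensor_pairing {r r' : k} (hr : r + r' = 0) {c : ι → L →ₗ[k] L'}
    {P : ι → Module.End k T} {P' : ι → Module.End k T'} {f : T →ₗ[k] T'}
    (h : ∀ i x, f (P i x) = P' i (f x)) (z : L ⊗[k] T) :
    f.lTensor L' ((r • pairing c P) z) + (r' • pairing c P') (f.lTensor L z) = 0 := by
  rw [LinearMap.smul_apply, map_smul, lTensor_pairing h, LinearMap.smul_apply, ← add_smul, hr,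
    zero_smul]

lemma lTensor_smul_pairing_zero {r : k} {c : ι → L →ₗ[k] L'} {P : ι → Module.End k T}
    {f : T →ₗ[k] T'} (h : ∀ i x, f (P i x) = 0) (z : L ⊗[k] T) :
    f.lTensor L' ((r • pairing c P) z) = 0 := by
  rw [LinearMap.smul_apply, map_smul, lTensor_pairing (P' := fun _ => 0) h]
  simp [pairing]

lemma smul_pairing_lTensor_zero {r : k} {c : ι → L →ₗ[k] L'} {P : ι → Module.End k T}
    {f : T' →ₗ[k] T} (h : ∀ i x, P i (f x) = 0) (z : L ⊗[k] T') :
    (r • pairing c P) (f.lTensor L z) = 0 := by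
  rw [LinearMap.smul_apply, ← lTensor_pairing (P := fun _ => 0) (fun i x => by
    rw [h, LinearMap.zero_apply, map_zero])]
  simp [pairing]

variable (e : L ≃ₗ[k] k)

/-- The map `y ⊗ x ↦ e y • f x`. -/
def augment (f : T →ₗ[k] T') : L ⊗[k] T →ₗ[k] T' :=
  (TensorProduct.lid k _).toLinearMap ∘ₗ TensorProduct.map e.toLinearMap f

/-- The map `x ↦ e⁻¹ 1 ⊗ g x`. -/
def coaugment (g : T' →ₗ[k] T) : T' →ₗ[k] L ⊗[k] T := TensorProduct.mk k _ _ (e.symm 1) ∘ₗ g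

lemma augment_tmul (f : T →ₗ[k] T') (y : L) (x : T) : augment e f (y ⊗ₜ x) = e y • f x := by
  simp [augment]

lemma coaugment_apply (g : T' →ₗ[k] T) (x : T') : coaugment e g x = e.symm 1 ⊗ₜ g x := rfl

lemma augment_coaugment {f : T →ₗ[k] T'} {g : T' →ₗ[k] T} (h : ∀ x, f (g x) = x) (x : T') :
    augment e f (coaugment e g x) = x := by
  rw [coaugment_apply, augment_tmul, LinearEquiv.apply_symm_apply, one_smul, h]

lemma lTensor_eq_sub_coaugment {f : T →ₗ[k] T'} {g : T' →ₗ[k] T} {F : Module.End k T}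
    (h : ∀ x, F x = x - g (f x)) (z : L ⊗[k] T) :
    F.lTensor L z = z - coaugment e g (augment e f z) := by
  induction z with
  | zero => simp
  | tmul y x =>
    rw [LinearMap.lTensor_tmul, h, TensorProduct.tmul_sub, augment_tmul, map_smul, coaugment_apply,
      TensorProduct.smul_tmul', ← map_smul, smul_eq_mul, mul_one, LinearEquiv.symm_apply_apply]
  | add y z hy hz => simp only [map_add, hy, hz]; abel

lemma augment_smul_pairing {r : k} {c : ι → L' →ₗ[k] L} {P : ι → Module.End k T} {f : T →ₗ[k] T'}
    (h : ∀ i x, f (P i x) = 0) (z : L' ⊗[k] T) : augment e f ((r • pairing c P) z) = 0 := by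
  induction z with
  | zero => simp
  | tmul y x => simp [pairing_tmul, augment_tmul, h]
  | add y z hy hz => simp only [map_add, hy, hz, add_zero]

lemma smul_pairing_coaugment {r : k} {c : ι → L →ₗ[k] L'} {P : ι → Module.End k T} {g : T' →ₗ[k] T}
    (h : ∀ i x, P i (g x) = 0) (x : T') : (r • pairing c P) (coaugment e g x) = 0 := by
  simp [pairing_tmul, coaugment_apply, h]

lemma augment_lTensor {S S' : Type*} [AddCommGroup S] [Module k S] [AddCommGroup S'] [Module k S']
    {f : T →ₗ[k] T'} {f' : S →ₗ[k] S'} {D : S →ₗ[k] T} {D' : S' →ₗ[k] T'}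
    (h : ∀ x, f (D x) = D' (f' x)) (z : L ⊗[k] S) :
    augment e f (D.lTensor L z) = D' (augment e f' z) := by
  induction z with
  | zero => simp
  | tmul y x => rw [LinearMap.lTensor_tmul, augment_tmul, augment_tmul, map_smul, h]
  | add y z hy hz => simp only [map_add, hy, hz]

lemma lTensor_coaugment {S S' : Type*} [AddCommGroup S] [Module k S] [AddCommGroup S'] [Module k S']
    {g : T' →ₗ[k] T} {g' : S' →ₗ[k] S} {D : T →ₗ[k] S} {D' : T' →ₗ[k] S'}
    (h : ∀ x, D (g x) = g' (D' x)) (x : T') :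
    D.lTensor L (coaugment e g x) = coaugment e g' (D' x) := by
  rw [coaugment_apply, coaugment_apply, LinearMap.lTensor_tmul, h]

lemma smul_pairing_contract_zero {r : k} (hr : r * r = 1) {c : ι → L' →ₗ[k] L}
    {w : ι → L →ₗ[k] L'} {P Q : ι → Module.End k T}
    (h : ∀ i j y, c i (w j y) = if i = j then y else 0) {f : T →ₗ[k] T'} {g : T' →ₗ[k] T}
    (hf : ∀ x, (∑ i, P i * Q i) x = x - g (f x)) (z : L ⊗[k] T) :
    (r • pairing c P) ((r • pairing w Q) z) = z - coaugment e g (augment e f z) := by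
  rw [LinearMap.smul_apply, LinearMap.smul_apply, map_smul, smul_smul, hr, one_smul,
    pairing_contract_zero h, lTensor_eq_sub_coaugment e hf]

omit e in
lemma smul_pairing_contract_succ {r : k} (hr : r * r = 1) {c : ι → L' →ₗ[k] L} {w : ι → L →ₗ[k] L'}
    {c' : ι → L →ₗ[k] L''} {w' : ι → L'' →ₗ[k] L} {P Q P' Q' : ι → Module.End k T}
    {H : Module.End k T} {s : k} (h : ∀ i j y, c i (w j y) + w' j (c' i y) = if i = j then y else 0)
    (hs : ∀ y, ∑ i, w' i (c' i y) = s • y)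
    (hQ : ∀ i j, Q' j * P' i = (if i = j then H else 0) + P i * Q j)
    (h1 : ∑ i, P i * Q i + s • H = 1) (z : L ⊗[k] T) :
    (r • pairing c P) ((r • pairing w Q) z) + (r • pairing w' Q') ((r • pairing c' P') z) = z := by
  simp only [LinearMap.smul_apply, map_smul, smul_smul, hr, one_smul]
  exact pairing_contract_succ h hs hQ h1 z

end Augmentation

end Pairing

/-! ### The Koszul and de Rham bicomplexes. -/

section Koszul

open PolynomialBialgebra

variable (k : Type*) [Field k] [CharZero k] (A : Type*) [CommRing A] [Bialgebra k A]
  [PolynomialBialgebra k A]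

/-- The terms of the Koszul bicomplex. -/
abbrev KoszulTerm (p q : ℕ) : Type _ := Ext k (dim k A) q ⊗[k] (⨂[k]^(p + 1) A)

/-- The terms of the exterior powers with coefficients in `A^{⊗0}`. -/
abbrev ExtTerm (q : ℕ) : Type _ := Ext k (dim k A) q ⊗[k] (⨂[k]^0 A)

/-- The tail of the bar differential, extended to the Koszul bicomplex. -/
def koszulBar (p q : ℕ) : KoszulTerm k A (p + 1) q →ₗ[k] KoszulTerm k A p q :=
  (barTail k A (p + 1)).lTensor _

/-- The tail of the cobar differential, extended to the Koszul bicomplex. -/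
def koszulCobar (p q : ℕ) : KoszulTerm k A p q →ₗ[k] KoszulTerm k A (p + 1) q :=
  (cobarTail k A (p + 1)).lTensor _

/-- The Koszul differential. -/
def koszulD (p q : ℕ) : KoszulTerm k A p (q + 1) →ₗ[k] KoszulTerm k A p q :=
  (-1 : k) ^ p • pairing (contract q) fun i => onHead k A p (mulVar k A i)

/-- The contraction of the Koszul differential. -/
def koszulT (p q : ℕ) : KoszulTerm k A p q →ₗ[k] KoszulTerm k A p (q + 1) :=
  (-1 : k) ^ p • pairing (wedge q) fun i => onHead k A p (deriv k A i * invDegree k A q)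

/-- The de Rham differential. -/
def deRhamD (p q : ℕ) : KoszulTerm k A p q →ₗ[k] KoszulTerm k A p (q + 1) :=
  (-1 : k) ^ p • pairing (wedge q) fun i => onHead k A p (deriv k A i)

/-- The contraction of the de Rham differential. -/
def deRhamT (p q : ℕ) : KoszulTerm k A p (q + 1) →ₗ[k] KoszulTerm k A p q :=
  (-1 : k) ^ p • pairing (contract q) fun i => onHead k A p (mulVar k A i * invDegree k A (q + 1))

/-- The augmentation of the columns of the Koszul bicomplex. -/
def koszulAug (p : ℕ) : KoszulTerm k A p 0 →ₗ[k] ⨂[k]^p A :=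
  augment (exteriorPower.zeroEquiv k _) (counitL k A p)

/-- The coaugmentation of the columns of the Koszul bicomplex. -/
def koszulSec (p : ℕ) : ⨂[k]^p A →ₗ[k] KoszulTerm k A p 0 :=
  coaugment (exteriorPower.zeroEquiv k _) (consR k A p).toLinearMap

variable {k A}

lemma neg_one_pow_mul_self (p : ℕ) : (-1 : k) ^ p * (-1 : k) ^ p = 1 := by
  rw [← mul_pow, neg_one_mul, neg_neg, one_pow]

lemma neg_one_pow_succ_add (p : ℕ) : (-1 : k) ^ (p + 1) + (-1 : k) ^ p = 0 := by
  rw [pow_succ, mul_neg, mul_one, neg_add_cancel]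

lemma onHead_deriv_mulVar (p q : ℕ) (i j : Fin (dim k A)) :
    onHead k A p (deriv k A j * mulVar k A i * invDegree k A (q + 1)) =
      (if i = j then onHead k A p (invDegree k A (q + 1)) else 0) +
        onHead k A p (mulVar k A i * deriv k A j * invDegree k A (q + 1)) := by
  rw [deriv_mulVar, add_mul, map_add]
  split_ifs <;> simp

lemma onHead_euler_succ (p q : ℕ) :
    ∑ i, onHead k A p (mulVar k A i * deriv k A i * invDegree k A (q + 1)) +
      ((q : k) + 1) • onHead k A p (invDegree k A (q + 1)) = 1 := by
  rw [← map_sum, ← map_smul, ← map_add, euler_invDegree_succ, map_one]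

lemma koszulD_koszulT_zero (p : ℕ) (z : KoszulTerm k A p 0) :
    koszulD k A p 0 (koszulT k A p 0 z) = z - koszulSec k A p (koszulAug k A p z) := by
  refine smul_pairing_contract_zero _ (neg_one_pow_mul_self p) contract_wedge_zero (fun x => ?_) z
  rw [AlgHom.toLinearMap_apply, ← onHead_euler, map_sum]
  simp only [map_mul, mul_assoc]

lemma koszulD_koszulT_succ (p q : ℕ) (z : KoszulTerm k A p (q + 1)) :
    koszulD k A p (q + 1) (koszulT k A p (q + 1) z) + koszulT k A p q (koszulD k A p q z) = z := by
  refine smul_pairing_contract_succ (neg_one_pow_mul_self p)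
    (H := onHead k A p (invDegree k A (q + 1))) (contract_wedge q)
    (sum_wedge_contract q) (fun i j => ?_) ?_ z
  · rw [← map_mul, ← map_mul, mul_assoc, invDegree_mulVar, ← mul_assoc, ← mul_assoc,
      onHead_deriv_mulVar]
  · simp only [← map_mul (onHead k A p), ← mul_assoc]
    exact onHead_euler_succ p q

lemma koszulD_koszulD (p q : ℕ) (z : KoszulTerm k A p (q + 2)) :
    koszulD k A p q (koszulD k A p (q + 1) z) = 0 :=
  smul_pairing_sq (contract_anticomm q)
    (fun i j => by rw [← map_mul (onHead k A p), ← map_mul (onHead k A p), mulVar_comm]) z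

lemma koszulBar_koszulBar (p q : ℕ) (z : KoszulTerm k A (p + 2) q) :
    koszulBar k A p q (koszulBar k A (p + 1) q z) = 0 :=
  lTensor_lTensor_zero (barTail_barTail (p + 1)) z

/-- The two operators commute since `barTail` is linear in the first factor; the sign `(-1)^p` in
`koszulD` turns this into anticommutation. -/
lemma koszulBar_koszulD (p q : ℕ) (z : KoszulTerm k A (p + 1) (q + 1)) :
    koszulBar k A p q (koszulD k A (p + 1) q z) + koszulD k A p q (koszulBar k A p (q + 1) z) = 0 :=
  smul_lTensor_pairing (neg_one_pow_succ_add p) (fun i => barTail_onHead p i) z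

variable (k A) in
/-- The columns of the Koszul bicomplex resolve the bar complex. -/
def koszulColumns : ColumnContraction (E := KoszulTerm k A) (B := fun p => ⨂[k]^p A)
    (koszulBar k A) (koszulD k A) (barD k A) where
  aug := koszulAug k A
  sec := koszulSec k A
  t := koszulT k A
  aug_sec p := augment_coaugment _ (counitL_consR p)
  aug_vert p := augment_smul_pairing _ (counitL_onHead p)
  aug_horiz p := augment_lTensor _ (counitL_barTail p)
  t_zero := koszulD_koszulT_zero
  t_succ := koszulD_koszulT_succ

variable (k A) in
/-- The rows of the Koszul bicomplex are contractible. -/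
def koszulRows : ColumnContraction (E := fun p q => KoszulTerm k A q p) (B := ExtTerm k A)
    (fun p q => koszulD k A q p) (fun p q => koszulBar k A q p)
    (fun q => (0 : ExtTerm k A (q + 1) →ₗ[k] ExtTerm k A q)) where
  aug _ := (barTail k A 0).lTensor _
  sec _ := (consR k A 0).toLinearMap.lTensor _
  t _ p := (consR k A (p + 1)).toLinearMap.lTensor _
  aug_sec _ := lTensor_lTensor_id barTail_zero_consR
  aug_vert _ := lTensor_lTensor_zero (barTail_barTail 0)
  -- The induced differential on the exterior powers is zero because the variables act on the
  -- trivial module through the counit.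
  aug_horiz _ := lTensor_smul_pairing_zero barTail_zero_onHead
  t_zero _ z := eq_sub_of_add_eq (lTensor_add_lTensor
    (fun x => eq_sub_iff_add_eq.1 (barTail_consR 0 x)) z)
  t_succ _ p := lTensor_add_lTensor fun x => eq_sub_iff_add_eq.1 (barTail_consR (p + 1) x)

-- The same bicomplex computes the bar homology by columns and, by rows, the exterior powers with
-- zero differential.
variable (k A) in
theorem nonempty_homology_barD_equiv (n : ℕ) :
    Nonempty (homology (B := fun p => ⨂[k]^p A) (barD k A) n ≃ₗ[k] ExtTerm k A n) := by
  obtain ⟨e⟩ := nonempty_homology_equiv (koszulColumns k A) (koszulRows k A) koszulBar_koszulBar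
    koszulD_koszulD koszulBar_koszulD n
  obtain ⟨e'⟩ := nonempty_homology_zero (k := k) (B := ExtTerm k A) n
  exact ⟨e.trans e'⟩

lemma deRhamT_deRhamD_zero (p : ℕ) (z : KoszulTerm k A p 0) :
    deRhamT k A p 0 (deRhamD k A p 0 z) = z - koszulSec k A p (koszulAug k A p z) := by
  refine smul_pairing_contract_zero _ (neg_one_pow_mul_self p) contract_wedge_zero (fun x => ?_) z
  rw [AlgHom.toLinearMap_apply, ← onHead_euler, map_sum]
  simp only [← map_mul (onHead k A p), mul_assoc, invDegree_deriv]

lemma deRhamT_deRhamD_succ (p q : ℕ) (z : KoszulTerm k A p (q + 1)) :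
    deRhamT k A p (q + 1) (deRhamD k A p (q + 1) z) + deRhamD k A p q (deRhamT k A p q z) = z := by
  refine smul_pairing_contract_succ (neg_one_pow_mul_self p)
    (H := onHead k A p (invDegree k A (q + 1))) (contract_wedge q)
    (sum_wedge_contract q) (fun i j => ?_) ?_ z
  · rw [← map_mul, ← map_mul, mul_assoc (mulVar k A i), invDegree_deriv, ← mul_assoc, ← mul_assoc,
      onHead_deriv_mulVar]
  · simp only [← map_mul (onHead k A p), mul_assoc, invDegree_deriv]
    simp only [← mul_assoc]
    exact onHead_euler_succ p q

lemma deRhamD_deRhamD (p q : ℕ) (z : KoszulTerm k A p q) :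
    deRhamD k A p (q + 1) (deRhamD k A p q z) = 0 :=
  smul_pairing_sq (wedge_anticomm q)
    (fun i j => by rw [← map_mul (onHead k A p), ← map_mul (onHead k A p), deriv_comm]) z

lemma koszulCobar_koszulCobar (p q : ℕ) (z : KoszulTerm k A p q) :
    koszulCobar k A (p + 1) q (koszulCobar k A p q z) = 0 :=
  lTensor_lTensor_zero (cobarTail_cobarTail (p + 1)) z

lemma koszulCobar_deRhamD (p q : ℕ) (z : KoszulTerm k A p q) :
    koszulCobar k A p (q + 1) (deRhamD k A p q z) +
      deRhamD k A (p + 1) q (koszulCobar k A p q z) = 0 :=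
  smul_lTensor_pairing ((add_comm _ _).trans (neg_one_pow_succ_add p))
    (fun i => cobarTail_onHead p i) z

variable (k A) in
/-- The duals of the columns of the de Rham bicomplex resolve the dual of the cobar complex. -/
def deRhamColumns : ColumnContraction (E := fun p q => Module.Dual k (KoszulTerm k A p q))
    (B := fun p => Module.Dual k (⨂[k]^p A)) (fun p q => (koszulCobar k A p q).dualMap)
    (fun p q => (deRhamD k A p q).dualMap) (fun p => (cobarD k A p).dualMap) where
  -- Dualising reverses arrows, so augmentation and section change places.
  aug p := (koszulSec k A p).dualMap
  sec p := (koszulAug k A p).dualMap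
  t p q := (deRhamT k A p q).dualMap
  aug_sec p φ := LinearMap.ext fun x => congrArg φ (augment_coaugment _ (counitL_consR p) x)
  aug_vert p φ := LinearMap.ext fun x => (congrArg φ
    (smul_pairing_coaugment _ (onHead_deriv_consR p) x)).trans (map_zero φ)
  aug_horiz p φ := LinearMap.ext fun x => congrArg φ (lTensor_coaugment _ (cobarTail_consR p) x)
  t_zero p φ := LinearMap.ext fun x => (congrArg φ (deRhamT_deRhamD_zero p x)).trans (map_sub φ _ _)
  t_succ p q φ := LinearMap.ext fun x => (map_add φ _ _).symm.trans
    (congrArg φ (deRhamT_deRhamD_succ p q x))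

variable (k A) in
/-- The duals of the rows of the de Rham bicomplex are contractible. -/
def deRhamRows : ColumnContraction (E := fun p q => Module.Dual k (KoszulTerm k A q p))
    (B := fun q => Module.Dual k (ExtTerm k A q)) (fun p q => (deRhamD k A q p).dualMap)
    (fun p q => (koszulCobar k A q p).dualMap)
    (fun q => (0 : Module.Dual k (ExtTerm k A (q + 1)) →ₗ[k] Module.Dual k (ExtTerm k A q))) where
  aug q := ((cobarTail k A 0).lTensor _).dualMap
  sec q := ((counitL k A 0).lTensor _).dualMap
  t q p := ((counitL k A (p + 1)).lTensor _).dualMap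
  aug_sec q φ := LinearMap.ext fun x => congrArg φ (lTensor_lTensor_id counitL_cobarTail_zero x)
  aug_vert q φ := LinearMap.ext fun x => (congrArg φ
    (lTensor_lTensor_zero (cobarTail_cobarTail 0) x)).trans (map_zero φ)
  -- Here the induced differential vanishes because `cobarTail` in degree 0 inserts a unit, whose
  -- derivatives are zero.
  aug_horiz q φ := LinearMap.ext fun x => (congrArg φ (smul_pairing_lTensor_zero
    (fun i y => by rw [cobarTail_zero, onHead_deriv_consR]) x)).trans (map_zero φ)
  t_zero q φ := LinearMap.ext fun x => (congrArg φ (eq_sub_of_add_eq (lTensor_add_lTensor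
    (counitL_cobarTail 0) x))).trans (map_sub φ _ _)
  t_succ q p φ := LinearMap.ext fun x => (map_add φ _ _).symm.trans
    (congrArg φ (lTensor_add_lTensor (counitL_cobarTail (p + 1)) x))

variable (k A) in
theorem nonempty_homology_dualMap_cobarD_equiv (n : ℕ) :
    Nonempty (homology (B := fun p => Module.Dual k (⨂[k]^p A)) (fun p => (cobarD k A p).dualMap) n
      ≃ₗ[k] Module.Dual k (ExtTerm k A n)) := by
  obtain ⟨e⟩ := nonempty_homology_equiv (deRhamColumns k A) (deRhamRows k A)
    (fun p q φ => LinearMap.ext fun x =>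
      (congrArg φ (koszulCobar_koszulCobar p q x)).trans (map_zero φ))
    (fun p q φ => LinearMap.ext fun x => (congrArg φ (deRhamD_deRhamD p q x)).trans (map_zero φ))
    (fun p q φ => LinearMap.ext fun x => (map_add φ _ _).symm.trans
      ((congrArg φ ((add_comm _ _).trans (koszulCobar_deRhamD p q x))).trans (map_zero φ))) n
  obtain ⟨e'⟩ := nonempty_homology_zero (k := k) (B := fun q => Module.Dual k (ExtTerm k A q)) n
  exact ⟨e.trans e'⟩

end Koszul

/-! ### Dimension count and conclusion. -/

section Cohomology

/-- Needed because the cobar side is known only after dualising. A space over a field is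
finite-dimensional as soon as its dual is, and then has the same dimension. -/
lemma finite_and_finrank_of_dual_equiv {k U W : Type*} [Field k] [AddCommGroup U] [Module k U]
    [AddCommGroup W] [Module k W] [Module.Finite k U] (e : Module.Dual k U ≃ₗ[k] Module.Dual k W) :
    Module.Finite k W ∧ Module.finrank k W = Module.finrank k U := by
  refine ⟨(Module.finite_dual_iff k).1 (Module.Finite.equiv e), ?_⟩
  rw [← Subspace.dual_finrank_eq, ← e.finrank_eq, Subspace.dual_finrank_eq]

lemma nonempty_hom_equiv_tensorProduct {k U W M N : Type*} [Field k] [AddCommGroup U] [Module k U]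
    [AddCommGroup W] [Module k W] [AddCommGroup M] [Module k M] [AddCommGroup N] [Module k N]
    [Module.Finite k U] [Module.Finite k W] [Module.Finite k M] [Module.Finite k N]
    (h : Module.finrank k U = Module.finrank k M) (h' : Module.finrank k W = Module.finrank k N) :
    Nonempty ((U →ₗ[k] W) ≃ₗ[k] M ⊗[k] N) := by
  refine FiniteDimensional.nonempty_linearEquiv_of_finrank_eq ?_
  rw [Module.finrank_linearMap, Module.finrank_tensorProduct, h, h']

open PolynomialBialgebra

section Twist

variable (k : Type*) [Field k] (A : Type*) [CommRing A] [Bialgebra k A] [PolynomialBialgebra k A]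

/-- The automorphism `twist` in all bidegrees. -/
def twistAll : Bicochain k A ≃ₗ[k] Bicochain k A where
  toFun Φ := Bicochain.of fun m n => twist m n (Φ m n)
  invFun Φ := Bicochain.of fun m n => (twist m n).symm (Φ m n)
  map_add' _ _ := Bicochain.ext fun m n => map_add (twist m n) _ _
  map_smul' r _ := Bicochain.ext fun m n => map_smul (twist m n) r _
  left_inv _ := Bicochain.ext fun m n => (twist m n).symm_apply_apply _
  right_inv _ := Bicochain.ext fun m n => (twist m n).apply_symm_apply _

variable {k A}

lemma twistAll_apply (Φ : Bicochain k A) (m n : ℕ) : twistAll k A Φ m n = twist m n (Φ m n) := rfl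

lemma twistAll_mem_cochains (p : ℕ) (Φ : Bicochain k A) :
    twistAll k A Φ ∈ cochains k A p ↔ Φ ∈ cochains k A p :=
  forall₃_congr fun m n _ => (twist m n).map_eq_zero_iff

lemma differential_twistAll (Φ : Bicochain k A) : differential k A (twistAll k A Φ) =
    twistAll k A (homDifferential (barD k A) (cobarD k A) Φ) := by
  refine Bicochain.ext fun m n => ?_
  rw [twistAll_apply, homDifferential, LinearMap.add_apply, Module.End.mul_apply,
    Bicochain.add_apply, conjugate_apply]
  cases m with
  | zero =>
    cases n with
    | zero =>
      rw [differential_zero_zero, precompSucc_zero, postcompSucc_zero]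
      simp
    | succ n =>
      rw [differential_zero_succ, twistAll_apply, d₂_twist, precompSucc_zero, postcompSucc_succ,
        zero_add, pow_zero, one_smul]
      rfl
  | succ m =>
    cases n with
    | zero =>
      rw [differential_succ_zero, twistAll_apply, d₁_twist, precompSucc_succ, postcompSucc_zero]
      simp
    | succ n =>
      rw [differential_succ_succ, twistAll_apply, twistAll_apply, d₁_twist, d₂_twist,
        precompSucc_succ, postcompSucc_succ, map_add, map_smul]
      rfl

end Twist

variable (k : Type*) [Field k] [CharZero k] (A : Type*) [CommRing A] [Bialgebra k A]
  [PolynomialBialgebra k A]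

omit [CharZero k] in
lemma finite_extTerm (n : ℕ) : Module.Finite k (ExtTerm k A n) :=
  have : Module.Finite k (⨂[k]^0 A) :=
    Module.Finite.equiv (PiTensorProduct.isEmptyEquiv (R := k) (s := fun _ : Fin 0 => A) (Fin 0)).symm
  inferInstance

omit [CharZero k] in
lemma finrank_extTerm (n : ℕ) : Module.finrank k (ExtTerm k A n) = (dim k A).choose n := by
  rw [Module.finrank_tensorProduct, exteriorPower.finrank_eq, Module.finrank_fin_fun,
    (PiTensorProduct.isEmptyEquiv (R := k) (s := fun _ : Fin 0 => A) (Fin 0)).finrank_eq,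
    Module.finrank_self, mul_one]

lemma finite_and_finrank_range_of_splitting {h : ∀ m, ⨂[k]^m A →ₗ[k] ⨂[k]^(m + 1) A}
    {π : ∀ m, ⨂[k]^m A →ₗ[k] ⨂[k]^m A} (S : Splitting (B := fun m => ⨂[k]^m A) (barD k A) h π)
    (n : ℕ) : Module.Finite k (LinearMap.range (π n)) ∧
      Module.finrank k (LinearMap.range (π n)) = (dim k A).choose n := by
  obtain ⟨e⟩ := S.nonempty_homology_equiv n
  obtain ⟨e'⟩ := nonempty_homology_barD_equiv k A n
  have := finite_extTerm k A n
  exact ⟨Module.Finite.equiv (e'.symm.trans e),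
    (e.symm.trans e').finrank_eq.trans (finrank_extTerm k A n)⟩

/-- The dual of the splitting identifies the homology of the dual cobar complex with the range of
the transposed projection, which is the dual of the range of `π`. -/
lemma finite_and_finrank_range_of_cosplitting {f : ∀ m, ⨂[k]^(m + 1) A →ₗ[k] ⨂[k]^m A}
    {π : ∀ m, ⨂[k]^m A →ₗ[k] ⨂[k]^m A} (S : Splitting (B := fun m => ⨂[k]^m A) f (cobarD k A) π)
    (n : ℕ) : Module.Finite k (LinearMap.range (π n)) ∧
      Module.finrank k (LinearMap.range (π n)) = (dim k A).choose n := by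
  obtain ⟨e⟩ := S.dual.nonempty_homology_equiv n
  obtain ⟨e'⟩ := nonempty_homology_dualMap_cobarD_equiv k A n
  obtain ⟨e''⟩ := nonempty_dual_range_equiv (π n)
  have := finite_extTerm k A n
  rw [← finrank_extTerm k A n]
  exact finite_and_finrank_of_dual_equiv (U := ExtTerm k A n) (W := LinearMap.range (π n))
    ((e'.symm.trans e).trans e''.symm)

/-- The Gerstenhaber–Schack cohomology of a polynomial bialgebra. -/
theorem nonempty_cohomology_polynomial_equiv (V : Type*) [AddCommGroup V] [Module k V]
    [FiniteDimensional k V] (hV : Module.finrank k V = dim k A) (p : ℕ) :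
    Nonempty (cohomology k A p ≃ₗ[k]
      DirectSum (Finset.HasAntidiagonal.antidiagonal p) fun ij =>
        (⋀[k]^(ij.1.1) V) ⊗[k] (⋀[k]^(ij.1.2) (Module.Dual k V))) := by
  obtain ⟨h, π, S⟩ := exists_splitting (B := fun m => ⨂[k]^m A) (f := barD k A) barD_comp_barD
  obtain ⟨f', π', S'⟩ :=
    exists_cosplitting (B := fun m => ⨂[k]^m A) (f := cobarD k A) cobarD_comp_cobarD
  obtain ⟨e⟩ := nonempty_cohomology_equiv S S' (twistAll k A) twistAll_mem_cochains
    differential_twistAll p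
  -- Only dimensions are compared: both sides have dimension `d.choose i * d.choose j`. Hence it
  -- does not matter which of `V` and its dual is attached to the bar side.
  have key : ∀ i j, Nonempty ((LinearMap.range (π i) →ₗ[k] LinearMap.range (π' j)) ≃ₗ[k]
      (⋀[k]^i V) ⊗[k] (⋀[k]^j (Module.Dual k V))) := by
    intro i j
    obtain ⟨h1, h2⟩ := finite_and_finrank_range_of_splitting k A S i
    obtain ⟨h3, h4⟩ := finite_and_finrank_range_of_cosplitting k A S' j
    refine nonempty_hom_equiv_tensorProduct ?_ ?_
    · rw [exteriorPower.finrank_eq, hV, h2]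
    · rw [exteriorPower.finrank_eq, Subspace.dual_finrank_eq, hV, h4]
  exact ⟨e ≪≫ₗ LinearEquiv.piCongrRight (fun ij => (key ij.1.1 ij.1.2).some) ≪≫ₗ
    (DirectSum.linearEquivFunOnFintype k _ _).symm⟩

end Cohomology

/-- The symmetric algebra of a finite-dimensional space is a polynomial bialgebra. -/
@[reducible] def polynomialBialgebraSymmetricAlgebra (k : Type*) [Field k] (V : Type*)
    [AddCommGroup V] [Module k V] [FiniteDimensional k V] :
    PolynomialBialgebra k (SymmetricAlgebra k V) where
  dim := Module.finrank k V
  equiv := (SymmetricAlgebra.equivMvPolynomial (Module.finBasis k V)).symm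
  comul_X i := by
    rw [SymmetricAlgebra.equivMvPolynomial_symm_X, SymmetricAlgebra.comul_ι]
  counit_X i := by
    rw [SymmetricAlgebra.equivMvPolynomial_symm_X, SymmetricAlgebra.counit_ι]

end GerstenhaberSchack

end

theorem mainTheorem9 (k : Type*) [Field k] [CharZero k] (V : Type*) [AddCommGroup V] [Module k V]
    [FiniteDimensional k V] (p : ℕ) :
    Nonempty (GerstenhaberSchack.cohomology k (SymmetricAlgebra k V) p ≃ₗ[k]
      DirectSum (Finset.HasAntidiagonal.antidiagonal p) fun ij =>
        (⋀[k]^(ij.1.1) V) ⊗[k] (⋀[k]^(ij.1.2) (Module.Dual k V))) :=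
  letI := GerstenhaberSchack.polynomialBialgebraSymmetricAlgebra k V
  GerstenhaberSchack.nonempty_cohomology_polynomial_equiv k (SymmetricAlgebra k V) V rfl p
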